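/- **Setting.** Let $g,m,\ell>0$ and let $P_-,P_+\in C^\infty((0,\infty))$ be nonnegative and strictly increasing with $1/P_\pm'\in L^\infty_{loc}((0,\infty))$. Put $h_\pm(z)=\int_1^z P_\pm'(r)/r\,dr$. Let $\rho_0^->0$ satisfy $P_-(\rho_0^-)>P_+(\rho_0^-)$ and $P_-(\rho_0^-)\in P_+((0,\infty))$, put $\rho_0^+=P_+^{-1}(P_-(\rho_0^-))$, and assume $h_-(\rho_0^-)+gm\in h_-((0,\infty))$ and $h_+(\rho_0^+)-g\ell\in h_+((0,\infty))$. Let $I_-=(-m,0)$, $I_+=(0,\ell)$, $\Omega_\pm=\mathbb R^2\times I_\pm$, and let $\rho_0(x_3)=h_\pm^{-1}(h_\pm(\rho_0^\pm)-gx_3)$ in $\Omega_\pm$. Write $P'(\rho_0)$ for $P'_\pm(\rho_0)$ in $\Omega_\pm$, and $[\![f]\!]=f_+|_{x_3=0}-f_-|_{x_3=0}$. The *linearized problem* for $\eta,v$ ($\mathbb R^3$-valued) and $q$ (scalar) is $$\partial_t\eta=v,\qquad \partial_t q+\rho_0\,\mathrm{div}\,v=0,\qquad \rho_0\partial_t v+\nabla(P'(\rho_0)q)=-g\,q\,e_3-g\rho_0\nabla(e_3\cdot\eta)$$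 in $\Omega_\pm$ for $t\ge0$, with the jump conditions $[\![v\cdot e_3]\!]=0$, $[\![P'(\rho_0)q]\!]=0$ and the boundary conditions $v\cdot e_3=0$ at $x_3=-m$ and at $x_3=\ell$. A solution is classical: on each of the two sides, $\eta,v,q$ are $C^1$ on $[0,\infty)\times\Omega_\pm$ and continuous on $[0,\infty)\times\overline{\Omega_\pm}$. For $k\in\mathbb N=\{0,1,2,\dots\}$, $H^k(\Omega)$ is the piecewise Sobolev space of all $f$ whose restrictions $f_\pm$ to $\Omega_\pm$ lie in $H^k(\Omega_\pm)$, with norm $$\|f\|_{H^k}^2=\sum_{\pm}\sum_{i=0}^k\int_{\mathbb R^2\times I_\pm}(1+|\xi|^2)^{k-i}\,|\partial_{x_3}^i\hat f_\pm(\xi,x_3)|^2\,d\xi\,dx_3,$$ where $\hat f(\xi,x_3)=\int_{\mathbb R^2}f(x',x_3)e^{-ix'\cdot\xi}\,dx'$; for vector fields the squares are summed over the components. Write $\|(\eta,v,q)\|_{H^k}=\|\eta\|_{H^k}+\|v\|_{H^k}+\|q\|_{H^k}$. **Theorem 4.5.** The linearized problem, with its jump and boundary conditions, is ill-posed in the sense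 of Hadamard in $H^k(\Omega)$ for every $k\in\mathbb N$: for no $T>0$ do solutions with values in $H^k(\Omega)$ depend continuously, in $H^k(\Omega)$ and uniformly on $[0,T]$, on their initial data in $H^k(\Omega)$. More precisely, for all $k,j\in\mathbb N$ with $j\ge k$, all $T_0>0$ and all $\alpha>0$ there is a sequence $\{(\eta_n,v_n,q_n)\}_{n\ge1}$ of solutions of the linearized problem, satisfying the jump and boundary conditions and with $\eta_n(t),v_n(t),q_n(t)\in H^j(\Omega)$ for all $t\ge0$, such that $$\|\eta_n(0)\|_{H^j}+\|v_n(0)\|_{H^j}+\|q_n(0)\|_{H^j}\le\frac1n,$$ but $$\|v_n(t)\|_{H^k}\ge\|\eta_n(t)\|_{H^k}\ge\alpha\qquad\text{for all }t\ge T_0.$$ -/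

import Mathlib

open MeasureTheory Set
open scoped ENNReal ContDiff FourierTransform

noncomputable section

namespace RT

/-- The two fluids: the lower one (index `-`) and the upper one (index `+`). -/
inductive Phase : Type
  | lower
  | upper

/-- Points `x = (x', x₃)` of `ℝ² × ℝ`. -/
abbrev Pt : Type := EuclideanSpace ℝ (Fin 2) × ℝ

/-- The enthalpy `h(z) = ∫₁ᶻ P'(r) / r dr` of a pressure law `P`. -/
def enthalpy (P : ℝ → ℝ) (z : ℝ) : ℝ := ∫ r in (1 : ℝ)..z, deriv P r / r

/-- The physical data: the pressure laws `P₋, P₊`, the gravitational constant `g`, the depth `m`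
of the lower fluid, the height `ℓ` of the upper one, and the density `ρ₀⁻` of the lower fluid at
the interface. -/
structure Config where
  P : Phase → ℝ → ℝ
  g : ℝ
  m : ℝ
  ℓ : ℝ
  rhoMinus : ℝ

namespace Config

/-- The density of the lower / upper fluid at the interface; `ρ₀⁺ = P₊⁻¹(P₋(ρ₀⁻))`. -/
def rhoAt (c : Config) : Phase → ℝ
  | .lower => c.rhoMinus
  | .upper => Function.invFunOn (c.P .upper) (Ioi 0) (c.P .lower c.rhoMinus)

/-- The steady density profile `ρ₀(x₃) = h⁻¹(h(ρ₀^±) - g x₃)` in each fluid. -/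
def rho0 (c : Config) (s : Phase) (z : ℝ) : ℝ :=
  Function.invFunOn (enthalpy (c.P s)) (Ioi 0) (enthalpy (c.P s) (c.rhoAt s) - c.g * z)

/-- The standing assumptions on the data. -/
structure Admissible (c : Config) : Prop where
  g_pos : 0 < c.g
  m_pos : 0 < c.m
  ℓ_pos : 0 < c.ℓ
  P_nonneg : ∀ s, ∀ z ∈ Ioi (0 : ℝ), 0 ≤ c.P s z
  P_smooth : ∀ s, ContDiffOn ℝ ∞ (c.P s) (Ioi 0)
  P_strictMono : ∀ s, StrictMonoOn (c.P s) (Ioi 0)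
  /-- `1 / P'` is locally bounded in `(0, ∞)` (with `1 / 0 = ∞`). -/
  P_inv_deriv : ∀ s, ∀ K ⊆ Ioi (0 : ℝ), IsCompact K → ∃ B : ℝ, ∀ z ∈ K, 1 ≤ B * deriv (c.P s) z
  /-- `ρ₀⁻` lies in the set `Z`: the upper fluid is denser at the interface. -/
  rhoMinus_pos : 0 < c.rhoMinus
  rhoMinus_gt : c.P .upper c.rhoMinus < c.P .lower c.rhoMinus
  rhoMinus_mem : c.P .lower c.rhoMinus ∈ c.P .upper '' Ioi 0
  /-- The steady density is defined and positive up to the bottom and the top of the slab. -/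
  bottom_mem : enthalpy (c.P .lower) (c.rhoAt .lower) + c.g * c.m ∈
    enthalpy (c.P .lower) '' Ioi 0
  top_mem : enthalpy (c.P .upper) (c.rhoAt .upper) - c.g * c.ℓ ∈
    enthalpy (c.P .upper) '' Ioi 0

/-- `P'(ρ₀)` in each fluid, as a function of `x₃`. -/
def dP (c : Config) (s : Phase) (z : ℝ) : ℝ := deriv (c.P s) (c.rho0 s z)

/-- The vertical interval of each fluid: `I₋ = (-m, 0)`, `I₊ = (0, ℓ)`. -/
def interval (c : Config) : Phase → Set ℝ
  | .lower => Ioo (-c.m) 0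
  | .upper => Ioo 0 c.ℓ

/-- The slabs `Ω₋ = ℝ² × (-m, 0)` and `Ω₊ = ℝ² × (0, ℓ)`. -/
def slab (c : Config) (s : Phase) : Set Pt := univ ×ˢ c.interval s

end Config

/-! ### Piecewise Sobolev spaces -/

/-- The Fourier transform `∫ u(x') e^{-i x'·ξ} dx'` of a function in `L²(ℝ²)` (that is, its
extension from `L¹ ∩ L²`, defined almost everywhere); Mathlib's transform has the kernel
`e^{-2πi x'·ζ}`, whence the rescaling. -/
def hft (u : EuclideanSpace ℝ (Fin 2) → ℂ) (hu : MemLp u 2 volume)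
    (ξ : EuclideanSpace ℝ (Fin 2)) : ℂ :=
  (𝓕 (hu.toLp u) : Lp ℂ 2 (volume : Measure (EuclideanSpace ℝ (Fin 2)))) ((2 * Real.pi)⁻¹ • ξ)

open Classical in
/-- `∫ (1 + |ξ|²)^r |û(ξ)|² dξ`, which is `∞` if `u` is not in `L²(ℝ²)`. -/
def horizontalSq (r : ℕ) (u : EuclideanSpace ℝ (Fin 2) → ℝ) : ℝ≥0∞ :=
  if hu : MemLp (fun y => (u y : ℂ)) 2 volume then
    ∫⁻ ξ, ENNReal.ofReal ((1 + ‖ξ‖ ^ 2) ^ r) * ‖hft (fun y => (u y : ℂ)) hu ξ‖ₑ ^ 2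
  else ∞

/-- `f'` is the weak derivative `∂₃^j f` on the open set `U`. -/
def IsWeakVerticalDeriv (U : Set Pt) (j : ℕ) (f f' : Pt → ℝ) : Prop :=
  LocallyIntegrableOn f U volume ∧ LocallyIntegrableOn f' U volume ∧
    ∀ φ : Pt → ℝ, ContDiff ℝ ∞ φ → HasCompactSupport φ → tsupport φ ⊆ U →
      ∫ x in U, f x * iteratedDeriv j (fun z => φ (x.1, z)) x.2 = (-1) ^ j * ∫ x in U, f' x * φ x

namespace Config

/-- `‖f‖²` in `H^k(Ω_±)`, i.e. `∑_{j ≤ k} ∫∫ (1 + |ξ|²)^{k-j} |∂₃^j f̂(ξ, x₃)|² dξ dx₃`.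
A weak derivative is unique up to null sets, so the infimum only serves to give the value `∞`
when it does not exist. -/
def sobolevSq (c : Config) (k : ℕ) (s : Phase) (f : Pt → ℝ) : ℝ≥0∞ :=
  ∑ j ∈ Finset.range (k + 1),
    ⨅ (f' : Pt → ℝ) (_ : IsWeakVerticalDeriv (c.slab s) j f f'),
      ∫⁻ z in c.interval s, horizontalSq (k - j) (fun y => f' (y, z))

/-- The norm of the piecewise Sobolev space `H^k(Ω)` for scalar functions, given by their
restrictions to the two slabs; it is `∞` exactly outside the space. -/
def hNorm (c : Config) (k : ℕ) (f : Phase → Pt → ℝ) : ℝ≥0∞ :=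
  (c.sobolevSq k .lower (f .lower) + c.sobolevSq k .upper (f .upper)) ^ (1 / 2 : ℝ)

/-- The norm of the piecewise Sobolev space `H^k(Ω)` for vector fields. -/
def hNormVec (c : Config) (k : ℕ) (f : Phase → Pt → Fin 3 → ℝ) : ℝ≥0∞ :=
  (∑ i, (c.sobolevSq k .lower (fun x => f .lower x i) +
    c.sobolevSq k .upper (fun x => f .upper x i))) ^ (1 / 2 : ℝ)

end Config

/-! ### The linearized problem -/

/-- The unknowns: linearized flow map `η`, velocity `v` and density `q` in each fluid, as
functions of time and space. -/
structure State where
  η : Phase → ℝ → Pt → Fin 3 → ℝ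
  v : Phase → ℝ → Pt → Fin 3 → ℝ
  q : Phase → ℝ → Pt → ℝ

/-- The coordinate directions `e₁, e₂, e₃`. -/
def dir : Fin 3 → Pt :=
  ![(EuclideanSpace.single 0 1, 0), (EuclideanSpace.single 1 1, 0), (0, 1)]

/-- The partial derivative `∂ᵢ f (x)`. -/
def pd (i : Fin 3) (f : Pt → ℝ) (x : Pt) : ℝ := fderiv ℝ f x (dir i)

/-- The divergence of a vector field. -/
def dvg (w : Pt → Fin 3 → ℝ) (x : Pt) : ℝ := ∑ i, pd i (fun y => w y i) x

/-- `f` is continuously differentiable on `[0, ∞) × Ω_±` and continuous up to the boundary of the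
slab. -/
def Regular (c : Config) (s : Phase) (f : ℝ → Pt → ℝ) : Prop :=
  ContDiffOn ℝ 1 (fun p : ℝ × Pt => f p.1 p.2) (Ici 0 ×ˢ c.slab s) ∧
    ContinuousOn (fun p : ℝ × Pt => f p.1 p.2) (Ici 0 ×ˢ closure (c.slab s))

/-- Classical solutions, for all times `t ≥ 0`, of the equations linearized at the steady state,
with the jump conditions at `x₃ = 0` and the boundary conditions at `x₃ = -m, ℓ`. Time derivatives
at `t = 0` are one-sided. -/
structure IsSolution (c : Config) (X : State) : Prop where
  regular_η : ∀ s i, Regular c s (fun t x => X.η s t x i)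
  regular_v : ∀ s i, Regular c s (fun t x => X.v s t x i)
  regular_q : ∀ s, Regular c s (X.q s)
  eq_η : ∀ s, ∀ t ≥ (0 : ℝ), ∀ x ∈ c.slab s, ∀ i,
    derivWithin (fun τ => X.η s τ x i) (Ici 0) t = X.v s t x i
  eq_q : ∀ s, ∀ t ≥ (0 : ℝ), ∀ x ∈ c.slab s,
    derivWithin (fun τ => X.q s τ x) (Ici 0) t + c.rho0 s x.2 * dvg (X.v s t) x = 0
  eq_v : ∀ s, ∀ t ≥ (0 : ℝ), ∀ x ∈ c.slab s, ∀ i,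
    c.rho0 s x.2 * derivWithin (fun τ => X.v s τ x i) (Ici 0) t +
        pd i (fun y => c.dP s y.2 * X.q s t y) x =
      -(c.g * X.q s t x * (if i = 2 then 1 else 0)) -
        c.g * c.rho0 s x.2 * pd i (fun y => X.η s t y 2) x
  jump_v : ∀ t ≥ (0 : ℝ), ∀ y : EuclideanSpace ℝ (Fin 2),
    X.v .upper t (y, 0) 2 - X.v .lower t (y, 0) 2 = 0
  jump_q : ∀ t ≥ (0 : ℝ), ∀ y : EuclideanSpace ℝ (Fin 2),
    c.dP .upper 0 * X.q .upper t (y, 0) - c.dP .lower 0 * X.q .lower t (y, 0) = 0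
  bottom : ∀ t ≥ (0 : ℝ), ∀ y : EuclideanSpace ℝ (Fin 2), X.v .lower t (y, -c.m) 2 = 0
  top : ∀ t ≥ (0 : ℝ), ∀ y : EuclideanSpace ℝ (Fin 2), X.v .upper t (y, c.ℓ) 2 = 0

/-- `‖η(t)‖ + ‖v(t)‖ + ‖q(t)‖` in `H^k(Ω)`. -/
def stateNorm (c : Config) (k : ℕ) (X : State) (t : ℝ) : ℝ≥0∞ :=
  c.hNormVec k (fun s => X.η s t) + c.hNormVec k (fun s => X.v s t) + c.hNorm k (fun s => X.q s t)

/-- The difference of two states. -/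
def State.diff (X Y : State) : State where
  η := fun s t x i => X.η s t x i - Y.η s t x i
  v := fun s t x i => X.v s t x i - Y.v s t x i
  q := fun s t x => X.q s t x - Y.q s t x

/-- A solution with `η(t), v(t), q(t) ∈ H^k(Ω)` for all `t ≥ 0`. -/
def IsSolutionIn (c : Config) (k : ℕ) (X : State) : Prop :=
  IsSolution c X ∧ ∀ t ≥ (0 : ℝ), stateNorm c k X t < ⊤

/-- Solutions in `H^k(Ω)` depend continuously on their initial data in `H^k(Ω)`, uniformly for
times in `[0, T]`. -/
def DependsContinuously (c : Config) (k : ℕ) (T : ℝ) : Prop :=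
  ∀ X, IsSolutionIn c k X → ∀ ε : ℝ, 0 < ε → ∃ δ : ℝ, 0 < δ ∧
    ∀ Y, IsSolutionIn c k Y → stateNorm c k (X.diff Y) 0 < ENNReal.ofReal δ →
      ∀ t ∈ Icc 0 T, stateNorm c k (X.diff Y) t < ENNReal.ofReal ε

/-- Hadamard ill-posedness in `H^k(Ω)`: on no time interval `[0, T]` do solutions depend
continuously on the initial data. -/
def HadamardIllPosed (c : Config) (k : ℕ) : Prop :=
  ∀ T : ℝ, 0 < T → ¬ DependsContinuously c k T

end RT

end

/-! The upper fluid is denser at the interface, so every large horizontal frequency ξ carries a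
Rayleigh–Taylor normal mode whose growth rate λ is of order √|ξ|. At any fixed positive time the
factor exp(λt) beats every power of |ξ|, so no loss of derivatives can compensate for the growth.

Normal modes. Insert exp(λt + i y·ξ) with v₃ = u/ρ₀, horizontal velocity (iξ/λ²)H, η = v/λ and
P'(ρ₀)q = -(ρ₀H + gu)/λ. Since ρ₀' = -gρ₀/P'(ρ₀), the equations reduce to the 2×2 system u' =
(1/P'(ρ₀) + K)ρ₀H, H' = (L/ρ₀)u with K = |ξ|²/λ² and L = λ². It is solved in each layer from the
rigid wall, starting at u = 0 and |H| = 1 (`exists_linear_flow`, `exists_isMode`). Rescaling one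
layer against the other makes v₃ continuous, and continuity of the pressure becomes one scalar
equation at the interface: ρ₋²H₋/u₋ - ρ₊²H₊/u₊ = g(ρ₊ - ρ₋), where H₋ > 0 > H₊.

Growth rate. Put λ² = μ|ξ|. Monotone quantities of the form U² - M²V² (`flow_upper_barrier`,
`flow_lower_barrier`) show that the left side is too small for a small fixed μ = a and too large for
a large fixed μ = b, for all large |ξ|. Hence there is a root μ in [a, b], and it can be chosen
measurably in |ξ| (`exists_measurable_root`, `nonempty_growingModes`).

Wave packets. A plane wave is not in L², so the modes are superposed over the annulus κ ≤ |ξ| ≤ κ +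
1, with symbols symmetric under ξ ↦ -ξ to keep the fields real. The packet solves the linearized
problem because each frequency does (`isSolution_state`).

Norms. By Plancherel the Sobolev norms are integrals over the annulus. Each vertical derivative of u
or H is again a combination of u and H with coefficients polynomial in K and L (`ModeSpan`). So the
H^j norm of the data from above, and the L² norm of η from below, are both comparable, up to
polynomials in κ, with one and the same energy ∫∫ w²(u² + H²), w being the matching weight; no
asymptotics of the modes are needed. This energy is normalized away by the amplitude, and κ is
chosen so large that exp(2√(κa) T₀) dominates the polynomials (`exists_small_growing_solution`).
Comparison with the zero solution then contradicts continuous dependence (`hadamardIllPosed`). -/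

noncomputable section

namespace RT

/-! ### Plancherel's formula for the horizontal norms -/

section Plancherel

open SchwartzMap

variable {E : Type*} [NormedAddCommGroup E] [MeasurableSpace E] [BorelSpace E]
  [InnerProductSpace ℝ E] [FiniteDimensional ℝ E]

theorem integral_mul_fourierInv_eq {f g : E → ℂ} (hf : Integrable f) (hg : Integrable g) :
    ∫ x, 𝓕⁻ f x * g x = ∫ x, f x * 𝓕⁻ g x := by
  have h := VectorFourier.integral_fourierIntegral_smul_eq_flip (μ := (volume : Measure E))
    (ν := (volume : Measure E)) (e := Real.fourierChar) (L := -innerₗ E)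
    (f := f) (g := g) Real.continuous_fourierChar (by
      simp only [LinearMap.neg_apply]
      exact (continuous_inner).neg) hf hg
  have e1 : ∀ (h : E → ℂ) (x : E), VectorFourier.fourierIntegral Real.fourierChar volume
      (-innerₗ E) h x = 𝓕⁻ h x := by
    intro h x
    rw [Real.fourierInv_eq]
    simp [VectorFourier.fourierIntegral]
  have e2 : ∀ (h : E → ℂ) (x : E), VectorFourier.fourierIntegral Real.fourierChar volume
      (-innerₗ E).flip h x = 𝓕⁻ h x := by
    intro h x
    rw [Real.fourierInv_eq]
    simp [VectorFourier.fourierIntegral, real_inner_comm]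
  simpa [e1, e2] using h

theorem continuous_fourierInv {g : E → ℂ} (hg : Integrable g) : Continuous (𝓕⁻ g) := by
  have := VectorFourier.fourierIntegral_continuous (μ := (volume : Measure E))
    (e := Real.fourierChar) (L := -innerₗ E) Real.continuous_fourierChar (by
      simp only [LinearMap.neg_apply]
      exact (continuous_inner).neg) hg
  convert this using 1
  funext x
  rw [Real.fourierInv_eq]
  simp [VectorFourier.fourierIntegral]

/-- On `L¹ ∩ L²` the inverse Fourier transform of `L²` is given by the integral. -/
theorem fourierInv_toLp_ae_eq {g : E → ℂ} (h1 : Integrable g) (h2 : MemLp g 2) :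
    ((𝓕⁻ (h2.toLp g) : Lp ℂ 2 (volume : Measure E)) : E → ℂ) =ᵐ[volume] 𝓕⁻ g := by
  refine ae_eq_of_integral_contDiff_smul_eq ?_ (continuous_fourierInv h1).locallyIntegrable ?_
  · exact (Lp.memLp _).locallyIntegrable (by norm_num)
  intro φ hφ hc
  have hc' : HasCompactSupport (fun x => (φ x : ℂ)) := hc.comp_left (g := fun r : ℝ => (r : ℂ)) rfl
  have hs : ContDiff ℝ ∞ (fun x => (φ x : ℂ)) := Complex.ofRealCLM.contDiff.comp hφ
  set Φ : 𝓢(E, ℂ) := hc'.toSchwartzMap hs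
  have hΦ : ∀ x, Φ x = φ x := fun x => rfl
  -- The L² transform agrees with the transform of tempered distributions, so it may be moved onto
  -- the test function, where it is an integral; Fubini then moves it back onto `g`.
  have key : ((𝓕⁻ (h2.toLp g) : Lp ℂ 2 (volume : Measure E)) : 𝓢'(E, ℂ)) Φ =
      ((h2.toLp g : Lp ℂ 2 (volume : Measure E)) : 𝓢'(E, ℂ)) (𝓕⁻ Φ) := by
    rw [← Lp.fourierInv_toTemperedDistribution_eq]
    rfl
  rw [Lp.toTemperedDistribution_apply, Lp.toTemperedDistribution_apply] at key
  have e1 : ∫ x, (𝓕⁻ Φ) x • (h2.toLp g) x = ∫ x, 𝓕⁻ (fun y => Φ y) x * g x := by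
    apply integral_congr_ae
    filter_upwards [h2.coeFn_toLp] with x hx
    rw [hx, SchwartzMap.fourierInv_coe, smul_eq_mul]
  rw [e1, integral_mul_fourierInv_eq Φ.integrable h1] at key
  simpa [hΦ] using key

theorem memLp_fourierInv {g : E → ℂ} (h1 : Integrable g) (h2 : MemLp g 2) :
    MemLp (𝓕⁻ g) 2 := (memLp_congr_ae (fourierInv_toLp_ae_eq h1 h2)).1 (Lp.memLp _)

theorem fourier_toLp_fourierInv {g : E → ℂ} (h1 : Integrable g) (h2 : MemLp g 2)
    (h : MemLp (𝓕⁻ g) 2) : (𝓕 (h.toLp (𝓕⁻ g)) : Lp ℂ 2 (volume : Measure E)) = h2.toLp g := by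
  have : h.toLp (𝓕⁻ g) = (𝓕⁻ (h2.toLp g) : Lp ℂ 2 (volume : Measure E)) := by
    apply Lp.ext
    exact h.coeFn_toLp.trans (fourierInv_toLp_ae_eq h1 h2).symm
  rw [this, FourierTransform.fourier_fourierInv_eq]

end Plancherel

/-- The inverse transform `∫ g(ξ) e^{i y·ξ} dξ` with the kernel of `hft`. -/
def synth (g : EuclideanSpace ℝ (Fin 2) → ℂ) (y : EuclideanSpace ℝ (Fin 2)) : ℂ :=
  ∫ ξ, g ξ * Complex.exp (Complex.I * (inner ℝ ξ y : ℝ))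

/-- Substituting ξ = 2πζ in the plane turns one kernel into the other, with Jacobian (2π)². -/
theorem synth_eq_fourierInv (g : EuclideanSpace ℝ (Fin 2) → ℂ) :
    synth g = 𝓕⁻ (fun ζ => ((2 * Real.pi : ℝ) : ℂ) ^ 2 * g ((2 * Real.pi) • ζ)) := by
  funext y
  rw [Real.fourierInv_eq']
  have := Measure.integral_comp_smul (volume : Measure (EuclideanSpace ℝ (Fin 2)))
    (fun ξ => g ξ * Complex.exp (Complex.I * (inner ℝ ξ y : ℝ))) (2 * Real.pi)
  have hpi : (0 : ℝ) < 2 * Real.pi := by positivity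
  simp only [finrank_euclideanSpace, Fintype.card_fin] at this
  rw [synth]
  have e : ∀ v : EuclideanSpace ℝ (Fin 2),
      Complex.exp (↑(2 * Real.pi * inner ℝ v y) * Complex.I) •
        (((2 * Real.pi : ℝ) : ℂ) ^ 2 * g ((2 * Real.pi) • v)) =
      ((2 * Real.pi : ℝ) : ℂ) ^ 2 * (g ((2 * Real.pi) • v) *
        Complex.exp (Complex.I * (inner ℝ ((2 * Real.pi) • v) y : ℝ))) := by
    intro v
    rw [real_inner_smul_left, smul_eq_mul, mul_comm Complex.I]
    ring
  simp_rw [e]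
  rw [integral_const_mul, this, abs_of_pos (by positivity), Complex.real_smul, ← mul_assoc]
  push_cast
  rw [mul_inv_cancel₀ (by simp [Real.pi_ne_zero]), one_mul]

/-- Plancherel's formula for a superposition of horizontal waves. -/
theorem horizontalSq_of_eq_synth (r : ℕ) {g : EuclideanSpace ℝ (Fin 2) → ℂ}
    {u : EuclideanSpace ℝ (Fin 2) → ℝ} (h1 : Integrable g) (h2 : MemLp g 2)
    (hu : ∀ y, (u y : ℂ) = synth g y) :
    horizontalSq r u =
      ∫⁻ ξ, ENNReal.ofReal ((1 + ‖ξ‖ ^ 2) ^ r) * (ENNReal.ofReal ((2 * Real.pi) ^ 2) * ‖g ξ‖ₑ) ^ 2 := by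
  have hpi : (2 * Real.pi) ≠ 0 := by positivity
  set G : EuclideanSpace ℝ (Fin 2) → ℂ :=
    fun ζ => ((2 * Real.pi : ℝ) : ℂ) ^ 2 * g ((2 * Real.pi) • ζ) with hG
  have hq : Measure.QuasiMeasurePreserving (fun ζ : EuclideanSpace ℝ (Fin 2) => (2 * Real.pi) • ζ) := by
    refine ⟨measurable_const_smul _, ?_⟩
    rw [Measure.map_addHaar_smul _ hpi]
    exact Measure.smul_absolutelyContinuous
  have hq' : Measure.QuasiMeasurePreserving
      (fun ζ : EuclideanSpace ℝ (Fin 2) => (2 * Real.pi)⁻¹ • ζ) := by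
    refine ⟨measurable_const_smul _, ?_⟩
    rw [Measure.map_addHaar_smul _ (inv_ne_zero hpi)]
    exact Measure.smul_absolutelyContinuous
  have G1 : Integrable G := (h1.comp_smul hpi).const_mul _
  have G2 : MemLp G 2 := by
    apply MemLp.const_mul
    have := (h2.smul_measure (c := ENNReal.ofReal |((2 * Real.pi) ^ 2)⁻¹|) ENNReal.ofReal_ne_top)
    have h3 := Measure.map_addHaar_smul (volume : Measure (EuclideanSpace ℝ (Fin 2))) hpi
    rw [finrank_euclideanSpace, Fintype.card_fin] at h3
    rw [← h3] at this
    exact this.comp_of_map (measurable_const_smul _).aemeasurable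
  have hu' : (fun y => (u y : ℂ)) = 𝓕⁻ G := by
    funext y
    rw [hu, synth_eq_fourierInv]
  have hm : MemLp (fun y => (u y : ℂ)) 2 volume := by
    rw [hu']; exact memLp_fourierInv G1 G2
  rw [horizontalSq, dif_pos hm]
  have hF : (𝓕 (hm.toLp _) : Lp ℂ 2 (volume : Measure (EuclideanSpace ℝ (Fin 2)))) = G2.toLp G := by
    have h3 : MemLp (𝓕⁻ G) 2 := memLp_fourierInv G1 G2
    rw [← fourier_toLp_fourierInv G1 G2 h3]
    congr 1
    exact MemLp.toLp_congr _ _ (by rw [hu'])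
  apply lintegral_congr_ae
  have h4 := hq'.ae (G2.coeFn_toLp)
  filter_upwards [h4] with ξ hξ
  rw [hft, hF, hξ, hG]
  simp only [smul_smul, mul_inv_cancel₀ hpi, one_smul, enorm_mul]
  congr 3
  rw [← Complex.ofReal_pow, ← ofReal_norm, Complex.norm_real, Real.norm_of_nonneg (by positivity)]

theorem horizontalSq_congr_ae (r : ℕ) {u w : EuclideanSpace ℝ (Fin 2) → ℝ} (h : u =ᵐ[volume] w) :
    horizontalSq r u = horizontalSq r w := by
  have h' : (fun y => (u y : ℂ)) =ᵐ[volume] (fun y => (w y : ℂ)) := by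
    filter_upwards [h] with y hy; rw [hy]
  unfold horizontalSq
  by_cases hu : MemLp (fun y => (u y : ℂ)) 2 volume
  · have hw : MemLp (fun y => (w y : ℂ)) 2 volume := (memLp_congr_ae h').1 hu
    rw [dif_pos hu, dif_pos hw]
    unfold hft
    rw [MemLp.toLp_congr hu hw h']
  · have hw : ¬ MemLp (fun y => (w y : ℂ)) 2 volume := fun h2 => hu ((memLp_congr_ae h').2 h2)
    rw [dif_neg hu, dif_neg hw]

/-- Needed because the difference between the zero solution and a packet is minus the packet. -/
theorem horizontalSq_neg (r : ℕ) (u : EuclideanSpace ℝ (Fin 2) → ℝ) :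
    horizontalSq r (fun y => -u y) = horizontalSq r u := by
  unfold horizontalSq
  have e : (fun y => ((-u y : ℝ) : ℂ)) = -(fun y => (u y : ℂ)) := by
    funext y; simp
  by_cases hu : MemLp (fun y => (u y : ℂ)) 2 volume
  · have hw : MemLp (fun y => ((-u y : ℝ) : ℂ)) 2 volume := by rw [e]; exact hu.neg
    rw [dif_pos hu, dif_pos hw]
    apply lintegral_congr_ae
    have h1 : (𝓕 (hw.toLp _) : Lp ℂ 2 (volume : Measure (EuclideanSpace ℝ (Fin 2)))) =
        -(𝓕 (hu.toLp _) : Lp ℂ 2 (volume : Measure (EuclideanSpace ℝ (Fin 2)))) := by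
      rw [MemLp.toLp_congr hw hu.neg (by rw [e]), MemLp.toLp_neg]
      exact map_neg (Lp.fourierTransformₗᵢ (EuclideanSpace ℝ (Fin 2)) ℂ) _
    have hpi : (2 * Real.pi) ≠ 0 := by positivity
    have hq' : Measure.QuasiMeasurePreserving
        (fun ζ : EuclideanSpace ℝ (Fin 2) => (2 * Real.pi)⁻¹ • ζ) := by
      refine ⟨measurable_const_smul _, ?_⟩
      rw [Measure.map_addHaar_smul _ (inv_ne_zero hpi)]
      exact Measure.smul_absolutelyContinuous
    filter_upwards [hq'.ae (Lp.coeFn_neg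
      (𝓕 (hu.toLp _) : Lp ℂ 2 (volume : Measure (EuclideanSpace ℝ (Fin 2)))))] with ξ hξ
    rw [hft, h1, hξ, hft, Pi.neg_apply, enorm_neg]
  · have hw : ¬ MemLp (fun y => ((-u y : ℝ) : ℂ)) 2 volume := by
      rw [e]; intro h; exact hu (by simpa using h.neg)
    rw [dif_neg hu, dif_neg hw]

/-! ### Weak vertical derivatives and the Sobolev norm -/

theorem integrable_mul_of_tsupport_subset {U : Set Pt} {f φ : Pt → ℝ}
    (hf : LocallyIntegrableOn f U volume) (hφ : Continuous φ) (hc : HasCompactSupport φ)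
    (hs : tsupport φ ⊆ U) : Integrable (fun x => f x * φ x) := by
  have h1 : IntegrableOn f (tsupport φ) := hf.integrableOn_compact_subset hs hc
  have h2 : IntegrableOn (fun x => f x * φ x) (tsupport φ) :=
    h1.mul_continuousOn hφ.continuousOn hc
  refine (integrableOn_iff_integrable_of_support_subset ?_).1 h2
  intro x hx
  apply subset_tsupport
  intro h0
  exact hx (by simp [h0])

theorem setIntegral_mul_of_tsupport_subset {U : Set Pt} {f φ : Pt → ℝ}
    (hs : tsupport φ ⊆ U) : ∫ x in U, f x * φ x = ∫ x, f x * φ x := by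
  apply setIntegral_eq_integral_of_forall_compl_eq_zero
  intro x hx
  rw [image_eq_zero_of_notMem_tsupport (fun h => hx (hs h)), mul_zero]

/-- Weak vertical derivatives are unique almost everywhere. -/
theorem IsWeakVerticalDeriv.ae_eq {U : Set Pt} (hU : IsOpen U) {j : ℕ} {f f₁ f₂ : Pt → ℝ}
    (h₁ : IsWeakVerticalDeriv U j f f₁) (h₂ : IsWeakVerticalDeriv U j f f₂) :
    ∀ᵐ x, x ∈ U → f₁ x = f₂ x := by
  have hd : LocallyIntegrableOn (fun x => f₁ x - f₂ x) U volume := h₁.2.1.sub h₂.2.1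
  have := hU.ae_eq_zero_of_integral_contDiff_smul_eq_zero hd (by
    intro φ hφ hc hs
    have e1 := h₁.2.2 φ hφ hc hs
    rw [h₂.2.2 φ hφ hc hs] at e1
    have e2 : ∫ x in U, f₂ x * φ x = ∫ x in U, f₁ x * φ x :=
      mul_left_cancel₀ (pow_ne_zero j (by norm_num)) e1
    rw [setIntegral_mul_of_tsupport_subset hs, setIntegral_mul_of_tsupport_subset hs] at e2
    have e3 : ∀ x, φ x • (f₁ x - f₂ x) = f₁ x * φ x - f₂ x * φ x := by
      intro x; rw [smul_eq_mul]; ring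
    simp_rw [e3]
    rw [integral_sub (integrable_mul_of_tsupport_subset h₁.2.1 hφ.continuous hc hs)
      (integrable_mul_of_tsupport_subset h₂.2.1 hφ.continuous hc hs), e2, sub_self])
  filter_upwards [this] with x hx hxU
  exact sub_eq_zero.1 (hx hxU)

theorem hasDerivAt_vertical {φ : Pt → ℝ} (hφ : Differentiable ℝ φ) (y : EuclideanSpace ℝ (Fin 2))
    (z : ℝ) : HasDerivAt (fun w => φ (y, w)) (fderiv ℝ φ (y, z) (0, 1)) z := by
  have h1 : HasDerivAt (fun w : ℝ => ((y, w) : Pt)) (0, 1) z :=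
    (hasDerivAt_const z y).prodMk (hasDerivAt_id z)
  exact (hφ (y, z)).hasFDerivAt.comp_hasDerivAt z h1

/-- Vertical integration by parts against a test function. -/
theorem integral_mul_vertical_deriv {U : Set Pt} (hU : IsOpen U) {f f' φ : Pt → ℝ}
    (hf : ContinuousOn f U) (hf' : ContinuousOn f' U)
    (hd : ∀ x ∈ U, HasDerivAt (fun z => f (x.1, z)) (f' x) x.2)
    (hφ : ContDiff ℝ ∞ φ) (hc : HasCompactSupport φ) (hs : tsupport φ ⊆ U) :
    ∫ x in U, f x * fderiv ℝ φ x (0, 1) = -∫ x in U, f' x * φ x := by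
  have hcl : ∀ {h : Pt → ℝ}, ContinuousOn h U → LocallyIntegrableOn h U volume := fun hh =>
    hh.locallyIntegrableOn hU.measurableSet
  set ψ : Pt → ℝ := fun x => fderiv ℝ φ x (0, 1) with hψ
  have hψc : Continuous ψ := (hφ.continuous_fderiv (by simp)).clm_apply continuous_const
  have hψs : tsupport ψ ⊆ tsupport φ := by
    refine closure_minimal ?_ (isClosed_tsupport _)
    intro x hx
    by_contra h
    apply hx
    have : φ =ᶠ[nhds x] 0 := notMem_tsupport_iff_eventuallyEq.1 h
    rw [hψ]
    simp [this.fderiv_eq]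
  have hψcs : HasCompactSupport ψ := hc.of_isClosed_subset (isClosed_tsupport _) hψs
  have I1 := integrable_mul_of_tsupport_subset (hcl hf) hψc hψcs (hψs.trans hs)
  have I2 := integrable_mul_of_tsupport_subset (hcl hf') hφ.continuous hc hs
  have I3 := integrable_mul_of_tsupport_subset (hcl hf) hφ.continuous hc hs
  rw [setIntegral_mul_of_tsupport_subset (hψs.trans hs), setIntegral_mul_of_tsupport_subset hs]
  have hφd : Differentiable ℝ φ := hφ.differentiable (by simp)
  have : (volume : Measure Pt).IsAddHaarMeasure := Measure.prod.instIsAddHaarMeasure _ _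
  -- Taken with the constant function 1 as second factor, this says that the vertical derivative of
  -- `f * φ`, which vanishes near every point outside `U`, has integral zero.
  have key := integral_bilinear_hasLineDerivAt_right_eq_neg_left_of_integrable
    (μ := (volume : Measure Pt)) (f := fun x => f x * φ x)
    (f' := fun x => f' x * φ x + f x * ψ x) (g := fun _ => (1 : ℝ)) (g' := fun _ => (0 : ℝ))
    (v := ((0, 1) : Pt)) (B := ContinuousLinearMap.mul ℝ ℝ)
    (by simpa only [ContinuousLinearMap.mul_apply', mul_one] using! I2.add I1) (by simp) (by simpa using I3)
    (by
      intro x _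
      by_cases hx : x ∈ U
      · have h1 := (hd x hx).mul (hasDerivAt_vertical hφd x.1 x.2)
        unfold HasLineDerivAt
        have h2 : HasDerivAt (fun t : ℝ => x.2 + t) 1 0 := (hasDerivAt_id 0).const_add x.2
        have h3 := HasDerivAt.comp (0 : ℝ) (by simpa using h1) h2
        rw [mul_one] at h3
        refine h3.congr_of_eventuallyEq (.of_forall fun t => ?_)
        have e : x + t • ((0, 1) : Pt) = (x.1, x.2 + t) := by ext <;> simp
        simp only [e]
        rfl
      · have hx' : x ∉ tsupport φ := fun h => hx (hs h)
        have h0 : φ x = 0 := image_eq_zero_of_notMem_tsupport hx'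
        have h0' : ψ x = 0 := image_eq_zero_of_notMem_tsupport (fun h => hx' (hψs h))
        have he : (fun x => f x * φ x) =ᶠ[nhds x] fun _ => 0 := by
          filter_upwards [notMem_tsupport_iff_eventuallyEq.1 hx'] with y hy
          rw [hy]; simp
        have h2 : HasFDerivAt (fun x => f x * φ x) (0 : Pt →L[ℝ] ℝ) x :=
          (hasFDerivAt_const (0 : ℝ) x).congr_of_eventuallyEq he
        have h3 := h2.hasLineDerivAt (0, 1)
        simpa [h0, h0'] using h3)
    (by
      intro x _
      exact (hasFDerivAt_const (1 : ℝ) x).hasLineDerivAt (0, 1))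
  simp only [ContinuousLinearMap.mul_apply', mul_zero, integral_zero, mul_one] at key
  rw [integral_add I2 I1] at key
  linarith

/-- A tower of classical vertical derivatives on `U`. -/
structure VerticalTower (U : Set Pt) (D : ℕ → Pt → ℝ) : Prop where
  continuousOn : ∀ j, ContinuousOn (D j) U
  hasDerivAt : ∀ j, ∀ x ∈ U, HasDerivAt (fun z => D j (x.1, z)) (D (j + 1) x) x.2

/-- Derivatives are moved one at a time: the induction hypothesis is applied to ∂₃φ, which is again
a test function, and one integration by parts finishes. -/
theorem VerticalTower.isWeakVerticalDeriv {U : Set Pt} (hU : IsOpen U) {D : ℕ → Pt → ℝ}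
    (h : VerticalTower U D) (j : ℕ) : IsWeakVerticalDeriv U j (D 0) (D j) := by
  refine ⟨(h.continuousOn 0).locallyIntegrableOn hU.measurableSet,
    (h.continuousOn j).locallyIntegrableOn hU.measurableSet, ?_⟩
  induction j with
  | zero => intro φ _ _ _; simp
  | succ j ih =>
    intro φ hφ hc hs
    set ψ : Pt → ℝ := fun x => fderiv ℝ φ x (0, 1) with hψ
    have hψs : tsupport ψ ⊆ tsupport φ := by
      refine closure_minimal ?_ (isClosed_tsupport _)
      intro x hx
      by_contra hn
      apply hx
      have : φ =ᶠ[nhds x] 0 := notMem_tsupport_iff_eventuallyEq.1 hn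
      rw [hψ]
      simp [this.fderiv_eq]
    have hψd : ContDiff ℝ ∞ ψ := (hφ.fderiv_right (m := ∞) (by simp)).clm_apply contDiff_const
    have e : ∀ x : Pt, iteratedDeriv (j + 1) (fun z => φ (x.1, z)) x.2 =
        iteratedDeriv j (fun z => ψ (x.1, z)) x.2 := by
      intro x
      rw [iteratedDeriv_succ']
      congr 1
      funext z
      exact (hasDerivAt_vertical (hφ.differentiable (by simp)) x.1 z).deriv
    simp_rw [e]
    rw [ih ψ hψd (hc.of_isClosed_subset (isClosed_tsupport _) hψs) (hψs.trans hs),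
      integral_mul_vertical_deriv hU (h.continuousOn j) (h.continuousOn (j + 1))
        (h.hasDerivAt j) hφ hc hs, pow_succ]
    ring

namespace Config

theorem isOpen_interval (c : Config) (s : Phase) : IsOpen (c.interval s) := by
  cases s <;> exact isOpen_Ioo

theorem isOpen_slab (c : Config) (s : Phase) : IsOpen (c.slab s) :=
  isOpen_univ.prod (c.isOpen_interval s)

/-- The infimum runs over a single almost-everywhere class, since weak derivatives are unique; by
Fubini almost every horizontal section of two representatives agrees, so their integrals are equal.
-/
theorem sobolevSq_eq_of_tower (c : Config) (k : ℕ) (s : Phase) {D : ℕ → Pt → ℝ}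
    (h : VerticalTower (c.slab s) D) :
    c.sobolevSq k s (D 0) = ∑ j ∈ Finset.range (k + 1),
      ∫⁻ z in c.interval s, horizontalSq (k - j) (fun y => D j (y, z)) := by
  unfold sobolevSq
  refine Finset.sum_congr rfl fun j _ => le_antisymm ?_ ?_
  · exact iInf₂_le (D j) (h.isWeakVerticalDeriv (c.isOpen_slab s) j)
  · refine le_iInf₂ fun f' hf' => le_of_eq ?_
    have h1 := (h.isWeakVerticalDeriv (c.isOpen_slab s) j).ae_eq (c.isOpen_slab s) hf'
    have h2 : ∀ᵐ p : ℝ × EuclideanSpace ℝ (Fin 2),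
        p.1 ∈ c.interval s → D j (p.2, p.1) = f' (p.2, p.1) := by
      -- The norm integrates the height outermost while points list it second, so the null set is
      -- transported by the swap.
      have hsw : Measure.QuasiMeasurePreserving
          (Prod.swap : ℝ × EuclideanSpace ℝ (Fin 2) → EuclideanSpace ℝ (Fin 2) × ℝ) :=
        (Measure.measurePreserving_swap (μ := (volume : Measure ℝ))
          (ν := (volume : Measure (EuclideanSpace ℝ (Fin 2))))).quasiMeasurePreserving
      filter_upwards [hsw.ae h1] with p hp hm
      exact hp ⟨mem_univ _, hm⟩
    have h3 := Measure.ae_ae_of_ae_prod h2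
    apply setLIntegral_congr_fun_ae (c.isOpen_interval s).measurableSet
    filter_upwards [h3] with z hz hzI
    apply horizontalSq_congr_ae
    filter_upwards [hz] with y hy
    exact hy hzI

theorem _root_.RT.IsWeakVerticalDeriv.neg {U : Set Pt} {j : ℕ} {f f' : Pt → ℝ}
    (h : IsWeakVerticalDeriv U j f f') :
    IsWeakVerticalDeriv U j (fun x => -f x) (fun x => -f' x) := by
  refine ⟨h.1.neg, h.2.1.neg, fun φ hφ hc hs => ?_⟩
  simp only [neg_mul, integral_neg]
  rw [h.2.2 φ hφ hc hs, mul_neg]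

theorem sobolevSq_neg (c : Config) (k : ℕ) (s : Phase) (f : Pt → ℝ) :
    c.sobolevSq k s (fun x => -f x) = c.sobolevSq k s f := by
  have key : ∀ f : Pt → ℝ, c.sobolevSq k s (fun x => -f x) ≤ c.sobolevSq k s f := by
    intro f
    refine Finset.sum_le_sum fun j _ => le_iInf₂ fun f' hf' => ?_
    refine (iInf₂_le (fun x => -f' x) hf'.neg).trans (le_of_eq ?_)
    simp_rw [horizontalSq_neg]
  refine le_antisymm (key f) ?_
  simpa using key (fun x => -f x)

end Config

/-! ### Superpositions of growing plane waves -/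

/-- Horizontal frequencies. -/
abbrev Freq : Type := EuclideanSpace ℝ (Fin 2)

/-- `S` is a bounded symmetric set of frequencies and `γ` an even bounded growth rate on `S`. -/
structure IsSpectrum (S : Set Freq) (γ : Freq → ℝ) : Prop where
  measurableSet : MeasurableSet S
  measurable : Measurable γ
  bdd : ∃ r, 0 ≤ r ∧ ∀ ξ ∈ S, ‖ξ‖ ≤ r ∧ |γ ξ| ≤ r
  neg_mem : ∀ ξ ∈ S, -ξ ∈ S
  even : ∀ ξ, γ (-ξ) = γ ξ

/-- Bounded measurable symbols of real Fourier multipliers on `S`. -/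
structure IsSymbol (S : Set Freq) (g : Freq → ℂ) : Prop where
  measurable : Measurable g
  bdd : ∃ C, 0 ≤ C ∧ ∀ ξ ∈ S, ‖g ξ‖ ≤ C
  herm : ∀ ξ, g (-ξ) = (starRingEnd ℂ) (g ξ)

theorem IsSymbol.mul {S : Set Freq} {g h : Freq → ℂ} (hg : IsSymbol S g) (hh : IsSymbol S h) :
    IsSymbol S (fun ξ => g ξ * h ξ) := by
  refine ⟨hg.measurable.mul hh.measurable, ?_, fun ξ => by simp [hg.herm, hh.herm]⟩
  obtain ⟨C, hC, hC'⟩ := hg.bdd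
  obtain ⟨D, hD, hD'⟩ := hh.bdd
  refine ⟨C * D, mul_nonneg hC hD, fun ξ hξ => ?_⟩
  rw [norm_mul]
  exact mul_le_mul (hC' ξ hξ) (hD' ξ hξ) (norm_nonneg _) hC

theorem isSymbol_const (S : Set Freq) (r : ℝ) : IsSymbol S (fun _ => (r : ℂ)) :=
  ⟨measurable_const, ⟨|r|, abs_nonneg r, fun ξ _ => by simp⟩, fun ξ => by simp⟩

theorem IsSpectrum.isSymbol {S : Set Freq} {γ : Freq → ℝ} (h : IsSpectrum S γ) :
    IsSymbol S (fun ξ => (γ ξ : ℂ)) := by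
  obtain ⟨r, hr, hb⟩ := h.bdd
  exact ⟨Complex.measurable_ofReal.comp h.measurable,
    ⟨r, hr, fun ξ hξ => by simpa using (hb ξ hξ).2⟩, fun ξ => by simp [h.even]⟩

theorem IsSpectrum.isSymbol_coord {S : Set Freq} {γ : Freq → ℝ} (h : IsSpectrum S γ) (i : Fin 2) :
    IsSymbol S (fun ξ => Complex.I * (ξ i : ℂ)) := by
  obtain ⟨r, hr, hb⟩ := h.bdd
  refine ⟨?_, ⟨r, hr, fun ξ hξ => ?_⟩, fun ξ => by simp⟩
  · fun_prop
  · rw [norm_mul, Complex.norm_I, one_mul, Complex.norm_real]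
    exact (PiLp.norm_apply_le ξ i).trans (hb ξ hξ).1

/-- The growing plane wave `e^{γ(ξ) t + i y·ξ}`. -/
def planeWave (γ : Freq → ℝ) (ξ : Freq) (t : ℝ) (y : Freq) : ℂ :=
  Complex.exp (((γ ξ * t : ℝ) : ℂ) + Complex.I * ((inner ℝ ξ y : ℝ) : ℂ))

theorem norm_planeWave (γ : Freq → ℝ) (ξ : Freq) (t : ℝ) (y : Freq) :
    ‖planeWave γ ξ t y‖ = Real.exp (γ ξ * t) := by
  rw [planeWave, Complex.norm_exp]; simp

/-- A superposition of growing plane waves. -/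
def cwave (S : Set Freq) (γ : Freq → ℝ) (g : Freq → ℂ) (t : ℝ) (y : Freq) : ℂ :=
  ∫ ξ in S, g ξ * planeWave γ ξ t y

section

variable {S : Set Freq} {γ : Freq → ℝ}

theorem IsSpectrum.volume_lt_top (h : IsSpectrum S γ) : volume S < ⊤ := by
  obtain ⟨r, hr, hb⟩ := h.bdd
  refine Bornology.IsBounded.measure_lt_top ?_
  exact isBounded_iff_forall_norm_le.2 ⟨r, fun ξ hξ => (hb ξ hξ).1⟩

theorem measurable_planeWave (h : IsSpectrum S γ) (t : ℝ) (y : Freq) :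
    Measurable (fun ξ => planeWave γ ξ t y) := by
  unfold planeWave
  have := h.measurable
  fun_prop

theorem IsSpectrum.norm_planeWave_le (h : IsSpectrum S γ) :
    ∃ r, 0 ≤ r ∧ ∀ ξ ∈ S, ∀ T t y, |t| ≤ T → ‖planeWave γ ξ t y‖ ≤ Real.exp (r * T) := by
  obtain ⟨r, hr, hb⟩ := h.bdd
  refine ⟨r, hr, fun ξ hξ T t y ht => ?_⟩
  rw [norm_planeWave, Real.exp_le_exp]
  calc γ ξ * t ≤ |γ ξ * t| := le_abs_self _
    _ = |γ ξ| * |t| := abs_mul _ _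
    _ ≤ r * T := mul_le_mul (hb ξ hξ).2 ht (abs_nonneg _) hr

theorem IsSymbol.integrableOn (h : IsSpectrum S γ) {g : Freq → ℂ} (hg : IsSymbol S g) (t : ℝ)
    (y : Freq) : IntegrableOn (fun ξ => g ξ * planeWave γ ξ t y) S := by
  obtain ⟨C, hC, hC'⟩ := hg.bdd
  obtain ⟨r, hr, hb⟩ := h.norm_planeWave_le
  refine Measure.integrableOn_of_bounded (M := C * Real.exp (r * |t|)) h.volume_lt_top.ne
    (hg.measurable.mul (measurable_planeWave h t y)).aestronglyMeasurable ?_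
  refine (ae_restrict_iff' h.measurableSet).2 (.of_forall fun ξ hξ => ?_)
  rw [norm_mul]
  exact mul_le_mul (hC' ξ hξ) (hb ξ hξ _ t y le_rfl) (norm_nonneg _) hC

theorem cwave_const_mul (r : ℝ) (g : Freq → ℂ) (t : ℝ) (y : Freq) :
    cwave S γ (fun ξ => r * g ξ) t y = r * cwave S γ g t y := by
  unfold cwave
  simp_rw [mul_assoc]
  rw [integral_const_mul]

theorem cwave_congr (h : IsSpectrum S γ) {g₁ g₂ : Freq → ℂ} (he : ∀ ξ ∈ S, g₁ ξ = g₂ ξ)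
    (t : ℝ) (y : Freq) : cwave S γ g₁ t y = cwave S γ g₂ t y := by
  unfold cwave
  refine setIntegral_congr_fun h.measurableSet fun ξ hξ => ?_
  simp only [he ξ hξ]

/-- The substitution ξ ↦ -ξ turns the integral into its conjugate: the symbol is Hermitian, the
growth rate is even and `S` is symmetric. -/
theorem cwave_eq_re (h : IsSpectrum S γ) {g : Freq → ℂ} (hg : IsSymbol S g) (t : ℝ) (y : Freq) :
    ((cwave S γ g t y).re : ℂ) = cwave S γ g t y := by
  rw [← Complex.conj_eq_iff_re]
  have e : cwave S γ g t y = ∫ ξ, S.indicator (fun ξ => g ξ * planeWave γ ξ t y) ξ :=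
    (integral_indicator h.measurableSet).symm
  rw [e, ← integral_conj, ← integral_neg_eq_self]
  congr 1
  funext ξ
  by_cases hξ : ξ ∈ S
  · have hn := h.neg_mem ξ hξ
    rw [indicator_of_mem hn, indicator_of_mem hξ]
    simp only [map_mul, hg.herm, Complex.conj_conj, planeWave, ← Complex.exp_conj, map_add,
      Complex.conj_ofReal, Complex.conj_I, h.even, inner_neg_left]
    congr 2
    push_cast
    ring
  · have hn : -ξ ∉ S := fun hn => hξ (by simpa using h.neg_mem _ hn)
    rw [indicator_of_notMem hn, indicator_of_notMem hξ, map_zero]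

/-- At a fixed time the packet is the inverse transform of the bounded function g·exp(γt) supported
on a bounded set, which lies in L¹ ∩ L², so Plancherel applies. -/
theorem horizontalSq_cwave (h : IsSpectrum S γ) {g : Freq → ℂ} (hg : IsSymbol S g) (r : ℕ)
    (t : ℝ) : horizontalSq r (fun y => (cwave S γ g t y).re) =
      ∫⁻ ξ in S, ENNReal.ofReal ((1 + ‖ξ‖ ^ 2) ^ r) *
        (ENNReal.ofReal ((2 * Real.pi) ^ 2) * ‖g ξ * Real.exp (γ ξ * t)‖ₑ) ^ 2 := by
  have hm : Measurable (fun ξ => g ξ * ((Real.exp (γ ξ * t) : ℝ) : ℂ)) := by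
    have := h.measurable
    have := hg.measurable
    fun_prop
  have hfin : IsFiniteMeasure (volume.restrict S) := ⟨by simpa using h.volume_lt_top⟩
  obtain ⟨C, hC, hC'⟩ := hg.bdd
  obtain ⟨q, hq, hb⟩ := h.norm_planeWave_le
  have hbd : ∀ᵐ ξ ∂(volume.restrict S),
      ‖g ξ * ((Real.exp (γ ξ * t) : ℝ) : ℂ)‖ ≤ C * Real.exp (q * |t|) := by
    refine (ae_restrict_iff' h.measurableSet).2 (.of_forall fun ξ hξ => ?_)
    rw [norm_mul]
    refine mul_le_mul (hC' ξ hξ) ?_ (norm_nonneg _) hC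
    have := hb ξ hξ _ t 0 le_rfl
    rw [norm_planeWave] at this
    rwa [Complex.norm_real, Real.norm_of_nonneg (Real.exp_pos _).le]
  have hL : ∀ p : ℝ≥0∞, MemLp (S.indicator fun ξ => g ξ * ((Real.exp (γ ξ * t) : ℝ) : ℂ)) p :=
    fun p => (memLp_indicator_iff_restrict h.measurableSet).2
      (MemLp.of_bound hm.aestronglyMeasurable _ hbd)
  rw [horizontalSq_of_eq_synth r (memLp_one_iff_integrable.1 (hL 1)) (hL 2),
    ← lintegral_indicator h.measurableSet]
  · congr 1
    funext ξ
    by_cases hξ : ξ ∈ S <;> simp [hξ]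
  · intro y
    rw [cwave_eq_re h hg, synth, cwave, ← integral_indicator h.measurableSet]
    congr 1
    funext ξ
    by_cases hξ : ξ ∈ S
    · simp only [hξ, indicator_of_mem, planeWave, Complex.exp_add, Complex.ofReal_exp]
      ring
    · simp [hξ]

/-- Amplitudes depending on the height `z ∈ [a, b]`. -/
structure IsAmplitude (S : Set Freq) (a b : ℝ) (G : Freq → ℝ → ℂ) : Prop where
  isSymbol : ∀ z ∈ Icc a b, IsSymbol S (fun ξ => G ξ z)
  continuousOn : ∀ ξ ∈ S, ContinuousOn (G ξ) (Icc a b)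
  bdd : ∃ C, 0 ≤ C ∧ ∀ ξ ∈ S, ∀ z ∈ Icc a b, ‖G ξ z‖ ≤ C

theorem IsAmplitude.symbol_mul {a b : ℝ} {G : Freq → ℝ → ℂ} (hG : IsAmplitude S a b G)
    {m : Freq → ℂ} (hm : IsSymbol S m) : IsAmplitude S a b (fun ξ z => m ξ * G ξ z) := by
  refine ⟨fun z hz => hm.mul (hG.isSymbol z hz),
    fun ξ hξ => continuousOn_const.mul (hG.continuousOn ξ hξ), ?_⟩
  obtain ⟨C, hC, hC'⟩ := hm.bdd
  obtain ⟨D, hD, hD'⟩ := hG.bdd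
  refine ⟨C * D, mul_nonneg hC hD, fun ξ hξ z hz => ?_⟩
  rw [norm_mul]
  exact mul_le_mul (hC' ξ hξ) (hD' ξ hξ z hz) (norm_nonneg _) hC

theorem continuousOn_cwave (h : IsSpectrum S γ) {a b : ℝ} {G : Freq → ℝ → ℂ}
    (hG : IsAmplitude S a b G) :
    ContinuousOn (fun p : ℝ × Pt => cwave S γ (fun ξ => G ξ p.2.2) p.1 p.2.1)
      (univ ×ˢ (univ ×ˢ Icc a b)) := by
  intro p₀ hp₀
  obtain ⟨C, hC, hC'⟩ := hG.bdd
  obtain ⟨r, hr, hb⟩ := h.norm_planeWave_le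
  have hfin : IsFiniteMeasure (volume.restrict S) := ⟨by simpa using h.volume_lt_top⟩
  unfold cwave
  refine continuousWithinAt_of_dominated
    (bound := fun _ => C * Real.exp (r * (|p₀.1| + 1))) ?_ ?_ (integrable_const _) ?_
  · filter_upwards [self_mem_nhdsWithin] with p hp
    exact ((hG.isSymbol p.2.2 hp.2.2).measurable.mul
      (measurable_planeWave h p.1 p.2.1)).aestronglyMeasurable
  · have h1 : ∀ᶠ p : ℝ × Pt in nhdsWithin p₀ (univ ×ˢ (univ ×ˢ Icc a b)), |p.1| < |p₀.1| + 1 := by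
      have : ContinuousAt (fun p : ℝ × Pt => |p.1|) p₀ := by fun_prop
      exact (this.eventually_lt continuousAt_const (by simp)).filter_mono nhdsWithin_le_nhds
    filter_upwards [h1, self_mem_nhdsWithin] with p hp hps
    refine (ae_restrict_iff' h.measurableSet).2 (.of_forall fun ξ hξ => ?_)
    rw [norm_mul]
    exact mul_le_mul (hC' ξ hξ _ hps.2.2) (hb ξ hξ _ _ _ hp.le) (norm_nonneg _) hC
  · refine (ae_restrict_iff' h.measurableSet).2 (.of_forall fun ξ hξ => ?_)
    have h1 : ContinuousWithinAt (fun p : ℝ × Pt => G ξ p.2.2) (univ ×ˢ (univ ×ˢ Icc a b)) p₀ :=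
      ContinuousWithinAt.comp (t := Icc a b) (hG.continuousOn ξ hξ p₀.2.2 hp₀.2.2)
        (by fun_prop) (fun p hp => hp.2.2)
    have h2 : Continuous (fun p : ℝ × Pt => planeWave γ ξ p.1 p.2.1) := by
      unfold planeWave; fun_prop
    exact h1.mul h2.continuousWithinAt

/-- The `ℂ`-valued coordinate functionals on `ℝ × Pt`. -/
def timeCoord : ℝ × Pt →L[ℝ] ℂ := Complex.ofRealCLM ∘L ContinuousLinearMap.fst ℝ ℝ Pt

/-- The horizontal coordinates. -/
def horCoord (i : Fin 2) : ℝ × Pt →L[ℝ] ℂ :=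
  Complex.ofRealCLM ∘L EuclideanSpace.proj i ∘L ContinuousLinearMap.fst ℝ Freq ℝ ∘L
    ContinuousLinearMap.snd ℝ ℝ Pt

/-- The vertical coordinate. -/
def vertCoord : ℝ × Pt →L[ℝ] ℂ :=
  Complex.ofRealCLM ∘L ContinuousLinearMap.snd ℝ Freq ℝ ∘L ContinuousLinearMap.snd ℝ ℝ Pt

theorem hasFDerivAt_mul_planeWave {G G' : ℝ → ℂ} {ξ : Freq} {p : ℝ × Pt}
    (hG : HasDerivAt G (G' p.2.2) p.2.2) :
    HasFDerivAt (fun p : ℝ × Pt => G p.2.2 * planeWave γ ξ p.1 p.2.1)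
      ((γ ξ * G p.2.2 * planeWave γ ξ p.1 p.2.1) • timeCoord +
        (∑ i, (Complex.I * ξ i * G p.2.2 * planeWave γ ξ p.1 p.2.1) • horCoord i) +
        (G' p.2.2 * planeWave γ ξ p.1 p.2.1) • vertCoord) p := by
  have h1 : HasFDerivAt (fun p : ℝ × Pt => G p.2.2)
      ((ContinuousLinearMap.toSpanSingleton ℝ (G' p.2.2)) ∘L
        (ContinuousLinearMap.snd ℝ Freq ℝ ∘L ContinuousLinearMap.snd ℝ ℝ Pt)) p :=
    HasFDerivAt.comp p hG.hasFDerivAt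
      (ContinuousLinearMap.snd ℝ Freq ℝ ∘L ContinuousLinearMap.snd ℝ ℝ Pt).hasFDerivAt
  have h2 : HasFDerivAt (fun p : ℝ × Pt =>
      ((γ ξ * p.1 : ℝ) : ℂ) + Complex.I * ((inner ℝ ξ p.2.1 : ℝ) : ℂ))
      ((γ ξ : ℂ) • timeCoord + ∑ i, (Complex.I * ξ i) • horCoord i) p := by
    have e : (fun p : ℝ × Pt => ((γ ξ * p.1 : ℝ) : ℂ) + Complex.I * ((inner ℝ ξ p.2.1 : ℝ) : ℂ)) =
        ⇑((γ ξ : ℂ) • timeCoord + ∑ i, (Complex.I * ξ i) • horCoord i) := by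
      funext p
      simp only [timeCoord, horCoord, PiLp.inner_apply, Fin.sum_univ_two]
      simp
      ring
    rw [e]
    exact ContinuousLinearMap.hasFDerivAt _
  have h3 := h1.mul h2.cexp
  refine h3.congr_fderiv ?_
  ext v <;> simp [planeWave, timeCoord, horCoord, vertCoord] <;> ring

/-- Differentiation under the integral: ∂ₜ multiplies the symbol by γ, horizontal derivatives
multiply it by iξ, and ∂₃ acts on the amplitude. The dominating function is constant because
frequencies, rates and amplitudes are bounded on `S`. -/
theorem hasFDerivAt_cwave (h : IsSpectrum S γ) {a b : ℝ} {G G' : Freq → ℝ → ℂ}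
    (hG : IsAmplitude S a b G) (hG' : IsAmplitude S a b G')
    (hd : ∀ ξ ∈ S, ∀ z ∈ Ioo a b, HasDerivAt (G ξ) (G' ξ z) z) {p : ℝ × Pt}
    (hp : p.2.2 ∈ Ioo a b) :
    HasFDerivAt (fun p : ℝ × Pt => cwave S γ (fun ξ => G ξ p.2.2) p.1 p.2.1)
      (cwave S γ (fun ξ => γ ξ * G ξ p.2.2) p.1 p.2.1 • timeCoord +
        (∑ i, cwave S γ (fun ξ => Complex.I * ξ i * G ξ p.2.2) p.1 p.2.1 • horCoord i) +
        cwave S γ (fun ξ => G' ξ p.2.2) p.1 p.2.1 • vertCoord) p := by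
  obtain ⟨r, hr, hb⟩ := h.norm_planeWave_le
  have hfin : IsFiniteMeasure (volume.restrict S) := ⟨by simpa using h.volume_lt_top⟩
  have hA0 := hG.symbol_mul h.isSymbol
  have hAi := fun i => hG.symbol_mul (h.isSymbol_coord i)
  obtain ⟨C0, hC0, hC0'⟩ := hA0.bdd
  choose Ci hCi hCi' using fun i => (hAi i).bdd
  obtain ⟨C1, hC1, hC1'⟩ := hG'.bdd
  -- The growth factor is bounded only for bounded times, so the domination is carried out on a
  -- neighbourhood of `p` with |t| < T.
  set T := |p.1| + 1
  set s : Set (ℝ × Pt) := {q | |q.1| < T ∧ q.2.2 ∈ Ioo a b}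
  have hso : IsOpen s := by
    refine IsOpen.inter (isOpen_lt (f := fun q : ℝ × Pt => |q.1|) (by fun_prop) continuous_const) ?_
    exact isOpen_Ioo.preimage (f := fun q : ℝ × Pt => q.2.2) (by fun_prop)
  have hs : s ∈ nhds p := hso.mem_nhds ⟨by simp [T], hp⟩
  have hsub := Ioo_subset_Icc_self (a := a) (b := b)
  have key := hasFDerivAt_integral_of_dominated_of_fderiv_le (𝕜 := ℝ)
    (μ := volume.restrict S) (x₀ := p) (s := s)
    (F := fun (q : ℝ × Pt) ξ => G ξ q.2.2 * planeWave γ ξ q.1 q.2.1)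
    (F' := fun (q : ℝ × Pt) ξ => (γ ξ * G ξ q.2.2 * planeWave γ ξ q.1 q.2.1) • timeCoord +
        (∑ i, (Complex.I * ξ i * G ξ q.2.2 * planeWave γ ξ q.1 q.2.1) • horCoord i) +
        (G' ξ q.2.2 * planeWave γ ξ q.1 q.2.1) • vertCoord)
    (bound := fun _ => C0 * Real.exp (r * T) * ‖timeCoord‖ +
      (∑ i, Ci i * Real.exp (r * T) * ‖horCoord i‖) + C1 * Real.exp (r * T) * ‖vertCoord‖)
    hs ?_ ?_ ?_ ?_ (integrable_const _) ?_
  · refine key.congr_fderiv ?_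
    have i0 := (hA0.isSymbol p.2.2 (hsub hp)).integrableOn h p.1 p.2.1
    have ii := fun i => ((hAi i).isSymbol p.2.2 (hsub hp)).integrableOn h p.1 p.2.1
    have i1 := (hG'.isSymbol p.2.2 (hsub hp)).integrableOn h p.1 p.2.1
    rw [integral_add, integral_add, integral_finsetSum, integral_smul_const, integral_smul_const]
    · simp_rw [integral_smul_const]
      rfl
    · exact fun i _ => (ii i).smul_const _
    · exact i0.smul_const _
    · exact integrable_finsetSum _ fun i _ => (ii i).smul_const _
    · exact (i0.smul_const _).add (integrable_finsetSum _ fun i _ => (ii i).smul_const _)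
    · exact i1.smul_const _
  · filter_upwards [hs] with q hq
    exact ((hG.isSymbol q.2.2 (hsub hq.2)).measurable.mul
      (measurable_planeWave h q.1 q.2.1)).aestronglyMeasurable
  · exact (hG.isSymbol p.2.2 (hsub hp)).integrableOn h p.1 p.2.1
  · have i0 := (hA0.isSymbol p.2.2 (hsub hp)).integrableOn h p.1 p.2.1
    have ii := fun i => ((hAi i).isSymbol p.2.2 (hsub hp)).integrableOn h p.1 p.2.1
    have i1 := (hG'.isSymbol p.2.2 (hsub hp)).integrableOn h p.1 p.2.1
    have j0 := i0.smul_const timeCoord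
    have ji := integrable_finsetSum Finset.univ fun i _ => (ii i).smul_const (horCoord i)
    have j1 := i1.smul_const vertCoord
    exact (j0.aestronglyMeasurable.add ji.aestronglyMeasurable).add j1.aestronglyMeasurable
  · refine (ae_restrict_iff' h.measurableSet).2 (.of_forall fun ξ hξ q hq => ?_)
    have hw := hb ξ hξ T q.1 q.2.1 hq.1.le
    refine (norm_add_le _ _).trans (add_le_add ((norm_add_le _ _).trans (add_le_add ?_ ?_)) ?_)
    · rw [norm_smul, norm_mul]
      gcongr
      exact hC0' ξ hξ _ (hsub hq.2)
    · refine (norm_sum_le _ _).trans (Finset.sum_le_sum fun i _ => ?_)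
      rw [norm_smul, norm_mul]
      gcongr
      · exact hCi i
      · exact hCi' i ξ hξ _ (hsub hq.2)
    · rw [norm_smul, norm_mul]
      gcongr
      exact hC1' ξ hξ _ (hsub hq.2)
  · exact (ae_restrict_iff' h.measurableSet).2 (.of_forall fun ξ hξ q hq =>
      hasFDerivAt_mul_planeWave (G' := G' ξ) (hd ξ hξ q.2.2 hq.2))

theorem contDiffOn_cwave (h : IsSpectrum S γ) {a b : ℝ} {G G' : Freq → ℝ → ℂ}
    (hG : IsAmplitude S a b G) (hG' : IsAmplitude S a b G')
    (hd : ∀ ξ ∈ S, ∀ z ∈ Ioo a b, HasDerivAt (G ξ) (G' ξ z) z) :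
    ContDiffOn ℝ 1 (fun p : ℝ × Pt => cwave S γ (fun ξ => G ξ p.2.2) p.1 p.2.1)
      (univ ×ˢ (univ ×ˢ Ioo a b)) := by
  have ho : IsOpen (univ ×ˢ (univ ×ˢ Ioo a b) : Set (ℝ × Pt)) :=
    isOpen_univ.prod (isOpen_univ.prod isOpen_Ioo)
  have hsub : (univ ×ˢ (univ ×ˢ Ioo a b) : Set (ℝ × Pt)) ⊆ univ ×ˢ (univ ×ˢ Icc a b) :=
    prod_mono_right (prod_mono_right Ioo_subset_Icc_self)
  rw [show (1 : WithTop ℕ∞) = 0 + 1 from rfl,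
    contDiffOn_succ_iff_hasFDerivWithinAt_of_uniqueDiffOn ho.uniqueDiffOn]
  refine ⟨by simp, _, ?_, fun p hp => (hasFDerivAt_cwave h hG hG' hd hp.2.2).hasFDerivWithinAt⟩
  rw [contDiffOn_zero]
  have c0 := (continuousOn_cwave h (hG.symbol_mul h.isSymbol)).mono hsub
  have ci := fun i => (continuousOn_cwave h (hG.symbol_mul (h.isSymbol_coord i))).mono hsub
  have c1 := (continuousOn_cwave h hG').mono hsub
  exact ((c0.smul continuousOn_const).add
    (continuousOn_finsetSum _ fun i _ => (ci i).smul continuousOn_const)).add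
    (c1.smul continuousOn_const)

end

/-! ### A linear system of two equations with parameters -/

section LinearSystem

variable {X : Type*}

/-- Picard iterates for the system `U' = α V`, `V' = β U`, `U(0) = 0`, `V(0) = 1`. -/
def picardTerm (α β : X → ℝ → ℝ) : ℕ → X → ℝ → ℝ × ℝ
  | 0 => fun _ _ => (0, 1)
  | n + 1 => fun P τ => (∫ s in (0 : ℝ)..τ, α P s * (picardTerm α β n P s).2,
      ∫ s in (0 : ℝ)..τ, β P s * (picardTerm α β n P s).1)

theorem abs_intervalIntegral_le_pow_div {f : ℝ → ℝ} {C τ : ℝ} (hC : 0 ≤ C) (n : ℕ)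
    (hf : ∀ s, |s| ≤ |τ| → |f s| ≤ C * ((C * |s|) ^ n / n.factorial)) :
    |∫ s in (0 : ℝ)..τ, f s| ≤ (C * |τ|) ^ (n + 1) / (n + 1).factorial := by
  have h1 : |∫ s in (0 : ℝ)..τ, f s| ≤
      |∫ s in (0 : ℝ)..τ, C * ((C * |s - 0|) ^ n / n.factorial)| := by
    have hc : Continuous fun s : ℝ => C * ((C * |s - 0|) ^ n / n.factorial) := by fun_prop
    refine intervalIntegral.norm_integral_le_abs_of_norm_le (μ := volume) (f := f)
      (g := fun s => C * ((C * |s - 0|) ^ n / n.factorial)) ?_ (hc.intervalIntegrable (μ := volume) 0 τ)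
    refine (ae_restrict_iff' measurableSet_uIoc).2 (.of_forall fun s hs => ?_)
    rw [sub_zero]
    apply hf
    rcases le_total 0 τ with h | h
    · rw [uIoc_of_le h] at hs
      rw [abs_of_pos hs.1, abs_of_nonneg h]; exact hs.2
    · rw [uIoc_of_ge h] at hs
      rw [abs_of_nonpos hs.2, abs_of_nonpos h]; linarith [hs.1]
  refine h1.trans (le_of_eq ?_)
  have e : ∀ s : ℝ, C * ((C * |s - 0|) ^ n / n.factorial) =
      (C ^ (n + 1) / n.factorial) * |s - 0| ^ n := by
    intro s; rw [mul_pow, pow_succ]; ring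
  simp_rw [e]
  rw [intervalIntegral.integral_const_mul, abs_mul, intervalIntegral.abs_intervalIntegral_eq,
    integral_pow_abs_sub_uIoc, sub_zero, abs_of_nonneg (by positivity),
    abs_of_nonneg (by positivity), Nat.factorial_succ, mul_pow]
  push_cast
  field_simp

/-- Each Picard step integrates the previous bound against a coefficient of size at most `C`, which
produces the terms of the exponential series. -/
theorem norm_picardTerm_le {α β : X → ℝ → ℝ} {P : X} {C T : ℝ} (hC : 0 ≤ C)
    (h : ∀ s, |s| ≤ T → |α P s| ≤ C ∧ |β P s| ≤ C) (n : ℕ) (τ : ℝ) (hτ : |τ| ≤ T) :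
    ‖picardTerm α β n P τ‖ ≤ (C * |τ|) ^ n / n.factorial := by
  induction n generalizing τ with
  | zero => simp [picardTerm]
  | succ n ih =>
    rw [picardTerm, Prod.norm_def, max_le_iff]
    constructor <;>
    · refine abs_intervalIntegral_le_pow_div hC n fun s hs => ?_
      rw [abs_mul]
      have h1 := ih s (hs.trans hτ)
      have h2 := h s (hs.trans hτ)
      rw [Prod.norm_def, max_le_iff] at h1
      exact mul_le_mul (by first | exact h2.1 | exact h2.2)
        (by first | exact h1.2 | exact h1.1) (abs_nonneg _) hC

variable [MetricSpace X]

theorem continuous_picardTerm {α β : X → ℝ → ℝ} (hα : Continuous fun p : X × ℝ => α p.1 p.2)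
    (hβ : Continuous fun p : X × ℝ => β p.1 p.2) (n : ℕ) :
    Continuous fun p : X × ℝ => picardTerm α β n p.1 p.2 := by
  induction n with
  | zero => exact continuous_const
  | succ n ih =>
    have key : ∀ f : X → ℝ → ℝ, (Continuous fun p : X × ℝ => f p.1 p.2) →
        Continuous fun p : X × ℝ => ∫ s in (0 : ℝ)..p.2, f p.1 s := by
      intro f hf
      exact intervalIntegral.continuous_parametric_intervalIntegral_of_continuous
        (f := fun (p : X × ℝ) s => f p.1 s)
        (hf.comp (f := fun p : (X × ℝ) × ℝ => (p.1.1, p.2)) (by fun_prop)) continuous_snd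
    exact (key (fun P s => α P s * (picardTerm α β n P s).2) (hα.mul ih.snd)).prodMk
      (key (fun P s => β P s * (picardTerm α β n P s).1) (hβ.mul ih.fst))

/-- Global solutions of a linear system, jointly continuous in time and parameters. -/
theorem exists_linear_flow [ProperSpace X] {α β : X → ℝ → ℝ} (hα : Continuous fun p : X × ℝ => α p.1 p.2)
    (hβ : Continuous fun p : X × ℝ => β p.1 p.2) :
    ∃ U V : X → ℝ → ℝ, (Continuous fun p : X × ℝ => U p.1 p.2) ∧
      (Continuous fun p : X × ℝ => V p.1 p.2) ∧
      (∀ P, U P 0 = 0 ∧ V P 0 = 1) ∧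
      (∀ P τ, HasDerivAt (U P) (α P τ * V P τ) τ ∧ HasDerivAt (V P) (β P τ * U P τ) τ) ∧
      ∀ P, (∀ τ, 0 ≤ τ → 0 ≤ α P τ ∧ 0 ≤ β P τ) → ∀ τ, 0 ≤ τ → 0 ≤ U P τ ∧ 1 ≤ V P τ := by
  set Y := picardTerm α β with hY
  have hYc := continuous_picardTerm hα hβ
  have bound : ∀ (P₀ : X) (T : ℝ), ∃ C, 0 ≤ C ∧ ∀ P ∈ Metric.closedBall P₀ 1, ∀ s, |s| ≤ T →
      |α P s| ≤ C ∧ |β P s| ≤ C := by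
    intro P₀ T
    have hK : IsCompact (Metric.closedBall P₀ 1 ×ˢ Icc (-T) T) :=
      (isCompact_closedBall P₀ 1).prod isCompact_Icc
    obtain ⟨C₁, h₁⟩ := hK.exists_bound_of_continuousOn hα.continuousOn
    obtain ⟨C₂, h₂⟩ := hK.exists_bound_of_continuousOn hβ.continuousOn
    refine ⟨max 0 (max C₁ C₂), le_max_left _ _, fun P hP s hs => ?_⟩
    have hm : (P, s) ∈ Metric.closedBall P₀ 1 ×ˢ Icc (-T) T := ⟨hP, abs_le.1 hs⟩
    exact ⟨(h₁ _ hm).trans (by simp), (h₂ _ hm).trans (by simp)⟩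
  have hYb : ∀ {P : X} {C T : ℝ}, 0 ≤ C → (∀ s, |s| ≤ T → |α P s| ≤ C ∧ |β P s| ≤ C) →
      ∀ n τ, |τ| ≤ T → ‖Y n P τ‖ ≤ (C * T) ^ n / n.factorial := by
    intro P C T hC h n τ hτ
    refine (norm_picardTerm_le hC h n τ hτ).trans ?_
    gcongr
  have hsum : ∀ P τ, Summable fun n => Y n P τ := by
    intro P τ
    obtain ⟨C, hC, h⟩ := bound P |τ|
    exact Summable.of_norm_bounded (Real.summable_pow_div_factorial (C * |τ|))
      fun n => hYb hC (h P (by simp)) n τ le_rfl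
  have hcont : Continuous fun p : X × ℝ => ∑' n, Y n p.1 p.2 := by
    rw [continuous_iff_continuousAt]
    rintro ⟨P₀, τ₀⟩
    obtain ⟨C, hC, h⟩ := bound P₀ (|τ₀| + 1)
    have ho : Metric.closedBall P₀ 1 ×ˢ Metric.closedBall τ₀ 1 ∈ nhds (P₀, τ₀) :=
      prod_mem_nhds (Metric.closedBall_mem_nhds _ one_pos) (Metric.closedBall_mem_nhds _ one_pos)
    refine ContinuousOn.continuousAt ?_ ho
    refine continuousOn_tsum (fun n => (hYc n).continuousOn)
      (Real.summable_pow_div_factorial (C * (|τ₀| + 1))) ?_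
    rintro n ⟨P, τ⟩ ⟨hP, hτ⟩
    refine hYb hC (h P hP) n τ ?_
    rw [Metric.mem_closedBall, Real.dist_eq] at hτ
    calc |τ| = |τ₀ + (τ - τ₀)| := by ring_nf
      _ ≤ |τ₀| + 1 := (abs_add_le _ _).trans (by gcongr)
  have hsum1 : ∀ P τ, Summable fun n => (Y n P τ).1 :=
    fun P τ => (hsum P τ).map (AddMonoidHom.fst ℝ ℝ) continuous_fst
  have hsum2 : ∀ P τ, Summable fun n => (Y n P τ).2 :=
    fun P τ => (hsum P τ).map (AddMonoidHom.snd ℝ ℝ) continuous_snd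
  have hfst : ∀ P τ, (∑' n, Y n P τ).1 = ∑' n, (Y n P τ).1 :=
    fun P τ => (hsum P τ).map_tsum (AddMonoidHom.fst ℝ ℝ) continuous_fst
  have hsnd : ∀ P τ, (∑' n, Y n P τ).2 = ∑' n, (Y n P τ).2 :=
    fun P τ => (hsum P τ).map_tsum (AddMonoidHom.snd ℝ ℝ) continuous_snd
  refine ⟨fun P τ => ∑' n, (Y n P τ).1, fun P τ => ∑' n, (Y n P τ).2, ?_, ?_, ?_, ?_, ?_⟩
  · simpa only [hfst] using hcont.fst
  · simpa only [hsnd] using hcont.snd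
  · intro P
    constructor
    · have : ∀ n, (Y n P 0).1 = 0 := by
        intro n; cases n <;> simp [hY, picardTerm]
      simp [this]
    · refine (hsum2 P 0).tsum_eq_zero_add.trans ?_
      simp [hY, picardTerm]
  · intro P τ
    obtain ⟨C, hC, h⟩ := bound P (|τ| + 1)
    have h' := h P (by simp)
    set T := |τ| + 1
    have hT : 0 ≤ T := by positivity
    have hball : ∀ s ∈ Metric.ball (0 : ℝ) T, |s| ≤ T := by
      intro s hs
      have : |s| < T := by simpa using hs
      exact this.le
    -- The derivative of the n-th iterate is a coefficient times the (n-1)-st iterate. At n = 0 the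
    -- derivative is zero and the truncated n - 1 = 0 gives the harmless bound `C`.
    have hu : Summable fun n : ℕ => C * ((C * T) ^ (n - 1) / (n - 1).factorial) := by
      apply Summable.mul_left
      rw [← summable_nat_add_iff 1]
      simpa using Real.summable_pow_div_factorial (C * T)
    have h0 : (0 : ℝ) ∈ Metric.ball (0 : ℝ) T := by simp [T]; positivity
    have hτ : τ ∈ Metric.ball (0 : ℝ) T := by simp [T]
    have key : ∀ (y w : ℕ → ℝ → ℝ) (g : ℝ → ℝ), (∀ n, Continuous (w n)) → Continuous g →
        (∀ s, |s| ≤ T → |g s| ≤ C) → (∀ n s, |s| ≤ T → |w n s| ≤ (C * T) ^ n / n.factorial) →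
        (∀ s, Summable fun n => y n s) →
        (∃ k, ∀ s, y 0 s = k) → (∀ n s, y (n + 1) s = ∫ r in (0 : ℝ)..s, g r * w n r) →
        HasDerivAt (fun s => ∑' n, y n s) (g τ * ∑' n, w n τ) τ := by
      intro y w g hw hg hgC hwC hys hy0 hy
      obtain ⟨k, hk⟩ := hy0
      have hd := hasDerivAt_tsum_of_isPreconnected (g := y) (y₀ := 0) (y := τ)
        (g' := fun n s => Nat.casesOn n 0 fun n => g s * w n s)
        hu Metric.isOpen_ball (Metric.isConnected_ball (x := (0 : ℝ)) (by positivity)).isPreconnected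
        (by
          intro n s _
          cases n with
          | zero =>
            rw [show y 0 = fun _ => k from funext hk]
            exact hasDerivAt_const s k
          | succ n =>
            rw [show y (n + 1) = fun s => ∫ r in (0 : ℝ)..s, g r * w n r from funext (hy n)]
            have hc : Continuous fun r => g r * w n r := hg.mul (hw n)
            exact hc.integral_hasStrictDerivAt 0 s |>.hasDerivAt)
        (by
          intro n s hs
          cases n with
          | zero => simpa using hC
          | succ n =>
            simp only [Nat.add_sub_cancel, norm_mul, Real.norm_eq_abs]
            exact mul_le_mul (hgC s (hball s hs)) (hwC n s (hball s hs)) (abs_nonneg _) hC)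
        h0 (hys 0) hτ
      refine hd.congr_deriv (Eq.symm ?_)
      rw [← tsum_mul_left]
      have hws : Summable fun n => g τ * w n τ := by
        apply Summable.mul_left
        exact Summable.of_norm_bounded (Real.summable_pow_div_factorial (C * T))
          fun n => hwC n τ (hball τ hτ)
      have hs' : Summable (fun n : ℕ => (Nat.casesOn n 0 fun n => g τ * w n τ : ℝ)) :=
        (summable_nat_add_iff 1).1 hws
      refine Eq.symm (hs'.tsum_eq_zero_add.trans ?_)
      simp
    have hcomp : ∀ n, Continuous fun s => Y n P s := fun n =>
      (hYc n).comp (f := fun s : ℝ => (P, s)) (by fun_prop)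
    have hYn := hYb hC h'
    constructor
    · exact key _ (fun n s => (Y n P s).2) (α P) (fun n => (hcomp n).snd)
        (hα.comp (f := fun s : ℝ => (P, s)) (by fun_prop)) (fun s hs => (h' s hs).1)
        (fun n s hs => (norm_snd_le _).trans (hYn n s hs)) (hsum1 P) ⟨0, fun _ => rfl⟩
        (fun n s => rfl)
    · exact key _ (fun n s => (Y n P s).1) (β P) (fun n => (hcomp n).fst)
        (hβ.comp (f := fun s : ℝ => (P, s)) (by fun_prop)) (fun s hs => (h' s hs).2)
        (fun n s hs => (norm_fst_le _).trans (hYn n s hs)) (hsum2 P) ⟨1, fun _ => rfl⟩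
        (fun n s => rfl)
  · intro P hP
    -- With nonnegative coefficients every iterate is nonnegative for τ ≥ 0, so the sum for `V` is
    -- at least its zeroth term, which is 1.
    have hpos : ∀ n τ, 0 ≤ τ → 0 ≤ (Y n P τ).1 ∧ 0 ≤ (Y n P τ).2 := by
      intro n
      induction n with
      | zero => intro τ _; simp [hY, picardTerm]
      | succ n ih =>
        intro τ hτ
        exact ⟨intervalIntegral.integral_nonneg hτ fun s hs => mul_nonneg (hP s hs.1).1 (ih s hs.1).2,
          intervalIntegral.integral_nonneg hτ fun s hs => mul_nonneg (hP s hs.1).2 (ih s hs.1).1⟩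
    intro τ hτ
    refine ⟨tsum_nonneg fun n => (hpos n τ hτ).1, ?_⟩
    have := (hsum2 P τ).sum_le_tsum {0} (fun n _ => (hpos n τ hτ).2)
    simpa [hY, picardTerm] using this

end LinearSystem

/-! ### Comparison of the two components of the flow -/

section Barriers

variable {α β U V : ℝ → ℝ} {d : ℝ}

/-- `V(d)` is small compared with `U(d)` if `β` is small compared with `α`. -/
theorem flow_upper_barrier (hd : 0 ≤ d) (hU : ∀ τ, HasDerivAt U (α τ * V τ) τ)
    (hV : ∀ τ, HasDerivAt V (β τ * U τ) τ) (h0 : U 0 = 0 ∧ V 0 = 1)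
    (hpos : ∀ τ, 0 ≤ τ → 0 ≤ U τ ∧ 1 ≤ V τ) {M : ℝ} (hM : 0 < M)
    (h : ∀ τ ∈ Icc 0 d, M ^ 2 * β τ ≤ α τ) (hm : ∀ τ ∈ Icc 0 d, M ≤ α τ * d) :
    M * V d ≤ 2 * U d := by
  -- The derivative is 2UV(α - M²β) ≥ 0, and the initial value is -M².
  have hmono : MonotoneOn (fun τ => U τ ^ 2 - M ^ 2 * V τ ^ 2) (Icc 0 d) := by
    have hder : ∀ τ, HasDerivAt (fun τ => U τ ^ 2 - M ^ 2 * V τ ^ 2)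
        (2 * U τ * V τ * (α τ - M ^ 2 * β τ)) τ := by
      intro τ
      refine (((hU τ).pow 2).sub (((hV τ).pow 2).const_mul (M ^ 2))).congr_deriv ?_
      push_cast; ring
    refine monotoneOn_of_deriv_nonneg (convex_Icc 0 d)
      (fun τ _ => (hder τ).continuousAt.continuousWithinAt)
      (fun τ _ => (hder τ).differentiableAt.differentiableWithinAt) fun τ hτ => ?_
    rw [interior_Icc] at hτ
    rw [(hder τ).deriv]
    obtain ⟨h1, h2⟩ := hpos τ hτ.1.le
    have := h τ (Ioo_subset_Icc_self hτ)
    have h3 : 0 ≤ V τ := by linarith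
    exact mul_nonneg (by positivity) (by linarith)
  have hlin : MonotoneOn (fun τ => d * U τ - M * τ) (Icc 0 d) := by
    have hder : ∀ τ, HasDerivAt (fun τ => d * U τ - M * τ) (d * (α τ * V τ) - M * 1) τ :=
      fun τ => ((hU τ).const_mul d).sub ((hasDerivAt_id τ).const_mul M)
    refine monotoneOn_of_deriv_nonneg (convex_Icc 0 d)
      (fun τ _ => (hder τ).continuousAt.continuousWithinAt)
      (fun τ _ => (hder τ).differentiableAt.differentiableWithinAt) fun τ hτ => ?_
    rw [interior_Icc] at hτ
    rw [(hder τ).deriv]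
    obtain ⟨h1, h2⟩ := hpos τ hτ.1.le
    have := hm τ (Ioo_subset_Icc_self hτ)
    nlinarith
  have hl : (0 : ℝ) ∈ Icc 0 d := ⟨le_rfl, hd⟩
  have hr : d ∈ Icc 0 d := ⟨hd, le_rfl⟩
  have h1 := hmono hl hr hd
  have h2 := hlin hl hr hd
  simp only [h0.1, h0.2] at h1 h2
  obtain ⟨hUd, hVd⟩ := hpos d hd
  rcases hd.eq_or_lt with rfl | hd'
  · have := hm 0 hl
    linarith
  have h3 : M ≤ U d := by
    by_contra hc
    push Not at hc
    nlinarith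
  -- The deficit M² left by the initial value is absorbed by U(d) ≥ M: M²V² ≤ U² + M² ≤ 2U², whence
  -- the factor 2.
  have h4 : (M * V d) ^ 2 ≤ (2 * U d) ^ 2 := by nlinarith
  exact le_of_sq_le_sq h4 (by linarith)

/-- `U(d)` is small compared with `V(d)` if `α` is small compared with `β`. -/
theorem flow_lower_barrier (hd : 0 ≤ d) (hU : ∀ τ, HasDerivAt U (α τ * V τ) τ)
    (hV : ∀ τ, HasDerivAt V (β τ * U τ) τ) (h0 : U 0 = 0 ∧ V 0 = 1)
    (hpos : ∀ τ, 0 ≤ τ → 0 ≤ U τ ∧ 1 ≤ V τ) {e : ℝ} (he : 0 < e)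
    (h : ∀ τ ∈ Icc 0 d, α τ ≤ e ^ 2 * β τ) : U d ≤ e * V d := by
  have hmono : MonotoneOn (fun τ => e ^ 2 * V τ ^ 2 - U τ ^ 2) (Icc 0 d) := by
    have hder : ∀ τ, HasDerivAt (fun τ => e ^ 2 * V τ ^ 2 - U τ ^ 2)
        (2 * U τ * V τ * (e ^ 2 * β τ - α τ)) τ := by
      intro τ
      refine ((((hV τ).pow 2).const_mul (e ^ 2)).sub ((hU τ).pow 2)).congr_deriv ?_
      push_cast; ring
    refine monotoneOn_of_deriv_nonneg (convex_Icc 0 d)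
      (fun τ _ => (hder τ).continuousAt.continuousWithinAt)
      (fun τ _ => (hder τ).differentiableAt.differentiableWithinAt) fun τ hτ => ?_
    rw [interior_Icc] at hτ
    rw [(hder τ).deriv]
    obtain ⟨h1, h2⟩ := hpos τ hτ.1.le
    have := h τ (Ioo_subset_Icc_self hτ)
    have h3 : 0 ≤ V τ := by linarith
    exact mul_nonneg (by positivity) (by linarith)
  have h1 := hmono ⟨le_rfl, hd⟩ ⟨hd, le_rfl⟩ hd
  simp only [h0.1, h0.2] at h1
  obtain ⟨hUd, hVd⟩ := hpos d hd
  have h4 : U d ^ 2 ≤ (e * V d) ^ 2 := by nlinarith [sq_nonneg e]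
  exact le_of_sq_le_sq h4 (by positivity)

end Barriers

/-! ### Smoothness and positivity of the steady state -/

/-- The inverse function theorem supplies a smooth local inverse, and injectivity on `S` forces the
chosen inverse `Function.invFunOn` to coincide with it near `h a`. -/
theorem contDiffAt_invFunOn {h : ℝ → ℝ} {S : Set ℝ} (hS : IsOpen S) (hinj : InjOn h S) {a d : ℝ}
    (ha : a ∈ S) (hh : ContDiffAt ℝ ∞ h a) (hd : HasDerivAt h d a) (hd0 : d ≠ 0) :
    (∀ᶠ y in nhds (h a), y ∈ h '' S) ∧ ContDiffAt ℝ ∞ (Function.invFunOn h S) (h a) := by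
  have hf := hd.hasFDerivAt_equiv hd0
  have hst := hh.hasStrictFDerivAt' hf (by simp)
  constructor
  · have h1 := hst.eventually_right_inverse
    have h2 : ∀ᶠ y in nhds (h a), hst.localInverse h _ a y ∈ S := by
      have := hst.localInverse_tendsto
      exact this (hS.mem_nhds ha)
    filter_upwards [h1, h2] with y hy1 hy2
    exact ⟨_, hy2, hy1⟩
  · have hu := hst.localInverse_unique (g := Function.invFunOn h S) (by
      filter_upwards [hS.mem_nhds ha] with x hx
      exact hinj (Function.invFunOn_mem ⟨x, hx, rfl⟩) hx (Function.invFunOn_eq ⟨x, hx, rfl⟩))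
    exact (hh.to_localInverse hf (by simp)).congr_of_eventuallyEq hu

namespace Config

/-- The lower end of the vertical interval. -/
def lo (c : Config) : Phase → ℝ
  | .lower => -c.m
  | .upper => 0

/-- The upper end of the vertical interval. -/
def hi (c : Config) : Phase → ℝ
  | .lower => 0
  | .upper => c.ℓ

theorem interval_eq (c : Config) (s : Phase) : c.interval s = Ioo (c.lo s) (c.hi s) := by
  cases s <;> rfl

theorem slab_eq (c : Config) (s : Phase) : c.slab s = univ ×ˢ Ioo (c.lo s) (c.hi s) := by
  rw [slab, interval_eq]

/-- The open set on which the steady density is defined. -/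
def dom (c : Config) (s : Phase) : Set ℝ :=
  {z | enthalpy (c.P s) (c.rhoAt s) - c.g * z ∈ enthalpy (c.P s) '' Ioi 0}

namespace Admissible

variable {c : Config} (hc : c.Admissible) (s : Phase)
include hc

theorem lo_lt_hi : c.lo s < c.hi s := by
  cases s
  · simpa [lo, hi] using hc.m_pos
  · simpa [lo, hi] using hc.ℓ_pos

theorem closure_slab : closure (c.slab s) = univ ×ˢ Icc (c.lo s) (c.hi s) := by
  rw [slab_eq, closure_prod_eq, closure_univ, closure_Ioo (hc.lo_lt_hi s).ne]

/-- Strict monotonicity alone gives only P' ≥ 0; local boundedness of 1/P' excludes zeros. -/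
theorem deriv_P_pos {z : ℝ} (hz : 0 < z) : 0 < deriv (c.P s) z := by
  obtain ⟨B, hB⟩ := hc.P_inv_deriv s {z} (by simpa using hz) isCompact_singleton
  have h1 := hB z rfl
  have h2 : 0 ≤ deriv (c.P s) z := by
    have hm := (hc.P_strictMono s).monotoneOn.derivWithin_nonneg (x := z)
    rwa [derivWithin_of_isOpen isOpen_Ioi hz] at hm
  rcases h2.eq_or_lt with h | h
  · rw [← h] at h1; norm_num at h1
  · exact h

theorem contDiffOn_deriv_P : ContDiffOn ℝ ∞ (deriv (c.P s)) (Ioi 0) :=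
  ((contDiffOn_infty_iff_deriv_of_isOpen isOpen_Ioi).1 (hc.P_smooth s)).2

theorem contDiffOn_enthalpy_deriv : ContDiffOn ℝ ∞ (fun r => deriv (c.P s) r / r) (Ioi 0) :=
  (hc.contDiffOn_deriv_P s).div contDiffOn_id fun _ hx => ne_of_gt hx

theorem hasDerivAt_enthalpy {z : ℝ} (hz : 0 < z) :
    HasDerivAt (enthalpy (c.P s)) (deriv (c.P s) z / z) z := by
  have hcont := (hc.contDiffOn_enthalpy_deriv s).continuousOn
  refine intervalIntegral.integral_hasDerivAt_right ?_ ?_ (hcont.continuousAt (Ioi_mem_nhds hz))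
  · refine (hcont.mono ?_).intervalIntegrable
    intro x hx
    exact lt_of_lt_of_le (lt_min one_pos hz) hx.1
  · exact hcont.stronglyMeasurableAtFilter isOpen_Ioi z hz

theorem contDiffOn_enthalpy : ContDiffOn ℝ ∞ (enthalpy (c.P s)) (Ioi 0) := by
  refine (contDiffOn_infty_iff_deriv_of_isOpen isOpen_Ioi).2
    ⟨fun z hz => (hc.hasDerivAt_enthalpy s hz).differentiableAt.differentiableWithinAt, ?_⟩
  exact (hc.contDiffOn_enthalpy_deriv s).congr fun z hz => (hc.hasDerivAt_enthalpy s hz).deriv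

theorem strictMonoOn_enthalpy : StrictMonoOn (enthalpy (c.P s)) (Ioi 0) := by
  refine strictMonoOn_of_deriv_pos (convex_Ioi 0) (hc.contDiffOn_enthalpy s).continuousOn ?_
  intro z hz
  rw [interior_Ioi] at hz
  rw [(hc.hasDerivAt_enthalpy s hz).deriv]
  exact div_pos (hc.deriv_P_pos s hz) hz

theorem rhoAt_pos : 0 < c.rhoAt s := by
  cases s
  · exact hc.rhoMinus_pos
  · exact Function.invFunOn_mem hc.rhoMinus_mem

/-- The only place where the unstable configuration enters: P₊(ρ₀⁺) = P₋(ρ₀⁻) > P₊(ρ₀⁻), and P₊ is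
increasing. -/
theorem rhoAt_lt : c.rhoAt .lower < c.rhoAt .upper := by
  have h : c.P .upper (c.rhoAt .upper) = c.P .lower c.rhoMinus :=
    Function.invFunOn_eq hc.rhoMinus_mem
  have h2 := hc.rhoMinus_gt
  rw [← h] at h2
  exact ((hc.P_strictMono .upper).lt_iff_lt hc.rhoMinus_pos (hc.rhoAt_pos .upper)).1 h2

theorem contDiffAt_inv_enthalpy {y : ℝ} (hy : y ∈ enthalpy (c.P s) '' Ioi 0) :
    (∀ᶠ w in nhds y, w ∈ enthalpy (c.P s) '' Ioi 0) ∧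
      ContDiffAt ℝ ∞ (Function.invFunOn (enthalpy (c.P s)) (Ioi 0)) y := by
  obtain ⟨a, ha, rfl⟩ := hy
  exact contDiffAt_invFunOn isOpen_Ioi (hc.strictMonoOn_enthalpy s).injOn ha
    ((hc.contDiffOn_enthalpy s).contDiffAt (Ioi_mem_nhds ha)) (hc.hasDerivAt_enthalpy s ha)
    (div_pos (hc.deriv_P_pos s ha) ha).ne'

theorem isOpen_dom : IsOpen (c.dom s) := by
  have : IsOpen (enthalpy (c.P s) '' Ioi 0) :=
    isOpen_iff_mem_nhds.2 fun y hy => (hc.contDiffAt_inv_enthalpy s hy).1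
  exact this.preimage (by fun_prop)

/-- The range of the enthalpy is an interval. It contains the value at the interface and, by
assumption, the value at the wall, hence everything between them. -/
theorem Icc_subset_dom : Icc (c.lo s) (c.hi s) ⊆ c.dom s := by
  have hconn : OrdConnected (enthalpy (c.P s) '' Ioi 0) :=
    (isPreconnected_Ioi.image _ (hc.contDiffOn_enthalpy s).continuousOn).ordConnected
  have h0 : enthalpy (c.P s) (c.rhoAt s) ∈ enthalpy (c.P s) '' Ioi 0 :=
    ⟨_, hc.rhoAt_pos s, rfl⟩
  have hg := hc.g_pos
  intro z hz
  cases s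
  · refine hconn.out h0 hc.bottom_mem ⟨?_, ?_⟩
    · have : z ≤ 0 := hz.2
      nlinarith
    · have : -c.m ≤ z := hz.1
      nlinarith
  · refine hconn.out hc.top_mem h0 ⟨?_, ?_⟩
    · have : z ≤ c.ℓ := hz.2
      nlinarith
    · have : 0 ≤ z := hz.1
      nlinarith

theorem rho0_pos {z : ℝ} (hz : z ∈ c.dom s) : 0 < c.rho0 s z := Function.invFunOn_mem hz

theorem enthalpy_rho0 {z : ℝ} (hz : z ∈ c.dom s) :
    enthalpy (c.P s) (c.rho0 s z) = enthalpy (c.P s) (c.rhoAt s) - c.g * z :=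
  Function.invFunOn_eq hz

theorem rho0_zero : c.rho0 s 0 = c.rhoAt s := by
  have h0 : enthalpy (c.P s) (c.rhoAt s) - c.g * 0 ∈ enthalpy (c.P s) '' Ioi 0 :=
    ⟨_, hc.rhoAt_pos s, by simp⟩
  refine (hc.strictMonoOn_enthalpy s).injOn (hc.rho0_pos s h0) (hc.rhoAt_pos s) ?_
  rw [hc.enthalpy_rho0 s h0, mul_zero, sub_zero]

theorem contDiffOn_rho0 : ContDiffOn ℝ ∞ (c.rho0 s) (c.dom s) := by
  intro z hz
  refine ContDiffAt.contDiffWithinAt ?_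
  exact ContDiffAt.comp z (hc.contDiffAt_inv_enthalpy s hz).2
    (contDiffAt_const.sub (contDiffAt_const.mul contDiffAt_id))

theorem dP_pos {z : ℝ} (hz : z ∈ c.dom s) : 0 < c.dP s z := hc.deriv_P_pos s (hc.rho0_pos s hz)

theorem contDiffOn_dP : ContDiffOn ℝ ∞ (c.dP s) (c.dom s) :=
  (hc.contDiffOn_deriv_P s).comp (hc.contDiffOn_rho0 s) fun _ hz => hc.rho0_pos s hz

/-- Differentiate h(ρ₀(z)) = h(ρ₀^±) - gz with h'(r) = P'(r)/r: this is hydrostatic balance. -/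
theorem hasDerivAt_rho0 {z : ℝ} (hz : z ∈ c.dom s) :
    HasDerivAt (c.rho0 s) (-(c.g * c.rho0 s z / c.dP s z)) z := by
  have h1 : HasDerivAt (c.rho0 s) (deriv (c.rho0 s) z) z :=
    (((hc.contDiffOn_rho0 s).contDiffAt ((hc.isOpen_dom s).mem_nhds hz)).differentiableAt
      (by simp)).hasDerivAt
  have hpos := hc.rho0_pos s hz
  have h2 := (hc.hasDerivAt_enthalpy s hpos).comp z h1
  have h3 : HasDerivAt (fun w => enthalpy (c.P s) (c.rhoAt s) - c.g * w) (-(c.g * 1)) z :=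
    ((hasDerivAt_id z).const_mul c.g).const_sub _
  have h4 : (enthalpy (c.P s) ∘ c.rho0 s) =ᶠ[nhds z]
      fun w => enthalpy (c.P s) (c.rhoAt s) - c.g * w := by
    filter_upwards [(hc.isOpen_dom s).mem_nhds hz] with w hw
    exact hc.enthalpy_rho0 s hw
  have h5 := h2.unique (h3.congr_of_eventuallyEq h4)
  refine h1.congr_deriv ?_
  have hp := hc.dP_pos s hz
  rw [dP] at hp ⊢
  field_simp at h5 ⊢
  linarith

end Admissible

end Config

/-! ### Vertical modes of one layer -/

/-- Vertical modes `(u, H)` of a layer with density `R` and inverse sound speed `A`, vanishing at the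
wall `w`; `o` is the interface and `σ` the direction from the wall to the interface. The parameters
are `K = |ξ|² / λ²` and `L = λ²`. -/
structure IsMode (lo hi : ℝ) (R A : ℝ → ℝ) (σ w o : ℝ) (u H : ℝ × ℝ → ℝ → ℝ) : Prop where
  continuous_u : Continuous fun p : (ℝ × ℝ) × ℝ => u p.1 p.2
  continuous_H : Continuous fun p : (ℝ × ℝ) × ℝ => H p.1 p.2
  hasDerivAt_u : ∀ P, ∀ z ∈ Ioo lo hi, HasDerivAt (u P) ((A z + P.1) * R z * H P z) z
  hasDerivAt_H : ∀ P, ∀ z ∈ Ioo lo hi, HasDerivAt (H P) (P.2 / R z * u P z) z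
  wall : ∀ P, u P w = 0
  one_le_H : ∀ P : ℝ × ℝ, 0 ≤ P.1 → 0 ≤ P.2 → ∀ z ∈ Icc lo hi, 1 ≤ σ * H P z
  interface_u_pos : ∀ P : ℝ × ℝ, 0 < P.1 → 0 ≤ P.2 → 0 < u P o
  slow : ∀ M : ℝ, 0 < M → ∃ e₀ : ℝ, 0 < e₀ ∧ ∀ e : ℝ, 0 < e → e ≤ e₀ → ∃ k₀ : ℝ, 0 < k₀ ∧
    ∀ k, k₀ ≤ k → M * (σ * H (k / e, k * e) o) ≤ 2 * u (k / e, k * e) o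
  fast : ∀ e : ℝ, 0 < e → ∃ B₀ : ℝ, 1 ≤ B₀ ∧ ∀ B, B₀ ≤ B → ∀ k, 1 ≤ k →
    u (k / B, k * B) o ≤ e * (σ * H (k / B, k * B) o)

/-- In the distance τ = σ(z - w) from the wall, (u, σH) solves the system of `exists_linear_flow`
with coefficients that are nonnegative when K, L ≥ 0. The two barriers give `slow`, where K/L = 1/e²
is large, and `fast`, where K/L = 1/B² is small. -/
theorem exists_isMode {lo hi : ℝ} (hlt : lo < hi) {R A : ℝ → ℝ} (hR : ContinuousOn R (Icc lo hi))
    (hA : ContinuousOn A (Icc lo hi)) (hRpos : ∀ z ∈ Icc lo hi, 0 < R z)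
    (hApos : ∀ z ∈ Icc lo hi, 0 < A z) {σ w o : ℝ}
    (hσ : (σ = 1 ∧ w = lo ∧ o = hi) ∨ (σ = -1 ∧ w = hi ∧ o = lo)) :
    ∃ u H : ℝ × ℝ → ℝ → ℝ, IsMode lo hi R A σ w o u H := by
  -- Clamping extends the coefficients continuously to the whole line, as the global flow requires,
  -- without changing them on the layer.
  set π : ℝ → ℝ := fun z => max lo (min z hi)
  have hπ : ∀ z, π z ∈ Icc lo hi := fun z =>
    ⟨le_max_left _ _, max_le hlt.le (min_le_right _ _)⟩
  have hπc : Continuous π := by fun_prop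
  have hπe : ∀ z ∈ Icc lo hi, π z = z := by
    intro z hz
    simp only [π]
    rw [min_eq_left hz.2, max_eq_right hz.1]
  have hRc : Continuous fun z => R (π z) := hR.comp_continuous hπc hπ
  have hAc : Continuous fun z => A (π z) := hA.comp_continuous hπc hπ
  have hσσ : σ * σ = 1 := by rcases hσ with h | h <;> rw [h.1] <;> norm_num
  have hd : 0 < hi - lo := by linarith
  have ho : σ * (o - w) = hi - lo := by
    rcases hσ with ⟨h1, h2, h3⟩ | ⟨h1, h2, h3⟩ <;> rw [h1, h2, h3] <;> ring
  have hz : ∀ z, w + σ * (σ * (z - w)) = z := by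
    intro z
    rw [← mul_assoc, hσσ]; ring
  obtain ⟨U, V, hUc, hVc, h0, hder, hpos⟩ := exists_linear_flow
    (α := fun (P : ℝ × ℝ) τ => (A (π (w + σ * τ)) + P.1) * R (π (w + σ * τ)))
    (β := fun (P : ℝ × ℝ) τ => P.2 / R (π (w + σ * τ)))
    (by
      have h1 := hAc.comp (f := fun p : (ℝ × ℝ) × ℝ => w + σ * p.2) (by fun_prop)
      have h2 := hRc.comp (f := fun p : (ℝ × ℝ) × ℝ => w + σ * p.2) (by fun_prop)
      exact (h1.add (by fun_prop)).mul h2)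
    (by
      have h2 := hRc.comp (f := fun p : (ℝ × ℝ) × ℝ => w + σ * p.2) (by fun_prop)
      exact Continuous.div (by fun_prop) h2 fun p => (hRpos _ (hπ _)).ne')
  have hpos' : ∀ P : ℝ × ℝ, 0 ≤ P.1 → 0 ≤ P.2 → ∀ τ, 0 ≤ τ → 0 ≤ U P τ ∧ 1 ≤ V P τ := by
    intro P h1 h2
    refine hpos P fun τ _ => ⟨?_, div_nonneg h2 (hRpos _ (hπ _)).le⟩
    exact mul_nonneg (add_nonneg (hApos _ (hπ _)).le h1) (hRpos _ (hπ _)).le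
  have hlin : ∀ z, HasDerivAt (fun z => σ * (z - w)) σ z := fun z => by
    simpa using ((hasDerivAt_id z).sub_const w).const_mul σ
  obtain ⟨z₁, hz₁, hr₁⟩ := isCompact_Icc.exists_isMinOn (nonempty_Icc.2 hlt.le) hR
  obtain ⟨z₂, hz₂, hr₂⟩ := isCompact_Icc.exists_isMaxOn (nonempty_Icc.2 hlt.le) hR
  obtain ⟨z₃, hz₃, hr₃⟩ := isCompact_Icc.exists_isMaxOn (nonempty_Icc.2 hlt.le) hA
  have hr1 : ∀ z, R z₁ ≤ R (π z) := fun z => hr₁ (hπ z)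
  have hr2 : ∀ z, R (π z) ≤ R z₂ := fun z => hr₂ (hπ z)
  have ha2 : ∀ z, A (π z) ≤ A z₃ := fun z => hr₃ (hπ z)
  have p1 := hRpos _ hz₁
  have p2 := hRpos _ hz₂
  have p3 := hApos _ hz₃
  have hVo : ∀ P, σ * (σ * V P (σ * (o - w))) = V P (hi - lo) := fun P => by
    rw [← mul_assoc, hσσ, one_mul, ho]
  refine ⟨fun P z => U P (σ * (z - w)), fun P z => σ * V P (σ * (z - w)), ?_, ?_, ?_, ?_, ?_, ?_,
    ?_, ?_, ?_⟩
  · exact hUc.comp (f := fun p : (ℝ × ℝ) × ℝ => (p.1, σ * (p.2 - w))) (by fun_prop)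
  · exact continuous_const.mul
      (hVc.comp (f := fun p : (ℝ × ℝ) × ℝ => (p.1, σ * (p.2 - w))) (by fun_prop))
  · intro P z hzI
    have h1 := (hder P (σ * (z - w))).1.comp z (hlin z)
    rw [hz, hπe z (Ioo_subset_Icc_self hzI)] at h1
    refine h1.congr_deriv ?_
    ring
  · intro P z hzI
    have h1 := ((hder P (σ * (z - w))).2.comp z (hlin z)).const_mul σ
    rw [hz, hπe z (Ioo_subset_Icc_self hzI)] at h1
    refine h1.congr_deriv ?_
    linear_combination (P.2 / R z * U P (σ * (z - w))) * hσσ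
  · intro P
    simp [(h0 P).1]
  · intro P h1 h2 z hzI
    rw [← mul_assoc, hσσ, one_mul]
    refine (hpos' P h1 h2 _ ?_).2
    rcases hσ with ⟨q1, q2, -⟩ | ⟨q1, q2, -⟩ <;> rw [q1, q2] <;> linarith [hzI.1, hzI.2]
  · intro P h1 h2
    rw [ho, ← (h0 P).1]
    refine strictMonoOn_of_deriv_pos (convex_Icc 0 (hi - lo))
      (fun τ _ => (hder P τ).1.continuousAt.continuousWithinAt) (fun τ hτ => ?_)
      ⟨le_rfl, hd.le⟩ ⟨hd.le, le_rfl⟩ hd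
    rw [interior_Icc] at hτ
    rw [(hder P τ).1.deriv]
    have q1 := (hpos' P h1.le h2 τ hτ.1.le).2
    exact mul_pos (mul_pos (add_pos (hApos _ (hπ _)) h1) (hRpos _ (hπ _))) (by linarith)
  · intro M hM
    -- With R z₁ the minimal density, e ≤ R z₁ / M gives M²β ≤ α, and the bound on `k` gives M ≤
    -- α·(hi - lo): the two hypotheses of `flow_upper_barrier`.
    refine ⟨R z₁ / M, by positivity, fun e he hee => ⟨M * e / (R z₁ * (hi - lo)), by positivity,
      fun k hk => ?_⟩⟩
    have hk0 : 0 < k := lt_of_lt_of_le (by positivity) hk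
    simp only [hVo]
    rw [ho]
    rw [le_div_iff₀ hM] at hee
    rw [div_le_iff₀ (by positivity)] at hk
    refine flow_upper_barrier hd.le (fun τ => (hder _ τ).1) (fun τ => (hder _ τ).2) (h0 _)
      (hpos' _ (by positivity) (by positivity)) hM ?_ ?_
    · intro τ _
      have q1 := hr1 (w + σ * τ)
      have q3 := hApos _ (hπ (w + σ * τ))
      have q2 : 0 < R (π (w + σ * τ)) := hRpos _ (hπ _)
      simp only
      rw [mul_div_assoc', div_le_iff₀ q2]
      have h1 : (k / e) * (e * M) ^ 2 ≤ (k / e) * (R (π (w + σ * τ))) ^ 2 := by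
        gcongr
        exact hee.trans q1
      have h2 : M ^ 2 * (k * e) = (k / e) * (e * M) ^ 2 := by field_simp
      rw [h2]
      refine h1.trans ?_
      have h3 : 0 ≤ A (π (w + σ * τ)) * R (π (w + σ * τ)) ^ 2 := by positivity
      nlinarith
    · intro τ _
      have q1 := hr1 (w + σ * τ)
      have q3 := hApos _ (hπ (w + σ * τ))
      have h1 : M ≤ k / e * R z₁ * (hi - lo) := by
        rw [div_mul_eq_mul_div, div_mul_eq_mul_div, le_div_iff₀ he]
        linarith
      refine h1.trans ?_
      simp only
      gcongr
      linarith
  · intro e he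
    -- For B ≥ 1 and k ≥ 1 one has A + k/B ≤ (A z₃ + 1)k, so α ≤ e²β follows once B e² exceeds (A z₃
    -- + 1) times the square of the maximal density.
    refine ⟨max 1 ((A z₃ + 1) * R z₂ ^ 2 / e ^ 2), le_max_left _ _, fun B hB k hk => ?_⟩
    have hB1 : 1 ≤ B := (le_max_left _ _).trans hB
    have hB2 : (A z₃ + 1) * R z₂ ^ 2 / e ^ 2 ≤ B := (le_max_right _ _).trans hB
    rw [div_le_iff₀ (by positivity)] at hB2
    simp only [hVo]
    rw [ho]
    refine flow_lower_barrier hd.le (fun τ => (hder _ τ).1) (fun τ => (hder _ τ).2) (h0 _)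
      (hpos' _ (by positivity) (by positivity)) he ?_
    intro τ _
    have q2 : 0 < R (π (w + σ * τ)) := hRpos _ (hπ _)
    have q1 := hr2 (w + σ * τ)
    have q3 := ha2 (w + σ * τ)
    have q4 := hApos _ (hπ (w + σ * τ))
    simp only
    rw [mul_div_assoc', le_div_iff₀ q2]
    have h1 : A (π (w + σ * τ)) + k / B ≤ (A z₃ + 1) * k := by
      have : k / B ≤ k := div_le_self (by linarith) hB1
      nlinarith
    calc (A (π (w + σ * τ)) + k / B) * R (π (w + σ * τ)) * R (π (w + σ * τ))
        ≤ ((A z₃ + 1) * k) * R z₂ * R z₂ := by gcongr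
      _ = k * ((A z₃ + 1) * R z₂ ^ 2) := by ring
      _ ≤ k * (B * e ^ 2) := by gcongr
      _ = e ^ 2 * (k * B) := by ring

/-! ### Symbols generated by a mode -/

/-- Functions of the parameters and the height generated by a mode over smooth functions of the
height, closed under multiplication by the parameters. -/
inductive ModeSpan (J : Set ℝ) (u H : ℝ × ℝ → ℝ → ℝ) : (ℝ × ℝ → ℝ → ℝ) → Prop
  | u {a : ℝ → ℝ} (ha : ContDiffOn ℝ ∞ a J) : ModeSpan J u H fun P z => a z * u P z
  | H {a : ℝ → ℝ} (ha : ContDiffOn ℝ ∞ a J) : ModeSpan J u H fun P z => a z * H P z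
  | add {f g} (hf : ModeSpan J u H f) (hg : ModeSpan J u H g) :
      ModeSpan J u H fun P z => f P z + g P z
  | mul_K {f} (hf : ModeSpan J u H f) : ModeSpan J u H fun P z => P.1 * f P z
  | mul_L {f} (hf : ModeSpan J u H f) : ModeSpan J u H fun P z => P.2 * f P z

namespace ModeSpan

variable {lo hi : ℝ} {R A : ℝ → ℝ} {σ w o : ℝ} {u H : ℝ × ℝ → ℝ → ℝ} {J : Set ℝ}

theorem continuousOn (h : IsMode lo hi R A σ w o u H) (hJ : Icc lo hi ⊆ J)
    {f : ℝ × ℝ → ℝ → ℝ} (hf : ModeSpan J u H f) :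
    ContinuousOn (fun p : (ℝ × ℝ) × ℝ => f p.1 p.2) (univ ×ˢ Icc lo hi) := by
  have key : ∀ {a : ℝ → ℝ}, ContDiffOn ℝ ∞ a J →
      ContinuousOn (fun p : (ℝ × ℝ) × ℝ => a p.2) (univ ×ˢ Icc lo hi) := fun ha =>
    (ha.continuousOn.mono hJ).comp continuousOn_snd fun p hp => hp.2
  induction hf with
  | u ha => exact (key ha).mul h.continuous_u.continuousOn
  | H ha => exact (key ha).mul h.continuous_H.continuousOn
  | add _ _ hf hg => exact hf.add hg
  | mul_K _ hf => exact ContinuousOn.mul (by fun_prop) hf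
  | mul_L _ hf => exact ContinuousOn.mul (by fun_prop) hf

/-- The span of a mode is closed under vertical derivatives. -/
theorem exists_hasDerivAt (h : IsMode lo hi R A σ w o u H) (hJo : IsOpen J) (hJ : Icc lo hi ⊆ J)
    (hR : ContDiffOn ℝ ∞ R J) (hR0 : ∀ z ∈ J, R z ≠ 0) (hA : ContDiffOn ℝ ∞ A J)
    {f : ℝ × ℝ → ℝ → ℝ} (hf : ModeSpan J u H f) :
    ∃ f', ModeSpan J u H f' ∧ ∀ P, ∀ z ∈ Ioo lo hi, HasDerivAt (f P) (f' P z) z := by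
  have key : ∀ {a : ℝ → ℝ}, ContDiffOn ℝ ∞ a J → ∀ z ∈ Ioo lo hi, HasDerivAt a (deriv a z) z :=
    fun ha z hz => ((ha.contDiffAt (hJo.mem_nhds (hJ (Ioo_subset_Icc_self hz)))).differentiableAt
      (by simp)).hasDerivAt
  have hder : ∀ {a : ℝ → ℝ}, ContDiffOn ℝ ∞ a J → ContDiffOn ℝ ∞ (deriv a) J :=
    fun ha => ((contDiffOn_infty_iff_deriv_of_isOpen hJo).1 ha).2
  induction hf with
  | @u a ha =>
    refine ⟨_, ((ModeSpan.u (hder ha)).add (ModeSpan.H ((ha.mul hA).mul hR))).add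
      (ModeSpan.H (ha.mul hR)).mul_K, fun P z hz => ?_⟩
    refine ((key ha z hz).mul (h.hasDerivAt_u P z hz)).congr_deriv ?_
    ring
  | @H a ha =>
    refine ⟨_, (ModeSpan.H (hder ha)).add (ModeSpan.u (ha.div hR hR0)).mul_L, fun P z hz => ?_⟩
    refine ((key ha z hz).mul (h.hasDerivAt_H P z hz)).congr_deriv ?_
    simp only [Pi.div_apply]
    ring
  | add _ _ hf hg =>
    obtain ⟨f', hf', hfd⟩ := hf
    obtain ⟨g', hg', hgd⟩ := hg
    exact ⟨_, hf'.add hg', fun P z hz => (hfd P z hz).add (hgd P z hz)⟩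
  | mul_K _ hf =>
    obtain ⟨f', hf', hfd⟩ := hf
    exact ⟨_, hf'.mul_K, fun P z hz => (hfd P z hz).const_mul P.1⟩
  | mul_L _ hf =>
    obtain ⟨f', hf', hfd⟩ := hf
    exact ⟨_, hf'.mul_L, fun P z hz => (hfd P z hz).const_mul P.2⟩

/-- Elements of the span of a mode are bounded by the mode, polynomially in the parameters. -/
theorem exists_bound (hJ : Icc lo hi ⊆ J) {f : ℝ × ℝ → ℝ → ℝ} (hf : ModeSpan J u H f) :
    ∃ (C : ℝ) (N : ℕ), 0 ≤ C ∧ ∀ (P : ℝ × ℝ) (k : ℝ), 1 ≤ k → |P.1| ≤ k → |P.2| ≤ k →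
      ∀ z ∈ Icc lo hi, |f P z| ≤ C * k ^ N * (|u P z| + |H P z|) := by
  have key : ∀ {a : ℝ → ℝ}, ContDiffOn ℝ ∞ a J → ∃ C, 0 ≤ C ∧ ∀ z ∈ Icc lo hi, |a z| ≤ C := by
    intro a ha
    obtain ⟨C, hC⟩ := isCompact_Icc.exists_bound_of_continuousOn (ha.continuousOn.mono hJ)
    exact ⟨max C 0, le_max_right _ _, fun z hz => (hC z hz).trans (le_max_left _ _)⟩
  induction hf with
  | u ha =>
    obtain ⟨C, hC, hb⟩ := key ha
    refine ⟨C, 0, hC, fun P k _ _ _ z hz => ?_⟩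
    rw [abs_mul, pow_zero, mul_one]
    exact mul_le_mul (hb z hz) (le_add_of_nonneg_right (abs_nonneg _)) (abs_nonneg _) hC
  | H ha =>
    obtain ⟨C, hC, hb⟩ := key ha
    refine ⟨C, 0, hC, fun P k _ _ _ z hz => ?_⟩
    rw [abs_mul, pow_zero, mul_one]
    exact mul_le_mul (hb z hz) (le_add_of_nonneg_left (abs_nonneg _)) (abs_nonneg _) hC
  | @add f g _ _ hf hg =>
    obtain ⟨C, N, hC, hb⟩ := hf
    obtain ⟨D, M, hD, hb'⟩ := hg
    refine ⟨C + D, max N M, add_nonneg hC hD, fun P k hk h1 h2 z hz => ?_⟩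
    calc |f P z + g P z| ≤ C * k ^ N * (|u P z| + |H P z|) + D * k ^ M * (|u P z| + |H P z|) :=
          (abs_add_le _ _).trans (add_le_add (hb P k hk h1 h2 z hz) (hb' P k hk h1 h2 z hz))
      _ ≤ C * k ^ max N M * (|u P z| + |H P z|) + D * k ^ max N M * (|u P z| + |H P z|) := by
          gcongr <;> simp
      _ = _ := by ring
  | @mul_K f _ hf =>
    obtain ⟨C, N, hC, hb⟩ := hf
    refine ⟨C, N + 1, hC, fun P k hk h1 h2 z hz => ?_⟩
    rw [abs_mul]
    calc |P.1| * |f P z| ≤ k * (C * k ^ N * (|u P z| + |H P z|)) :=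
          mul_le_mul h1 (hb P k hk h1 h2 z hz) (abs_nonneg _) (by linarith)
      _ = _ := by ring
  | @mul_L f _ hf =>
    obtain ⟨C, N, hC, hb⟩ := hf
    refine ⟨C, N + 1, hC, fun P k hk h1 h2 z hz => ?_⟩
    rw [abs_mul]
    calc |P.2| * |f P z| ≤ k * (C * k ^ N * (|u P z| + |H P z|)) :=
          mul_le_mul h2 (hb P k hk h1 h2 z hz) (abs_nonneg _) (by linarith)
      _ = _ := by ring

end ModeSpan

/-! ### The dispersion relation and the growing modes -/

/-- A root of a continuous function that changes sign on `[a, b]`, chosen measurably in the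
parameter. -/
theorem exists_measurable_root {D : ℝ → ℝ → ℝ} (hD : Continuous fun p : ℝ × ℝ => D p.1 p.2)
    {a b : ℝ} (hab : a ≤ b) (s : Set ℝ) (hs : ∀ k ∈ s, D k a < 0 ∧ 0 < D k b) :
    ∃ μ : ℝ → ℝ, Measurable μ ∧ (∀ k, μ k ∈ Icc a b) ∧ ∀ k ∈ s, D k (μ k) = 0 := by
  classical
  have hDk : ∀ x, Continuous fun k => D k x := fun x =>
    hD.comp (f := fun k : ℝ => (k, x)) (by fun_prop)
  have hDx : ∀ k, Continuous fun x => D k x := fun k =>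
    hD.comp (f := fun x : ℝ => (k, x)) (by fun_prop)
  -- The root is the infimum of the rationals in [a, b] where `D k` is positive. A countable infimum
  -- keeps it measurable; the default value `b` does not affect it.
  set F : ℚ → ℝ → ℝ := fun q k => if a ≤ q ∧ q ≤ b ∧ 0 < D k q then (q : ℝ) else b with hF
  have hFm : ∀ q, Measurable (F q) := by
    intro q
    refine Measurable.ite ?_ measurable_const measurable_const
    have : MeasurableSet {k | 0 < D k q} := measurableSet_lt measurable_const (hDk q).measurable
    exact (MeasurableSet.const _).inter ((MeasurableSet.const _).inter this)
  have hFmem : ∀ q k, F q k ∈ Icc a b := by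
    intro q k
    simp only [hF]
    split_ifs with h
    · exact ⟨h.1, h.2.1⟩
    · exact ⟨hab, le_rfl⟩
  have hbdd : ∀ k, BddBelow (range fun q => F q k) := fun k =>
    ⟨a, by rintro _ ⟨q, rfl⟩; exact (hFmem q k).1⟩
  refine ⟨fun k => ⨅ q, F q k, Measurable.iInf hFm, fun k => ⟨le_ciInf fun q => (hFmem q k).1,
    (ciInf_le (hbdd k) 0).trans (hFmem 0 k).2⟩, fun k hk => ?_⟩
  change D k (⨅ q, F q k) = 0
  set m := ⨅ q, F q k
  obtain ⟨h1, h2⟩ := hs k hk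
  have hma : a ≤ m := le_ciInf fun q => (hFmem q k).1
  have hmb : m ≤ b := (ciInf_le (hbdd k) 0).trans (hFmem 0 k).2
  refine le_antisymm ?_ ?_
  -- If `D k` were positive at the infimum, it would be positive at rationals slightly to the left.
  · by_contra hc
    push Not at hc
    have ha : a < m := by
      rcases hma.eq_or_lt with h | h
      · rw [← h] at hc; linarith
      · exact h
    have hev : ∀ᶠ x in nhdsWithin m (Iio m), 0 < D k x :=
      ((hDx k).continuousAt.eventually (lt_mem_nhds hc)).filter_mono nhdsWithin_le_nhds
    obtain ⟨l, hl, hl'⟩ := (mem_nhdsLT_iff_exists_Ioo_subset' ha).1 hev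
    obtain ⟨q, hq1, hq2⟩ := exists_rat_btwn (max_lt hl ha)
    have hq3 : 0 < D k q := hl' ⟨(le_max_left _ _).trans_lt hq1, hq2⟩
    have : m ≤ F q k := ciInf_le (hbdd k) q
    simp only [hF] at this
    rw [if_pos ⟨((le_max_right _ _).trans_lt hq1).le, (hq2.trans_le hmb).le, hq3⟩] at this
    linarith
  -- If `D k` were negative at the infimum, no rational slightly to the right would be admissible,
  -- so the infimum would be larger.
  · by_contra hc
    push Not at hc
    have hb : m < b := by
      rcases hmb.eq_or_lt with h | h
      · rw [h] at hc; linarith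
      · exact h
    have hev : ∀ᶠ x in nhdsWithin m (Ioi m), D k x < 0 :=
      ((hDx k).continuousAt.eventually (gt_mem_nhds hc)).filter_mono nhdsWithin_le_nhds
    obtain ⟨l, hl, hl'⟩ := (mem_nhdsGT_iff_exists_Ioo_subset' hb).1 hev
    have : min l b ≤ m := by
      refine le_ciInf fun q => ?_
      have hmq : m ≤ F q k := ciInf_le (hbdd k) q
      simp only [hF] at hmq ⊢
      split_ifs with h
      · rw [if_pos h] at hmq
        by_contra hlt
        push Not at hlt
        have hql : (q : ℝ) < l := hlt.trans_le (min_le_left _ _)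
        rcases hmq.eq_or_lt with h' | h'
        · rw [h'] at hc; linarith [h.2.2]
        · have : D k q < 0 := hl' ⟨h', hql⟩
          linarith [h.2.2]
      · exact min_le_right _ _
    exact absurd (lt_min hl hb) (not_lt.2 this)

namespace Config

/-- The direction from the wall to the interface. -/
def sgn : Phase → ℝ
  | .lower => 1
  | .upper => -1

/-- The height of the rigid wall. -/
def wall (c : Config) : Phase → ℝ
  | .lower => -c.m
  | .upper => c.ℓ

end Config

/-- The mode parameters `(|ξ|² / λ², λ²)` for `|ξ| = k`, `λ² = μ k`. -/
def modePar (k μ : ℝ) : ℝ × ℝ := (k / μ, k * μ)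

/-- Growing normal modes for all large horizontal frequencies `k`, with growth rate
`λ = √(μ(k) k)`. -/
structure GrowingModes (c : Config) where
  u : Phase → ℝ × ℝ → ℝ → ℝ
  H : Phase → ℝ × ℝ → ℝ → ℝ
  isMode : ∀ s, IsMode (c.lo s) (c.hi s) (c.rho0 s) (fun z => (c.dP s z)⁻¹) (Config.sgn s)
    (c.wall s) 0 (u s) (H s)
  μ : ℝ → ℝ
  measurable_μ : Measurable μ
  a : ℝ
  b : ℝ
  a_pos : 0 < a
  μ_mem : ∀ k, μ k ∈ Icc a b
  k₀ : ℝ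
  one_le : 1 ≤ k₀
  dispersion : ∀ k, k₀ ≤ k →
    c.rho0 .lower 0 ^ 2 * H .lower (modePar k (μ k)) 0 * u .upper (modePar k (μ k)) 0 -
      c.rho0 .upper 0 ^ 2 * H .upper (modePar k (μ k)) 0 * u .lower (modePar k (μ k)) 0 =
    c.g * (c.rho0 .upper 0 - c.rho0 .lower 0) *
      (u .lower (modePar k (μ k)) 0 * u .upper (modePar k (μ k)) 0)

/-- Multiplied by u₋u₊, the interface equation has no denominators and is continuous in the mode
parameters. The estimates `slow` and `fast` fix its sign at μ = a and at μ = b for all k ≥ k₀, so it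
has a root between. -/
theorem Config.Admissible.nonempty_growingModes {c : Config} (hc : c.Admissible) :
    Nonempty (GrowingModes c) := by
  have hex : ∀ s, ∃ u H : ℝ × ℝ → ℝ → ℝ, IsMode (c.lo s) (c.hi s) (c.rho0 s)
      (fun z => (c.dP s z)⁻¹) (Config.sgn s) (c.wall s) 0 u H := by
    intro s
    have hJ := hc.Icc_subset_dom s
    refine exists_isMode (hc.lo_lt_hi s) ((hc.contDiffOn_rho0 s).continuousOn.mono hJ)
      (((hc.contDiffOn_dP s).continuousOn.mono hJ).inv₀ fun z hz => (hc.dP_pos s (hJ hz)).ne')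
      (fun z hz => hc.rho0_pos s (hJ hz)) (fun z hz => inv_pos.2 (hc.dP_pos s (hJ hz))) ?_
    cases s
    · exact Or.inl ⟨rfl, rfl, rfl⟩
    · exact Or.inr ⟨rfl, rfl, rfl⟩
  choose u H hm using hex
  have hg := hc.g_pos
  have h0 : ∀ s, (0 : ℝ) ∈ c.dom s := by
    intro s
    apply hc.Icc_subset_dom s
    cases s
    · exact ⟨neg_nonpos.2 hc.m_pos.le, le_rfl⟩
    · exact ⟨le_rfl, hc.ℓ_pos.le⟩
  set r₁ := c.rho0 .lower 0
  set r₂ := c.rho0 .upper 0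
  have hr₁ : 0 < r₁ := hc.rho0_pos _ (h0 _)
  have hr₂ : 0 < r₂ := hc.rho0_pos _ (h0 _)
  have hr : r₁ < r₂ := by
    simp only [r₁, r₂, hc.rho0_zero]
    exact hc.rhoAt_lt
  set Q := r₁ ^ 2 + r₂ ^ 2
  have hQ : 0 < Q := by positivity
  set G := c.g * (r₂ - r₁)
  have hG : 0 < G := mul_pos hg (by linarith)
  set D' : ℝ × ℝ → ℝ := fun P => r₁ ^ 2 * H .lower P 0 * u .upper P 0 -
      r₂ ^ 2 * H .upper P 0 * u .lower P 0 - G * (u .lower P 0 * u .upper P 0) with hD'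
  have hu0 : ∀ s, Continuous fun P => u s P 0 := fun s =>
    (hm s).continuous_u.comp (f := fun P : ℝ × ℝ => (P, (0 : ℝ))) (by fun_prop)
  have hH0 : ∀ s, Continuous fun P => H s P 0 := fun s =>
    (hm s).continuous_H.comp (f := fun P : ℝ × ℝ => (P, (0 : ℝ))) (by fun_prop)
  have hD'c : Continuous D' := by
    have h1 := hu0 .lower
    have h2 := hu0 .upper
    have h3 := hH0 .lower
    have h4 := hH0 .upper
    fun_prop
  -- With these constants σH ≤ (G/2Q)u at μ = a and σH ≥ (2G/Q)u at μ = b in both layers. Weighted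
  -- by r₁² and r₂², whose sum is Q, they give G/2 and 2G, on either side of the target G.
  obtain ⟨e₁, he₁, hs₁⟩ := (hm .lower).slow (4 * Q / G) (by positivity)
  obtain ⟨e₂, he₂, hs₂⟩ := (hm .upper).slow (4 * Q / G) (by positivity)
  obtain ⟨B₁, hB₁, hf₁⟩ := (hm .lower).fast (Q / (2 * G)) (by positivity)
  obtain ⟨B₂, hB₂, hf₂⟩ := (hm .upper).fast (Q / (2 * G)) (by positivity)
  set a := min 1 (min e₁ e₂)
  have ha : 0 < a := by positivity
  obtain ⟨k₁, -, hk₁⟩ := hs₁ a ha ((min_le_right _ _).trans (min_le_left _ _))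
  obtain ⟨k₂, -, hk₂⟩ := hs₂ a ha ((min_le_right _ _).trans (min_le_right _ _))
  set b := max B₁ B₂
  have hb : 1 ≤ b := hB₁.trans (le_max_left _ _)
  have hab : a ≤ b := (min_le_left _ _).trans hb
  set k₀ := max 1 (max k₁ k₂)
  have hpos : ∀ k μ, k₀ ≤ k → 0 < μ → ∀ s, 0 < u s (k / μ, k * μ) 0 := by
    intro k μ hk hμ s
    have : 0 < k := lt_of_lt_of_le (lt_of_lt_of_le one_pos (le_max_left _ _)) hk
    exact (hm s).interface_u_pos _ (by positivity) (by positivity)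
  obtain ⟨μ, hμm, hμ, hroot⟩ := exists_measurable_root
    -- Replacing x by max a x changes nothing on [a, b] and keeps the quotient continuous on the
    -- whole plane.
    (D := fun k x => D' (k / max a x, k * max a x))
    (by
      refine hD'c.comp (Continuous.prodMk ?_ (by fun_prop))
      exact Continuous.div (by fun_prop) (by fun_prop) fun p =>
        (lt_of_lt_of_le ha (le_max_left _ _)).ne') hab (Ici k₀) (by
      intro k hk
      have hk1 : 1 ≤ k := (le_max_left _ _).trans hk
      have hkk₁ : k₁ ≤ k := ((le_max_left _ _).trans (le_max_right _ _)).trans hk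
      have hkk₂ : k₂ ≤ k := ((le_max_right _ _).trans (le_max_right _ _)).trans hk
      simp only [max_self, max_eq_right hab, hD']
      constructor
      · have q1 := hk₁ k hkk₁
        have q2 := hk₂ k hkk₂
        have p1 := hpos k a hk ha .lower
        have p2 := hpos k a hk ha .upper
        simp only [Config.sgn, one_mul, neg_mul] at q1 q2
        set P : ℝ × ℝ := (k / a, k * a)
        rw [div_mul_eq_mul_div, div_le_iff₀ hG] at q1 q2
        have t1 := mul_le_mul_of_nonneg_left q1 (mul_nonneg (sq_nonneg r₁) p2.le)
        have t2 := mul_le_mul_of_nonneg_left q2 (mul_nonneg (sq_nonneg r₂) p1.le)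
        have t3 : 0 < G * (u .lower P 0 * u .upper P 0) := by positivity
        have t4 : 4 * Q * (r₁ ^ 2 * H .lower P 0 * u .upper P 0 -
          r₂ ^ 2 * H .upper P 0 * u .lower P 0) ≤
            2 * Q * (G * (u .lower P 0 * u .upper P 0)) := by
          simp only [Q] at t1 t2 ⊢
          nlinarith
        nlinarith
      · have q1 := hf₁ b (le_max_left _ _) k hk1
        have q2 := hf₂ b (le_max_right _ _) k hk1
        have hb0 : 0 < b := by linarith
        have p1 := hpos k b hk hb0 .lower
        have p2 := hpos k b hk hb0 .upper
        simp only [Config.sgn, one_mul, neg_mul] at q1 q2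
        set P : ℝ × ℝ := (k / b, k * b)
        rw [div_mul_eq_mul_div, le_div_iff₀ (by positivity)] at q1 q2
        have t1 := mul_le_mul_of_nonneg_left q1 (mul_nonneg (sq_nonneg r₁) p2.le)
        have t2 := mul_le_mul_of_nonneg_left q2 (mul_nonneg (sq_nonneg r₂) p1.le)
        have t3 : 0 < G * (u .lower P 0 * u .upper P 0) := by positivity
        have t4 : 2 * Q * (G * (u .lower P 0 * u .upper P 0)) ≤
            Q * (r₁ ^ 2 * H .lower P 0 * u .upper P 0 -
              r₂ ^ 2 * H .upper P 0 * u .lower P 0) := by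
          simp only [Q] at t1 t2 ⊢
          nlinarith
        nlinarith)
  refine ⟨⟨u, H, hm, μ, hμm, a, b, ha, hμ, k₀, le_max_left _ _, fun k hk => ?_⟩⟩
  have := hroot k hk
  simp only [max_eq_right (hμ k).1, hD'] at this
  simp only [modePar]
  linarith

/-- Linear relations between symbols carry over to superpositions of waves. -/
theorem sum_mul_re_cwave_eq_zero {S : Set Freq} {γ : Freq → ℝ} (h : IsSpectrum S γ) {n : ℕ}
    {r : Fin n → ℝ} {g : Fin n → Freq → ℂ} (hg : ∀ i, IsSymbol S (g i))
    (h0 : ∀ ξ ∈ S, ∑ i, (r i : ℂ) * g i ξ = 0) (t : ℝ) (y : Freq) :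
    ∑ i, r i * (cwave S γ (g i) t y).re = 0 := by
  have e : ∑ i, (r i : ℂ) * cwave S γ (g i) t y = 0 := by
    have h1 : ∀ i, (r i : ℂ) * cwave S γ (g i) t y =
        ∫ ξ in S, (r i : ℂ) * (g i ξ * planeWave γ ξ t y) := fun i =>
      (integral_const_mul _ _).symm
    simp_rw [h1]
    rw [← integral_finsetSum _ fun i _ => ((hg i).integrableOn h t y).const_mul _]
    refine setIntegral_eq_zero_of_forall_eq_zero fun ξ hξ => ?_
    simp_rw [← mul_assoc]
    rw [← Finset.sum_mul, h0 ξ hξ, zero_mul]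
  have := congrArg Complex.re e
  simpa using this

/-! ### Wave packets built from the growing modes -/

namespace GrowingModes

variable {c : Config} (M : GrowingModes c)

/-- The annulus of horizontal frequencies that are superposed. -/
def annulus (κ : ℝ) : Set Freq := {ξ | κ ≤ ‖ξ‖ ∧ ‖ξ‖ ≤ κ + 1}

/-- The mode parameters at the frequency `ξ`. -/
def par (ξ : Freq) : ℝ × ℝ := modePar ‖ξ‖ (M.μ ‖ξ‖)

/-- The growth rate at the frequency `ξ`. -/
def rate (ξ : Freq) : ℝ := √(‖ξ‖ * M.μ ‖ξ‖)

/-- The factors that match the modes of the two layers at the interface. -/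
def weight : Phase → Freq → ℝ
  | .lower => fun ξ => M.u .upper (M.par ξ) 0 / c.rho0 .upper 0
  | .upper => fun ξ => M.u .lower (M.par ξ) 0 / c.rho0 .lower 0

/-- The amplitude with Fourier symbol `m` and vertical profile `f`. -/
def amp (s : Phase) (m : Freq → ℂ) (f : ℝ × ℝ → ℝ → ℝ) (ξ : Freq) (z : ℝ) : ℂ :=
  m ξ * ((M.weight s ξ * f (M.par ξ) z : ℝ) : ℂ)

/-- The real wave packet with Fourier symbol `m` and vertical profile `f`. -/
def field (κ : ℝ) (s : Phase) (m : Freq → ℂ) (f : ℝ × ℝ → ℝ → ℝ) (t : ℝ) (x : Pt) : ℝ :=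
  (cwave (annulus κ) M.rate (fun ξ => M.amp s m f ξ x.2) t x.1).re

/-- Profiles generated by the modes of the phase `s`. -/
abbrev Profile (s : Phase) : (ℝ × ℝ → ℝ → ℝ) → Prop := ModeSpan (c.dom s) (M.u s) (M.H s)

theorem μ_pos (k : ℝ) : 0 < M.μ k := M.a_pos.trans_le (M.μ_mem k).1

theorem measurable_par : Measurable M.par := by
  have := M.measurable_μ
  unfold par modePar
  fun_prop

theorem measurable_rate : Measurable M.rate := by
  have := M.measurable_μ
  unfold rate
  fun_prop

theorem measurable_weight (s : Phase) : Measurable (M.weight s) := by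
  have h : ∀ s, Measurable fun ξ => M.u s (M.par ξ) 0 := fun s =>
    ((M.isMode s).continuous_u.comp (f := fun P : ℝ × ℝ => (P, (0 : ℝ)))
      (by fun_prop)).measurable.comp M.measurable_par
  cases s
  · exact (h _).div_const _
  · exact (h _).div_const _

theorem par_neg (ξ : Freq) : M.par (-ξ) = M.par ξ := by simp [par]

theorem rate_neg (ξ : Freq) : M.rate (-ξ) = M.rate ξ := by simp [rate]

theorem weight_neg (s : Phase) (ξ : Freq) : M.weight s (-ξ) = M.weight s ξ := by
  cases s <;> simp [weight, par_neg]

theorem measurableSet_annulus (κ : ℝ) : MeasurableSet (annulus κ) :=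
  (measurableSet_le measurable_const measurable_norm).inter
    (measurableSet_le measurable_norm measurable_const)

variable {κ : ℝ}

theorem rate_le {ξ : Freq} (hξ : ξ ∈ annulus κ) : M.rate ξ ≤ √((κ + 1) * M.b) := by
  apply Real.sqrt_le_sqrt
  have h1 := (M.μ_mem ‖ξ‖).2
  have h2 := M.μ_pos ‖ξ‖
  exact mul_le_mul hξ.2 h1 h2.le ((norm_nonneg ξ).trans hξ.2)

theorem isSpectrum (κ : ℝ) : IsSpectrum (annulus κ) M.rate where
  measurableSet := measurableSet_annulus κ
  measurable := M.measurable_rate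
  bdd := by
    refine ⟨max |κ + 1| √((κ + 1) * M.b), le_max_of_le_left (abs_nonneg _), fun ξ hξ => ⟨?_, ?_⟩⟩
    · exact hξ.2.trans ((le_abs_self _).trans (le_max_left _ _))
    · rw [abs_of_nonneg (show 0 ≤ M.rate ξ from Real.sqrt_nonneg _)]
      exact (M.rate_le hξ).trans (le_max_right _ _)
  neg_mem := fun ξ hξ => by simpa [annulus] using hξ
  even := M.rate_neg

/-- The parameters stay in a compact box whose size grows linearly in κ, because μ lies in a fixed
interval [a, b] with a > 0. -/
theorem par_mem {ξ : Freq} (hξ : ξ ∈ annulus κ) :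
    M.par ξ ∈ Icc 0 ((κ + 1) / M.a) ×ˢ Icc 0 ((κ + 1) * M.b) := by
  have h1 := M.μ_mem ‖ξ‖
  have h2 := M.μ_pos ‖ξ‖
  have h3 := M.a_pos
  have h4 := norm_nonneg ξ
  have h5 := hξ.2
  refine ⟨⟨by simp only [par, modePar]; positivity, ?_⟩,
    ⟨by simp only [par, modePar]; positivity, ?_⟩⟩
  · simp only [par, modePar]
    exact div_le_div₀ (by linarith) h5 h3 h1.1
  · simp only [par, modePar]
    exact mul_le_mul h5 h1.2 h2.le (by linarith)

theorem exists_weight_bound (κ : ℝ) (s : Phase) :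
    ∃ C, 0 ≤ C ∧ ∀ ξ ∈ annulus κ, |M.weight s ξ| ≤ C := by
  have h : ∀ (s : Phase) (r : ℝ), ∃ C, 0 ≤ C ∧ ∀ ξ ∈ annulus κ, |M.u s (M.par ξ) 0 / r| ≤ C := by
    intro s r
    have hK : IsCompact (Icc 0 ((κ + 1) / M.a) ×ˢ Icc 0 ((κ + 1) * M.b)) :=
      isCompact_Icc.prod isCompact_Icc
    obtain ⟨C, hC⟩ := hK.exists_bound_of_continuousOn (f := fun P => M.u s P 0 / r)
      (((M.isMode s).continuous_u.comp (f := fun P : ℝ × ℝ => (P, (0 : ℝ)))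
      (by fun_prop)).div_const r).continuousOn
    exact ⟨max C 0, le_max_right _ _, fun ξ hξ => (hC _ (M.par_mem hξ)).trans (le_max_left _ _)⟩
  cases s
  · exact h _ _
  · exact h _ _

variable (hc : c.Admissible) {s : Phase} {f : ℝ × ℝ → ℝ → ℝ} {m : Freq → ℂ}
include hc

/-- Profiles are jointly continuous in the parameters and the height, so they are bounded on the
compact box of parameters. Measurability in ξ is inherited from μ, and evenness from the dependence
on |ξ| alone. -/
theorem isAmplitude (hf : M.Profile s f) (hm : IsSymbol (annulus κ) m) :
    IsAmplitude (annulus κ) (c.lo s) (c.hi s) (M.amp s m f) := by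
  have hcont := hf.continuousOn (M.isMode s) (hc.Icc_subset_dom s)
  have hK : IsCompact ((Icc 0 ((κ + 1) / M.a) ×ˢ Icc 0 ((κ + 1) * M.b)) ×ˢ
      Icc (c.lo s) (c.hi s)) := (isCompact_Icc.prod isCompact_Icc).prod isCompact_Icc
  obtain ⟨C, hC⟩ := hK.exists_bound_of_continuousOn (hcont.mono (prod_mono_left (subset_univ _)))
  obtain ⟨D, hD, hw⟩ := M.exists_weight_bound κ s
  obtain ⟨B, hB, hmb⟩ := hm.bdd
  have hbd : ∀ ξ ∈ annulus κ, ∀ z ∈ Icc (c.lo s) (c.hi s), ‖M.amp s m f ξ z‖ ≤ B * (D * C) := by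
    intro ξ hξ z hz
    rw [amp, norm_mul, Complex.norm_real, norm_mul]
    have h1 := hC (M.par ξ, z) ⟨M.par_mem hξ, hz⟩
    have hC0 := (norm_nonneg _).trans h1
    exact mul_le_mul (hmb ξ hξ) (mul_le_mul (hw ξ hξ) h1 (norm_nonneg _) hD)
      (by positivity) hB
  have hsec : ∀ z ∈ Icc (c.lo s) (c.hi s), Measurable fun ξ => f (M.par ξ) z := by
    intro z hz
    have : Continuous fun P => f P z := hcont.comp_continuous
      (f := fun P : ℝ × ℝ => (P, z)) (by fun_prop) fun P => ⟨mem_univ _, hz⟩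
    exact this.measurable.comp M.measurable_par
  refine ⟨fun z hz => ⟨?_, ⟨max (B * (D * C)) 0, le_max_right _ _, fun ξ hξ =>
    (hbd ξ hξ z hz).trans (le_max_left _ _)⟩, fun ξ => ?_⟩, fun ξ hξ => ?_,
    ⟨max (B * (D * C)) 0, le_max_right _ _, fun ξ hξ z hz =>
      (hbd ξ hξ z hz).trans (le_max_left _ _)⟩⟩
  · exact hm.measurable.mul
      (Complex.measurable_ofReal.comp ((M.measurable_weight s).mul (hsec z hz)))
  · simp only [amp, hm.herm, M.weight_neg, M.par_neg, map_mul, Complex.conj_ofReal]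
  · have h1 : ContinuousOn (fun z => f (M.par ξ) z) (Icc (c.lo s) (c.hi s)) :=
      hcont.comp (f := fun z : ℝ => (M.par ξ, z)) (by fun_prop) fun z hz => ⟨mem_univ _, hz⟩
    exact continuousOn_const.mul
      (Complex.continuous_ofReal.comp_continuousOn (continuousOn_const.mul h1))

theorem exists_profile_deriv (hf : M.Profile s f) : ∃ f', M.Profile s f' ∧
    ∀ P, ∀ z ∈ Ioo (c.lo s) (c.hi s), HasDerivAt (f P) (f' P z) z :=
  hf.exists_hasDerivAt (M.isMode s) (hc.isOpen_dom s) (hc.Icc_subset_dom s)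
    (hc.contDiffOn_rho0 s) (fun _ hz => (hc.rho0_pos s hz).ne')
    ((hc.contDiffOn_dP s).inv fun _ hz => (hc.dP_pos s hz).ne')

omit hc in
theorem hasDerivAt_amp {f' : ℝ × ℝ → ℝ → ℝ}
    (hf' : ∀ P, ∀ z ∈ Ioo (c.lo s) (c.hi s), HasDerivAt (f P) (f' P z) z) (ξ : Freq) :
    ∀ z ∈ Ioo (c.lo s) (c.hi s), HasDerivAt (M.amp s m f ξ) (M.amp s m f' ξ z) z :=
  fun z hz => (((hf' (M.par ξ) z hz).const_mul _).ofReal_comp).const_mul _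

theorem hasFDerivAt_field (hf : M.Profile s f) (hm : IsSymbol (annulus κ) m)
    {f' : ℝ × ℝ → ℝ → ℝ} (hf' : M.Profile s f')
    (hd : ∀ P, ∀ z ∈ Ioo (c.lo s) (c.hi s), HasDerivAt (f P) (f' P z) z) (t : ℝ) {x : Pt}
    (hx : x ∈ c.slab s) :
    HasFDerivAt (fun p : ℝ × Pt => M.field κ s m f p.1 p.2)
      (Complex.reCLM ∘L
        (cwave (annulus κ) M.rate (fun ξ => M.rate ξ * M.amp s m f ξ x.2) t x.1 • timeCoord +
        (∑ i, cwave (annulus κ) M.rate (fun ξ => Complex.I * ξ i * M.amp s m f ξ x.2) t x.1 •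
          horCoord i) +
        cwave (annulus κ) M.rate (fun ξ => M.amp s m f' ξ x.2) t x.1 • vertCoord)) (t, x) := by
  rw [c.slab_eq] at hx
  exact Complex.reCLM.hasFDerivAt.comp (t, x) (hasFDerivAt_cwave (p := (t, x)) (M.isSpectrum κ)
    (M.isAmplitude hc hf hm) (M.isAmplitude hc hf' hm) (fun ξ _ => M.hasDerivAt_amp hd ξ) hx.2)

theorem regular_field (hf : M.Profile s f) (hm : IsSymbol (annulus κ) m) :
    Regular c s (M.field κ s m f) := by
  obtain ⟨f', hf', hd⟩ := M.exists_profile_deriv hc hf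
  constructor
  · have h1 := contDiffOn_cwave (M.isSpectrum κ) (M.isAmplitude hc hf hm)
      (M.isAmplitude hc hf' hm) (fun ξ _ => M.hasDerivAt_amp hd ξ)
    rw [c.slab_eq]
    exact (Complex.reCLM.contDiff.comp_contDiffOn h1).mono (prod_mono_left (subset_univ _))
  · have h1 := continuousOn_cwave (M.isSpectrum κ) (M.isAmplitude hc hf hm)
    rw [hc.closure_slab s]
    exact (Complex.continuous_re.comp_continuousOn h1).mono (prod_mono_left (subset_univ _))

theorem derivWithin_field (hf : M.Profile s f) (hm : IsSymbol (annulus κ) m) {t : ℝ}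
    (ht : 0 ≤ t) {x : Pt} (hx : x ∈ c.slab s) :
    derivWithin (fun τ => M.field κ s m f τ x) (Ici 0) t =
      (cwave (annulus κ) M.rate (fun ξ => M.rate ξ * M.amp s m f ξ x.2) t x.1).re := by
  obtain ⟨f', hf', hd⟩ := M.exists_profile_deriv hc hf
  have h1 := M.hasFDerivAt_field hc hf hm hf' hd t hx
  have h2 : HasDerivAt (fun τ : ℝ => (τ, x)) ((1, 0) : ℝ × Pt) t :=
    (hasDerivAt_id t).prodMk (hasDerivAt_const t x)
  have h3 := (h1.comp_hasDerivAt t h2).hasDerivWithinAt.derivWithin (uniqueDiffOn_Ici 0 t ht)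
  refine h3.trans ?_
  simp [timeCoord, horCoord, vertCoord]

theorem hasFDerivAt_field_space (hf : M.Profile s f) (hm : IsSymbol (annulus κ) m)
    {f' : ℝ × ℝ → ℝ → ℝ} (hf' : M.Profile s f')
    (hd : ∀ P, ∀ z ∈ Ioo (c.lo s) (c.hi s), HasDerivAt (f P) (f' P z) z) (t : ℝ) {x : Pt}
    (hx : x ∈ c.slab s) :
    ∃ L : Pt →L[ℝ] ℝ, HasFDerivAt (M.field κ s m f t) L x ∧
      (∀ i : Fin 2, L (EuclideanSpace.single i 1, 0) =
        (cwave (annulus κ) M.rate (fun ξ => Complex.I * ξ i * M.amp s m f ξ x.2) t x.1).re) ∧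
      L (0, 1) = (cwave (annulus κ) M.rate (fun ξ => M.amp s m f' ξ x.2) t x.1).re := by
  have h1 := M.hasFDerivAt_field hc hf hm hf' hd t hx
  have h2 : HasFDerivAt (fun x : Pt => (t, x)) (ContinuousLinearMap.inr ℝ ℝ Pt) x :=
    hasFDerivAt_prodMk_right t x
  refine ⟨_, h1.comp x h2, fun i => ?_, ?_⟩
  · fin_cases i <;> simp [timeCoord, horCoord, vertCoord]
  · simp [timeCoord, horCoord, vertCoord]

theorem pd_field_horizontal (hf : M.Profile s f) (hm : IsSymbol (annulus κ) m) (t : ℝ) {x : Pt}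
    (hx : x ∈ c.slab s) (i : Fin 2) : pd i.castSucc (M.field κ s m f t) x =
      (cwave (annulus κ) M.rate (fun ξ => Complex.I * ξ i * M.amp s m f ξ x.2) t x.1).re := by
  obtain ⟨f', hf', hd⟩ := M.exists_profile_deriv hc hf
  obtain ⟨L, hL, h1, -⟩ := M.hasFDerivAt_field_space hc hf hm hf' hd t hx
  rw [pd, hL.fderiv, ← h1 i]
  fin_cases i <;> rfl

theorem pd_field_vertical (hf : M.Profile s f) (hm : IsSymbol (annulus κ) m) (t : ℝ) {x : Pt}
    (hx : x ∈ c.slab s) {d : ℝ × ℝ → ℝ} (hd : ∀ P, HasDerivAt (f P) (d P) x.2) :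
    pd 2 (M.field κ s m f t) x = (cwave (annulus κ) M.rate
      (fun ξ => m ξ * ((M.weight s ξ * d (M.par ξ) : ℝ) : ℂ)) t x.1).re := by
  obtain ⟨f', hf', hd'⟩ := M.exists_profile_deriv hc hf
  obtain ⟨L, hL, -, h1⟩ := M.hasFDerivAt_field_space hc hf hm hf' hd' t hx
  rw [pd, hL.fderiv]
  refine h1.trans ?_
  rw [c.slab_eq] at hx
  congr 2
  funext ξ
  rw [amp, (hd' (M.par ξ) x.2 hx.2).unique (hd (M.par ξ))]

theorem isSymbol_vertical (hf : M.Profile s f) (hm : IsSymbol (annulus κ) m) {x : Pt}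
    (hx : x ∈ c.slab s) {d : ℝ × ℝ → ℝ} (hd : ∀ P, HasDerivAt (f P) (d P) x.2) :
    IsSymbol (annulus κ) (fun ξ => m ξ * ((M.weight s ξ * d (M.par ξ) : ℝ) : ℂ)) := by
  obtain ⟨f', hf', hd'⟩ := M.exists_profile_deriv hc hf
  rw [c.slab_eq] at hx
  have h1 := (M.isAmplitude hc hf' hm).isSymbol x.2 (Ioo_subset_Icc_self hx.2)
  convert h1 using 2 with ξ
  rw [amp, (hd' (M.par ξ) x.2 hx.2).unique (hd (M.par ξ))]

end GrowingModes

theorem isSymbol_ofReal {S : Set Freq} {ρ : Freq → ℝ} (hm : Measurable ρ)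
    (he : ∀ ξ, ρ (-ξ) = ρ ξ) {C : ℝ} (hC : 0 ≤ C) (hb : ∀ ξ ∈ S, |ρ ξ| ≤ C) :
    IsSymbol S (fun ξ => (ρ ξ : ℂ)) :=
  ⟨Complex.measurable_ofReal.comp hm, ⟨C, hC, fun ξ hξ => by simpa using hb ξ hξ⟩,
    fun ξ => by simp [he]⟩

/-! ### The packets solve the linearized problem -/

namespace GrowingModes

variable {c : Config} (M : GrowingModes c) {κ : ℝ}

theorem rate_sq (ξ : Freq) : M.rate ξ ^ 2 = ‖ξ‖ * M.μ ‖ξ‖ :=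
  Real.sq_sqrt (mul_nonneg (norm_nonneg _) (M.μ_pos _).le)

theorem le_rate {ξ : Freq} (hξ : ξ ∈ annulus κ) : √(κ * M.a) ≤ M.rate ξ :=
  Real.sqrt_le_sqrt (mul_le_mul hξ.1 (M.μ_mem _).1 M.a_pos.le (norm_nonneg _))

theorem rate_pos (hκ : 0 < κ) {ξ : Freq} (hξ : ξ ∈ annulus κ) : 0 < M.rate ξ :=
  (Real.sqrt_pos.2 (mul_pos hκ M.a_pos)).trans_le (M.le_rate hξ)

theorem par_snd (ξ : Freq) : (M.par ξ).2 = M.rate ξ ^ 2 := by rw [rate_sq]; rfl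

theorem par_fst (ξ : Freq) : (M.par ξ).1 * M.rate ξ ^ 2 = ξ 0 ^ 2 + ξ 1 ^ 2 := by
  have h2 : ‖ξ‖ ^ 2 = ξ 0 ^ 2 + ξ 1 ^ 2 := by
    rw [EuclideanSpace.norm_sq_eq]; simp
  have h3 := (M.μ_pos ‖ξ‖).ne'
  rw [rate_sq, ← h2]
  simp only [par, modePar]
  field_simp

theorem isSymbol_inv_rate (hκ : 0 < κ) : IsSymbol (annulus κ) (fun ξ => (M.rate ξ : ℂ)⁻¹) := by
  have h := isSymbol_ofReal (S := annulus κ) (ρ := fun ξ => (M.rate ξ)⁻¹)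
    M.measurable_rate.inv (fun ξ => by rw [M.rate_neg]) (C := (√(κ * M.a))⁻¹) (by positivity)
    (fun ξ hξ => by
      rw [abs_of_nonneg (inv_nonneg.2 (M.rate_pos hκ hξ).le)]
      exact inv_anti₀ (Real.sqrt_pos.2 (mul_pos hκ M.a_pos)) (M.le_rate hξ))
  simpa using h

/-- The Fourier symbols of the velocity. -/
def symV (α : ℝ) : Fin 3 → Freq → ℂ :=
  ![fun ξ => α * ((M.rate ξ : ℂ)⁻¹ * ((M.rate ξ : ℂ)⁻¹ * (Complex.I * ξ 0))),
    fun ξ => α * ((M.rate ξ : ℂ)⁻¹ * ((M.rate ξ : ℂ)⁻¹ * (Complex.I * ξ 1))), fun _ => α]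

/-- The Fourier symbols of the flow map. -/
def symEta (α : ℝ) (i : Fin 3) (ξ : Freq) : ℂ := (M.rate ξ : ℂ)⁻¹ * M.symV α i ξ

/-- The Fourier symbol of the density. -/
def symQ (α : ℝ) (ξ : Freq) : ℂ := ((-α : ℝ) : ℂ) * (M.rate ξ : ℂ)⁻¹

/-- The vertical profile of the normal velocity. -/
def normalProfile (s : Phase) (P : ℝ × ℝ) (z : ℝ) : ℝ := (c.rho0 s z)⁻¹ * M.u s P z

/-- The vertical profile of the tangential velocity. -/
def tangentialProfile (s : Phase) (P : ℝ × ℝ) (z : ℝ) : ℝ := 1 * M.H s P z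

/-- The vertical profile of the pressure. -/
def pressureProfile (s : Phase) (P : ℝ × ℝ) (z : ℝ) : ℝ :=
  c.rho0 s z * M.H s P z + c.g * M.u s P z

/-- The vertical profile of the density. -/
def densityProfile (s : Phase) (P : ℝ × ℝ) (z : ℝ) : ℝ :=
  (c.rho0 s z * (c.dP s z)⁻¹) * M.H s P z + (c.g * (c.dP s z)⁻¹) * M.u s P z

/-- The vertical profiles of the velocity. -/
def velocityProfile (s : Phase) : Fin 3 → ℝ × ℝ → ℝ → ℝ :=
  ![M.tangentialProfile s, M.tangentialProfile s, M.normalProfile s]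

theorem isSymbol_symV (hκ : 0 < κ) (α : ℝ) (i : Fin 3) : IsSymbol (annulus κ) (M.symV α i) := by
  have hr := M.isSymbol_inv_rate hκ
  have hα := isSymbol_const (annulus κ) α
  fin_cases i
  · exact hα.mul (hr.mul (hr.mul ((M.isSpectrum κ).isSymbol_coord 0)))
  · exact hα.mul (hr.mul (hr.mul ((M.isSpectrum κ).isSymbol_coord 1)))
  · exact hα

theorem isSymbol_symEta (hκ : 0 < κ) (α : ℝ) (i : Fin 3) :
    IsSymbol (annulus κ) (M.symEta α i) :=
  (M.isSymbol_inv_rate hκ).mul (M.isSymbol_symV hκ α i)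

theorem isSymbol_symQ (hκ : 0 < κ) (α : ℝ) : IsSymbol (annulus κ) (M.symQ α) :=
  (isSymbol_const (annulus κ) (-α)).mul (M.isSymbol_inv_rate hκ)

/-- The growing wave packet with amplitude `α` and frequencies `κ ≤ |ξ| ≤ κ + 1`. -/
def state (κ α : ℝ) : State where
  η := fun s t x i => M.field κ s (M.symEta α i) (M.velocityProfile s i) t x
  v := fun s t x i => M.field κ s (M.symV α i) (M.velocityProfile s i) t x
  q := fun s t x => M.field κ s (M.symQ α) (M.densityProfile s) t x

variable (hc : c.Admissible) (s : Phase)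
include hc

theorem profile_normal : M.Profile s (M.normalProfile s) :=
  ModeSpan.u ((hc.contDiffOn_rho0 s).inv fun _ hz => (hc.rho0_pos s hz).ne')

omit hc in
theorem profile_tangential : M.Profile s (M.tangentialProfile s) :=
  ModeSpan.H (a := fun _ => 1) contDiffOn_const

theorem profile_pressure : M.Profile s (M.pressureProfile s) :=
  (ModeSpan.H (hc.contDiffOn_rho0 s)).add (ModeSpan.u (a := fun _ => c.g) contDiffOn_const)

theorem profile_density : M.Profile s (M.densityProfile s) := by
  have h := (hc.contDiffOn_dP s).inv fun _ hz => (hc.dP_pos s hz).ne'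
  exact (ModeSpan.H ((hc.contDiffOn_rho0 s).mul h)).add (ModeSpan.u (contDiffOn_const.mul h))

theorem profile_velocity (i : Fin 3) : M.Profile s (M.velocityProfile s i) := by
  fin_cases i
  · exact M.profile_tangential s
  · exact M.profile_tangential s
  · exact M.profile_normal hc s

variable {s}

omit hc in
theorem mem_Ioo_of_slab {x : Pt} (hx : x ∈ c.slab s) : x.2 ∈ Ioo (c.lo s) (c.hi s) := by
  rw [c.slab_eq] at hx
  exact hx.2

theorem mem_dom_of_slab {x : Pt} (hx : x ∈ c.slab s) : x.2 ∈ c.dom s :=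
  hc.Icc_subset_dom s (Ioo_subset_Icc_self (mem_Ioo_of_slab hx))

/-- The term g u/(P'(ρ₀)ρ₀) comes from ρ₀' = -gρ₀/P'(ρ₀); the rest is the mode equation for u
divided by ρ₀. -/
theorem hasDerivAt_normalProfile (P : ℝ × ℝ) {x : Pt} (hx : x ∈ c.slab s) :
    HasDerivAt (M.normalProfile s P) (((c.dP s x.2)⁻¹ + P.1) * M.H s P x.2 +
      c.g * (c.dP s x.2)⁻¹ / c.rho0 s x.2 * M.u s P x.2) x.2 := by
  have hz := mem_dom_of_slab hc hx
  have hr := (hc.rho0_pos s hz).ne'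
  have hp := (hc.dP_pos s hz).ne'
  have h1 := ((hc.hasDerivAt_rho0 s hz).inv hr).mul
    ((M.isMode s).hasDerivAt_u P x.2 (mem_Ioo_of_slab hx))
  refine h1.congr_deriv ?_
  simp only [Pi.inv_apply]
  field_simp
  ring

/-- The contributions ∓gρ₀H/P'(ρ₀), from ρ₀' and from the compressible part of u', cancel. -/
theorem hasDerivAt_pressureProfile (P : ℝ × ℝ) {x : Pt} (hx : x ∈ c.slab s) :
    HasDerivAt (M.pressureProfile s P) (c.g * P.1 * c.rho0 s x.2 * M.H s P x.2 +
      P.2 * M.u s P x.2) x.2 := by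
  have hz := mem_dom_of_slab hc hx
  have hr := (hc.rho0_pos s hz).ne'
  have hp := (hc.dP_pos s hz).ne'
  have h1 := ((hc.hasDerivAt_rho0 s hz).mul
    ((M.isMode s).hasDerivAt_H P x.2 (mem_Ioo_of_slab hx))).add
    (((M.isMode s).hasDerivAt_u P x.2 (mem_Ioo_of_slab hx)).const_mul c.g)
  refine h1.congr_deriv ?_
  field_simp
  ring

theorem dP_mul_densityProfile (P : ℝ × ℝ) {z : ℝ} (hz : z ∈ c.dom s) :
    c.dP s z * M.densityProfile s P z = M.pressureProfile s P z := by
  have hp := (hc.dP_pos s hz).ne'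
  simp only [densityProfile, pressureProfile]
  field_simp

theorem dP_mul_field_density (α t : ℝ) {x : Pt} (hx : x.2 ∈ c.dom s) :
    c.dP s x.2 * M.field κ s (M.symQ α) (M.densityProfile s) t x =
      M.field κ s (M.symQ α) (M.pressureProfile s) t x := by
  rw [field, field, ← Complex.re_ofReal_mul, ← cwave_const_mul]
  congr 2
  funext ξ
  simp only [amp]
  rw [← M.dP_mul_densityProfile hc _ hx]
  push_cast
  ring

theorem pd_dP_mul_field_density (α t : ℝ) {x : Pt} (hx : x ∈ c.slab s) (i : Fin 3) :
    pd i (fun y => c.dP s y.2 * M.field κ s (M.symQ α) (M.densityProfile s) t y) x =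
      pd i (M.field κ s (M.symQ α) (M.pressureProfile s) t) x := by
  have h : (fun y : Pt => c.dP s y.2 * M.field κ s (M.symQ α) (M.densityProfile s) t y) =ᶠ[nhds x]
      M.field κ s (M.symQ α) (M.pressureProfile s) t := by
    filter_upwards [(c.isOpen_slab s).mem_nhds hx] with y hy
    exact M.dP_mul_field_density hc α t (mem_dom_of_slab hc hy)
  rw [pd, pd, h.fderiv_eq]

/-- The horizontal divergence of (iξ/λ²)H is -KH. It cancels the K-term of (u/ρ₀)', and what remains
is ρ₀⁻¹ times the density profile, balanced by λq. -/
theorem symbol_eq_q (hκ : 0 < κ) (α : ℝ) {x : Pt} (hx : x ∈ c.slab s) {ξ : Freq}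
    (hξ : ξ ∈ annulus κ) :
    M.rate ξ * M.amp s (M.symQ α) (M.densityProfile s) ξ x.2 + c.rho0 s x.2 *
      (Complex.I * ξ 0 * M.amp s (M.symV α 0) (M.tangentialProfile s) ξ x.2 +
      Complex.I * ξ 1 * M.amp s (M.symV α 1) (M.tangentialProfile s) ξ x.2 +
      M.symV α 2 ξ * ((M.weight s ξ * (((c.dP s x.2)⁻¹ + (M.par ξ).1) * M.H s (M.par ξ) x.2 +
      c.g * (c.dP s x.2)⁻¹ / c.rho0 s x.2 * M.u s (M.par ξ) x.2) : ℝ) : ℂ)) = 0 := by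
  have hl : (M.rate ξ : ℂ) ≠ 0 := Complex.ofReal_ne_zero.2 (M.rate_pos hκ hξ).ne'
  have hr' : (c.rho0 s x.2 : ℂ) ≠ 0 :=
    Complex.ofReal_ne_zero.2 (hc.rho0_pos s (mem_dom_of_slab hc hx)).ne'
  have hK : ((M.par ξ).1 : ℂ) = ((ξ 0 : ℂ) ^ 2 + (ξ 1 : ℂ) ^ 2) * ((M.rate ξ : ℂ)⁻¹) ^ 2 := by
    have : ((M.par ξ).1 : ℂ) * (M.rate ξ : ℂ) ^ 2 = (ξ 0 : ℂ) ^ 2 + (ξ 1 : ℂ) ^ 2 := by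
      exact_mod_cast M.par_fst ξ
    rw [← this]; field_simp
  simp only [amp, symV, symQ, densityProfile, tangentialProfile, Matrix.cons_val]
  push_cast
  rw [hK]
  field_simp
  ring_nf
  simp only [Complex.I_sq]
  ring

/-- The pressure perturbation plus gρ₀η₃ equals -ρ₀H/λ, so its horizontal gradient is balanced by
the inertia of (iξ/λ²)H. -/
theorem symbol_eq_v_horizontal (hκ : 0 < κ) (α : ℝ) {x : Pt} (hx : x ∈ c.slab s) {ξ : Freq}
    (hξ : ξ ∈ annulus κ) (i : Fin 2) :
    c.rho0 s x.2 * (M.rate ξ * M.amp s (M.symV α i.castSucc) (M.tangentialProfile s) ξ x.2) +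
      Complex.I * ξ i * M.amp s (M.symQ α) (M.pressureProfile s) ξ x.2 + c.g * c.rho0 s x.2 *
      (Complex.I * ξ i * M.amp s (M.symEta α 2) (M.normalProfile s) ξ x.2) = 0 := by
  have hl : (M.rate ξ : ℂ) ≠ 0 := Complex.ofReal_ne_zero.2 (M.rate_pos hκ hξ).ne'
  have hr' : (c.rho0 s x.2 : ℂ) ≠ 0 :=
    Complex.ofReal_ne_zero.2 (hc.rho0_pos s (mem_dom_of_slab hc hx)).ne'
  have hV : M.symV α i.castSucc ξ =
      α * ((M.rate ξ : ℂ)⁻¹ * ((M.rate ξ : ℂ)⁻¹ * (Complex.I * ξ i))) := by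
    fin_cases i <;> rfl
  have hE : M.symEta α 2 ξ = (M.rate ξ : ℂ)⁻¹ * α := rfl
  rw [amp, hV]
  simp only [amp, hE, symQ, normalProfile, pressureProfile, tangentialProfile]
  push_cast
  field_simp
  ring

/-- The relation L = λ² cancels inertia against the u-term of the pressure gradient; the buoyancy
terms in q and ∂₃η₃ absorb the others. -/
theorem symbol_eq_v_vertical (hκ : 0 < κ) (α : ℝ) {x : Pt} (hx : x ∈ c.slab s) {ξ : Freq}
    (hξ : ξ ∈ annulus κ) :
    c.rho0 s x.2 * (M.rate ξ * M.amp s (M.symV α 2) (M.normalProfile s) ξ x.2) +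
      M.symQ α ξ * ((M.weight s ξ * (c.g * (M.par ξ).1 * c.rho0 s x.2 * M.H s (M.par ξ) x.2 +
      (M.par ξ).2 * M.u s (M.par ξ) x.2) : ℝ) : ℂ) +
      c.g * M.amp s (M.symQ α) (M.densityProfile s) ξ x.2 + c.g * c.rho0 s x.2 *
      (M.symEta α 2 ξ * ((M.weight s ξ * (((c.dP s x.2)⁻¹ + (M.par ξ).1) * M.H s (M.par ξ) x.2 +
      c.g * (c.dP s x.2)⁻¹ / c.rho0 s x.2 * M.u s (M.par ξ) x.2) : ℝ) : ℂ)) = 0 := by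
  have hl : (M.rate ξ : ℂ) ≠ 0 := Complex.ofReal_ne_zero.2 (M.rate_pos hκ hξ).ne'
  have hz := mem_dom_of_slab hc hx
  have hr' : (c.rho0 s x.2 : ℂ) ≠ 0 := Complex.ofReal_ne_zero.2 (hc.rho0_pos s hz).ne'
  have hp' : (c.dP s x.2 : ℂ) ≠ 0 := Complex.ofReal_ne_zero.2 (hc.dP_pos s hz).ne'
  have hV : M.symV α 2 ξ = α := rfl
  have hE : M.symEta α 2 ξ = (M.rate ξ : ℂ)⁻¹ * α := rfl
  simp only [amp, hV, hE, symQ, normalProfile, densityProfile, par_snd]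
  push_cast
  field_simp
  ring

theorem state_eq_q (hκ : 0 < κ) (α : ℝ) {t : ℝ} (ht : 0 ≤ t) {x : Pt} (hx : x ∈ c.slab s) :
    derivWithin (fun τ => (M.state κ α).q s τ x) (Ici 0) t +
      c.rho0 s x.2 * dvg ((M.state κ α).v s t) x = 0 := by
  have hI := Ioo_subset_Icc_self (mem_Ioo_of_slab hx)
  have hV := M.isSymbol_symV hκ α
  have hS := M.isSpectrum κ
  have hpd0 := M.pd_field_horizontal hc (M.profile_tangential s) (hV 0) t hx 0
  have hpd1 := M.pd_field_horizontal hc (M.profile_tangential s) (hV 1) t hx 1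
  have hpd2 := M.pd_field_vertical hc (M.profile_normal hc s) (hV 2) t hx
    (fun P => M.hasDerivAt_normalProfile hc P hx)
  have hdt := M.derivWithin_field hc (M.profile_density hc s) (M.isSymbol_symQ hκ α) ht hx
  have key := sum_mul_re_cwave_eq_zero hS (n := 4)
    (r := ![1, c.rho0 s x.2, c.rho0 s x.2, c.rho0 s x.2])
    (g := ![fun ξ => M.rate ξ * M.amp s (M.symQ α) (M.densityProfile s) ξ x.2,
      fun ξ => Complex.I * ξ 0 * M.amp s (M.symV α 0) (M.tangentialProfile s) ξ x.2,
      fun ξ => Complex.I * ξ 1 * M.amp s (M.symV α 1) (M.tangentialProfile s) ξ x.2, _])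
    (by
      intro i
      fin_cases i
      · exact hS.isSymbol.mul ((M.isAmplitude hc (M.profile_density hc s)
          (M.isSymbol_symQ hκ α)).isSymbol _ hI)
      · exact (hS.isSymbol_coord 0).mul ((M.isAmplitude hc (M.profile_tangential s)
          (hV 0)).isSymbol _ hI)
      · exact (hS.isSymbol_coord 1).mul ((M.isAmplitude hc (M.profile_tangential s)
          (hV 1)).isSymbol _ hI)
      · exact M.isSymbol_vertical hc (M.profile_normal hc s) (hV 2) hx
          (fun P => M.hasDerivAt_normalProfile hc P hx))
    (fun ξ hξ => by
      have := M.symbol_eq_q hc hκ α hx hξ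
      simp only [Fin.sum_univ_four, Matrix.cons_val, Complex.ofReal_one]
      linear_combination this)
    t x.1
  simp only [Fin.sum_univ_four, Matrix.cons_val, one_mul] at key
  rw [← hpd0, ← hpd1, ← hpd2, ← hdt] at key
  rw [dvg, Fin.sum_univ_three]
  change derivWithin (fun τ => M.field κ s (M.symQ α) (M.densityProfile s) τ x) (Ici 0) t +
    c.rho0 s x.2 * (pd (Fin.castSucc 0) (M.field κ s (M.symV α 0) (M.tangentialProfile s) t) x +
    pd (Fin.castSucc 1) (M.field κ s (M.symV α 1) (M.tangentialProfile s) t) x +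
    pd 2 (M.field κ s (M.symV α 2) (M.normalProfile s) t) x) = 0
  linear_combination key

theorem state_eq_η (hκ : 0 < κ) (α : ℝ) {t : ℝ} (ht : 0 ≤ t) {x : Pt} (hx : x ∈ c.slab s)
    (i : Fin 3) :
    derivWithin (fun τ => (M.state κ α).η s τ x i) (Ici 0) t = (M.state κ α).v s t x i := by
  refine (M.derivWithin_field hc (M.profile_velocity hc s i) (M.isSymbol_symEta hκ α i) ht hx).trans
    (congrArg Complex.re (cwave_congr (M.isSpectrum κ) (fun ξ hξ => ?_) t x.1))
  have hl : (M.rate ξ : ℂ) ≠ 0 := Complex.ofReal_ne_zero.2 (M.rate_pos hκ hξ).ne'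
  simp only [amp, symEta]
  field_simp

theorem state_eq_v (hκ : 0 < κ) (α : ℝ) {t : ℝ} (ht : 0 ≤ t) {x : Pt} (hx : x ∈ c.slab s)
    (i : Fin 3) :
    c.rho0 s x.2 * derivWithin (fun τ => (M.state κ α).v s τ x i) (Ici 0) t +
        pd i (fun y => c.dP s y.2 * (M.state κ α).q s t y) x =
      -(c.g * (M.state κ α).q s t x * (if i = 2 then 1 else 0)) -
        c.g * c.rho0 s x.2 * pd i (fun y => (M.state κ α).η s t y 2) x := by
  have hI := Ioo_subset_Icc_self (mem_Ioo_of_slab hx)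
  have hS := M.isSpectrum κ
  have hV := M.isSymbol_symV hκ α
  have hE := M.isSymbol_symEta hκ α 2
  have hQ := M.isSymbol_symQ hκ α
  have hn := M.profile_normal hc s
  have hp := M.profile_pressure hc s
  have hT := M.profile_tangential s
  have hdt := M.derivWithin_field hc (M.profile_velocity hc s i) (hV i) ht hx
  have hdp := M.pd_dP_mul_field_density hc (κ := κ) α t hx i
  change c.rho0 s x.2 *
      derivWithin (fun τ => M.field κ s (M.symV α i) (M.velocityProfile s i) τ x) (Ici 0) t +
      pd i (fun y => c.dP s y.2 * M.field κ s (M.symQ α) (M.densityProfile s) t y) x =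
    -(c.g * M.field κ s (M.symQ α) (M.densityProfile s) t x * (if i = 2 then 1 else 0)) -
      c.g * c.rho0 s x.2 * pd i (M.field κ s (M.symEta α 2) (M.normalProfile s) t) x
  rw [hdt, hdp]
  have horizontal : ∀ j : Fin 2, c.rho0 s x.2 * (cwave (annulus κ) M.rate (fun ξ => M.rate ξ *
        M.amp s (M.symV α j.castSucc) (M.tangentialProfile s) ξ x.2) t x.1).re +
      pd j.castSucc (M.field κ s (M.symQ α) (M.pressureProfile s) t) x =
      - c.g * c.rho0 s x.2 *
        pd j.castSucc (M.field κ s (M.symEta α 2) (M.normalProfile s) t) x := by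
    intro j
    have key := sum_mul_re_cwave_eq_zero hS (n := 3)
      (r := ![c.rho0 s x.2, 1, c.g * c.rho0 s x.2])
      (g := ![fun ξ => M.rate ξ * M.amp s (M.symV α j.castSucc) (M.tangentialProfile s) ξ x.2,
        fun ξ => Complex.I * ξ j * M.amp s (M.symQ α) (M.pressureProfile s) ξ x.2,
        fun ξ => Complex.I * ξ j * M.amp s (M.symEta α 2) (M.normalProfile s) ξ x.2])
      (by
        intro i
        fin_cases i
        · exact hS.isSymbol.mul ((M.isAmplitude hc hT (hV _)).isSymbol _ hI)
        · exact (hS.isSymbol_coord j).mul ((M.isAmplitude hc hp hQ).isSymbol _ hI)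
        · exact (hS.isSymbol_coord j).mul ((M.isAmplitude hc hn hE).isSymbol _ hI))
      (fun ξ hξ => by
        have := M.symbol_eq_v_horizontal hc hκ α hx hξ j
        simp only [Fin.sum_univ_three, Matrix.cons_val, Complex.ofReal_one, Complex.ofReal_mul]
        linear_combination this)
      t x.1
    simp only [Fin.sum_univ_three, Matrix.cons_val, one_mul] at key
    rw [M.pd_field_horizontal hc hp hQ t hx j, M.pd_field_horizontal hc hn hE t hx j]
    linear_combination key
  have vertical : c.rho0 s x.2 * (cwave (annulus κ) M.rate (fun ξ => M.rate ξ *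
        M.amp s (M.symV α 2) (M.normalProfile s) ξ x.2) t x.1).re +
      pd 2 (M.field κ s (M.symQ α) (M.pressureProfile s) t) x =
      - (c.g * M.field κ s (M.symQ α) (M.densityProfile s) t x) - c.g * c.rho0 s x.2 *
        pd 2 (M.field κ s (M.symEta α 2) (M.normalProfile s) t) x := by
    have hdn := fun P => M.hasDerivAt_normalProfile hc P hx
    have hdp := fun P => M.hasDerivAt_pressureProfile hc P hx
    have key := sum_mul_re_cwave_eq_zero hS (n := 4)
      (r := ![c.rho0 s x.2, 1, c.g, c.g * c.rho0 s x.2])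
      (g := ![fun ξ => M.rate ξ * M.amp s (M.symV α 2) (M.normalProfile s) ξ x.2, _,
        fun ξ => M.amp s (M.symQ α) (M.densityProfile s) ξ x.2, _])
      (by
        intro i
        fin_cases i
        · exact hS.isSymbol.mul ((M.isAmplitude hc hn (hV _)).isSymbol _ hI)
        · exact M.isSymbol_vertical hc hp hQ hx hdp
        · exact (M.isAmplitude hc (M.profile_density hc s) hQ).isSymbol _ hI
        · exact M.isSymbol_vertical hc hn hE hx hdn)
      (fun ξ hξ => by
        have := M.symbol_eq_v_vertical hc hκ α hx hξ
        simp only [Fin.sum_univ_four, Matrix.cons_val, Complex.ofReal_one, Complex.ofReal_mul]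
        simp only [Complex.ofReal_mul] at this
        linear_combination this)
      t x.1
    simp only [Fin.sum_univ_four, Matrix.cons_val, one_mul] at key
    rw [M.pd_field_vertical hc hp hQ t hx hdp, M.pd_field_vertical hc hn hE t hx hdn]
    simp only [field] at key ⊢
    linear_combination key
  fin_cases i
  · have := horizontal 0
    simp only [Fin.zero_eta, Fin.isValue, Fin.reduceEq, if_false, mul_zero, neg_zero, zero_sub]
    rw [← neg_mul, ← neg_mul]
    exact this
  · have := horizontal 1
    simp only [Fin.mk_one, Fin.isValue, Fin.reduceEq, if_false, mul_zero, neg_zero, zero_sub]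
    rw [← neg_mul, ← neg_mul]
    exact this
  · simp only [Fin.reduceFinMk, Fin.isValue, if_true, mul_one]
    exact vertical

omit hc in
theorem field_eq_zero {m : Freq → ℂ} {f : ℝ × ℝ → ℝ → ℝ} {t : ℝ} {x : Pt}
    (h : ∀ ξ ∈ annulus κ, f (M.par ξ) x.2 = 0) : M.field κ s m f t x = 0 := by
  have : cwave (annulus κ) M.rate (fun ξ => M.amp s m f ξ x.2) t x.1 = 0 :=
    setIntegral_eq_zero_of_forall_eq_zero fun ξ hξ => by simp [amp, h ξ hξ]
  simp [field, this]

omit hc in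
theorem field_eq_field {m : Freq → ℂ} {f f' : ℝ × ℝ → ℝ → ℝ} {s' : Phase} {t : ℝ} {x : Pt}
    (h : ∀ ξ ∈ annulus κ,
      M.weight s ξ * f (M.par ξ) x.2 = M.weight s' ξ * f' (M.par ξ) x.2) :
    M.field κ s m f t x = M.field κ s' m f' t x :=
  congrArg Complex.re (cwave_congr (M.isSpectrum κ) (fun ξ hξ => by simp only [amp, h ξ hξ]) t x.1)

theorem zero_mem_dom (s : Phase) : (0 : ℝ) ∈ c.dom s := by
  apply hc.Icc_subset_dom s
  cases s
  · exact ⟨neg_nonpos.2 hc.m_pos.le, le_rfl⟩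
  · exact ⟨le_rfl, hc.ℓ_pos.le⟩

/-- The weights give both layers the same normal velocity u₋u₊/(ρ₋ρ₊) at the interface. After
clearing denominators, equality of the weighted pressures is exactly the `dispersion` relation. -/
theorem isSolution_state (hκ : M.k₀ ≤ κ) (α : ℝ) : IsSolution c (M.state κ α) := by
  have h0 : 0 < κ := zero_lt_one.trans_le (M.one_le.trans hκ)
  have hr := fun s => hc.rho0_pos s (zero_mem_dom hc s)
  exact {
    regular_η := fun s i => M.regular_field hc (M.profile_velocity hc s i)
      (M.isSymbol_symEta h0 α i)
    regular_v := fun s i => M.regular_field hc (M.profile_velocity hc s i) (M.isSymbol_symV h0 α i)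
    regular_q := fun s => M.regular_field hc (M.profile_density hc s) (M.isSymbol_symQ h0 α)
    eq_η := fun s t ht x hx i => M.state_eq_η hc h0 α ht hx i
    eq_q := fun s t ht x hx => M.state_eq_q hc h0 α ht hx
    eq_v := fun s t ht x hx i => M.state_eq_v hc h0 α ht hx i
    jump_v := fun t _ y => sub_eq_zero.2 <| M.field_eq_field fun ξ _ => by
      have h1 := (hr .lower).ne'
      have h2 := (hr .upper).ne'
      simp only [velocityProfile, normalProfile, weight, Matrix.cons_val]
      field_simp
    jump_q := fun t _ y => by
      have hd : ∀ s, c.dP s 0 * (M.state κ α).q s t (y, 0) =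
          M.field κ s (M.symQ α) (M.pressureProfile s) t (y, 0) := fun s =>
        M.dP_mul_field_density hc α t (x := (y, 0)) (zero_mem_dom hc s)
      rw [hd, hd]
      refine sub_eq_zero.2 <| M.field_eq_field fun ξ hξ => ?_
      have h1 := (hr .lower).ne'
      have h2 := (hr .upper).ne'
      have h3 := M.dispersion ‖ξ‖ (hκ.trans hξ.1)
      simp only [pressureProfile, weight, par]
      field_simp
      linear_combination -h3
    bottom := fun t _ y => M.field_eq_zero fun ξ _ => by
      have : M.u .lower (M.par ξ) (-c.m) = 0 := (M.isMode .lower).wall _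
      simp [velocityProfile, normalProfile, this]
    top := fun t _ y => M.field_eq_zero fun ξ _ => by
      have : M.u .upper (M.par ξ) c.ℓ = 0 := (M.isMode .upper).wall _
      simp [velocityProfile, normalProfile, this] }

end GrowingModes

/-! ### Sobolev norms of the packets in terms of the mode energy -/

namespace GrowingModes

variable {c : Config} (M : GrowingModes c) {κ : ℝ}

/-- The spectral density of the Sobolev norm of the wave packet with symbol `m` and profile `f`. -/
def density (r : ℕ) (s : Phase) (m : Freq → ℂ) (f : ℝ × ℝ → ℝ → ℝ) (t : ℝ) (ξ : Freq) (z : ℝ) :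
    ℝ :=
  (1 + ‖ξ‖ ^ 2) ^ r * ((2 * Real.pi) ^ 2 *
    (‖m ξ‖ * |M.weight s ξ * f (M.par ξ) z| * Real.exp (M.rate ξ * t))) ^ 2

/-- The energy density of the two-component mode. -/
def modeEnergy (s : Phase) (ξ : Freq) (z : ℝ) : ℝ :=
  M.weight s ξ ^ 2 * (M.u s (M.par ξ) z ^ 2 + M.H s (M.par ξ) z ^ 2)

/-- The energy of the mode over the annulus of frequencies. -/
def energy (κ : ℝ) (s : Phase) : ℝ≥0∞ :=
  ∫⁻ z in c.interval s, ∫⁻ ξ in annulus κ, ENNReal.ofReal (M.modeEnergy s ξ z)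

theorem density_eq (r : ℕ) (s : Phase) (m : Freq → ℂ) (f : ℝ × ℝ → ℝ → ℝ) (t : ℝ) (ξ : Freq)
    (z : ℝ) : ENNReal.ofReal ((1 + ‖ξ‖ ^ 2) ^ r) * (ENNReal.ofReal ((2 * Real.pi) ^ 2) *
      ‖M.amp s m f ξ z * Real.exp (M.rate ξ * t)‖ₑ) ^ 2 =
    ENNReal.ofReal (M.density r s m f t ξ z) := by
  rw [← ofReal_norm, ← ENNReal.ofReal_mul (by positivity),
    ← ENNReal.ofReal_pow (by positivity), ← ENNReal.ofReal_mul (by positivity), density, amp,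
    norm_mul, norm_mul, Complex.norm_real, Complex.norm_real, Real.norm_eq_abs, Real.norm_eq_abs,
    Real.abs_exp]

variable (hc : c.Admissible) {s : Phase} {f : ℝ × ℝ → ℝ → ℝ} {m : Freq → ℂ}
include hc

theorem exists_profile_tower (hf : M.Profile s f) : ∃ F : ℕ → ℝ × ℝ → ℝ → ℝ, F 0 = f ∧
    (∀ j, M.Profile s (F j)) ∧
    ∀ j P, ∀ z ∈ Ioo (c.lo s) (c.hi s), HasDerivAt (F j P) (F (j + 1) P z) z := by
  choose d hd hd' using fun F : {f // M.Profile s f} => M.exists_profile_deriv hc F.2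
  let F : ℕ → {f // M.Profile s f} := fun n => Nat.rec ⟨f, hf⟩ (fun _ g => ⟨d g, hd g⟩) n
  exact ⟨fun n => (F n).1, rfl, fun n => (F n).2, fun j => hd' (F j)⟩

/-- The tower of vertical profiles depends on `f` only, not on κ, the symbol or the time; this
uniformity makes the later bounds polynomial in κ. -/
theorem exists_sobolevSq_field_eq (hf : M.Profile s f) : ∃ F : ℕ → ℝ × ℝ → ℝ → ℝ, F 0 = f ∧
    (∀ j, M.Profile s (F j)) ∧ ∀ (k : ℕ) (κ : ℝ) (m : Freq → ℂ) (t : ℝ), IsSymbol (annulus κ) m →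
      c.sobolevSq k s (M.field κ s m f t) = ∑ j ∈ Finset.range (k + 1), ∫⁻ z in c.interval s,
        ∫⁻ ξ in annulus κ, ENNReal.ofReal (M.density (k - j) s m (F j) t ξ z) := by
  obtain ⟨F, rfl, hF, hd⟩ := M.exists_profile_tower hc hf
  refine ⟨F, rfl, hF, fun k κ m t hm => ?_⟩
  have ht : VerticalTower (c.slab s) fun j => M.field κ s m (F j) t := by
    refine ⟨fun j => ?_, fun j x hx => ?_⟩
    · intro x hx
      obtain ⟨L, hL, -⟩ := M.hasFDerivAt_field_space hc (hF j) hm (hF (j + 1)) (hd j) t hx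
      exact hL.continuousAt.continuousWithinAt
    · obtain ⟨L, hL, -, h1⟩ := M.hasFDerivAt_field_space hc (hF j) hm (hF (j + 1)) (hd j) t hx
      have h2 : HasDerivAt (fun z : ℝ => (x.1, z)) ((0, 1) : Pt) x.2 :=
        (hasDerivAt_const _ _).prodMk (hasDerivAt_id _)
      exact (HasFDerivAt.comp_hasDerivAt (f := fun z : ℝ => (x.1, z)) x.2 hL h2).congr_deriv h1
  refine (c.sobolevSq_eq_of_tower k s ht).trans (Finset.sum_congr rfl fun j _ => ?_)
  refine setLIntegral_congr_fun (c.isOpen_interval s).measurableSet fun z hz => ?_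
  rw [c.interval_eq] at hz
  have := horizontalSq_cwave (M.isSpectrum κ)
    ((M.isAmplitude hc (hF j) hm).isSymbol z (Ioo_subset_Icc_self hz)) (k - j) t
  simp_rw [M.density_eq] at this
  exact this

theorem sobolevSq_field_mono (hf : M.Profile s f) {m' : Freq → ℂ} (hm : IsSymbol (annulus κ) m)
    (hm' : IsSymbol (annulus κ) m') (h : ∀ ξ ∈ annulus κ, ‖m ξ‖ ≤ ‖m' ξ‖) (k : ℕ) (t : ℝ) :
    c.sobolevSq k s (M.field κ s m f t) ≤ c.sobolevSq k s (M.field κ s m' f t) := by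
  obtain ⟨F, -, -, hF⟩ := M.exists_sobolevSq_field_eq hc hf
  rw [hF k κ m t hm, hF k κ m' t hm']
  refine Finset.sum_le_sum fun j _ => lintegral_mono fun z =>
    setLIntegral_mono' (measurableSet_annulus κ) fun ξ hξ => ENNReal.ofReal_le_ofReal ?_
  unfold density
  gcongr
  exact h ξ hξ

/-- Keep only the term without vertical derivatives and drop the weights (1 + |ξ|²)^k ≥ 1 and (2π)⁴
≥ 1. -/
theorem le_sobolevSq_field (hf : M.Profile s f) (hm : IsSymbol (annulus κ) m) (k : ℕ) (t : ℝ) :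
    ∫⁻ z in c.interval s, ∫⁻ ξ in annulus κ, ENNReal.ofReal
      ((‖m ξ‖ * |M.weight s ξ * f (M.par ξ) z| * Real.exp (M.rate ξ * t)) ^ 2) ≤
    c.sobolevSq k s (M.field κ s m f t) := by
  obtain ⟨F, hF0, -, hF⟩ := M.exists_sobolevSq_field_eq hc hf
  rw [hF k κ m t hm]
  refine le_trans ?_ (Finset.single_le_sum (fun _ _ => zero_le) (Finset.mem_range.2 k.succ_pos))
  refine lintegral_mono fun z => lintegral_mono fun ξ => ENNReal.ofReal_le_ofReal ?_
  have hπ : 1 ≤ (2 * Real.pi) ^ 2 := one_le_pow₀ (by linarith [Real.pi_gt_three])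
  have h1 : 1 ≤ (1 + ‖ξ‖ ^ 2) ^ (k - 0) := one_le_pow₀ (by nlinarith [norm_nonneg ξ])
  rw [density, hF0]
  set X := ‖m ξ‖ * |M.weight s ξ * f (M.par ξ) z| * Real.exp (M.rate ξ * t)
  have hX : 0 ≤ X := by positivity
  have h2 : X ^ 2 ≤ ((2 * Real.pi) ^ 2 * X) ^ 2 :=
    pow_le_pow_left₀ hX (le_mul_of_one_le_left hX hπ) 2
  exact h2.trans (le_mul_of_one_le_left (by positivity) h1)

/-- `ModeSpan.exists_bound` controls the profile by |u| + |H| times a power of the parameter size,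
which is at most D(κ + 1) on the annulus. -/
theorem exists_density_bound (hf : M.Profile s f) (r : ℕ) : ∃ φ : Polynomial ℝ,
    (∀ κ, 0 ≤ κ → 0 ≤ φ.eval κ) ∧ ∀ κ, 0 ≤ κ → ∀ (m : Freq → ℂ) (B t : ℝ), 0 ≤ t →
      ∀ ξ ∈ annulus κ, ‖m ξ‖ ≤ B → ∀ z ∈ c.interval s, M.density r s m f t ξ z ≤
        φ.eval κ * (B * Real.exp (√((κ + 1) * M.b) * t)) ^ 2 * M.modeEnergy s ξ z := by
  obtain ⟨C, N, hC, hb⟩ := hf.exists_bound (hc.Icc_subset_dom s)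
  have ha := M.a_pos
  have hb0 : 0 < M.b := ha.trans_le ((M.μ_mem 0).1.trans (M.μ_mem 0).2)
  set D : ℝ := 1 + 1 / M.a + M.b with hD
  have hD1 : 1 ≤ D := by have := one_div_pos.2 ha; linarith
  -- The factors bound, in order, the horizontal weight, the square of (2π)², the square of the
  -- profile constant, and (|u| + |H|)² ≤ 2(u² + H²).
  open Polynomial in
  refine ⟨(1 + (X + 1) ^ 2) ^ r * Polynomial.C ((2 * Real.pi) ^ 4) *
    (Polynomial.C C * (Polynomial.C D * (X + 1)) ^ N) ^ 2 * 2, fun κ hκ => ?_,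
    fun κ hκ m B t ht ξ hξ hB z hz => ?_⟩
  · simp only [Polynomial.eval_mul, Polynomial.eval_pow, Polynomial.eval_add, Polynomial.eval_X,
      Polynomial.eval_one, Polynomial.eval_C, Polynomial.eval_ofNat]
    positivity
  simp only [Polynomial.eval_mul, Polynomial.eval_pow, Polynomial.eval_add, Polynomial.eval_X,
    Polynomial.eval_one, Polynomial.eval_C, Polynomial.eval_ofNat]
  rw [c.interval_eq] at hz
  obtain ⟨⟨h1, h2⟩, h3, h4⟩ := M.par_mem hξ
  have hP1 : |(M.par ξ).1| ≤ D * (κ + 1) := by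
    rw [abs_of_nonneg h1]
    refine h2.trans ?_
    rw [div_eq_mul_one_div, mul_comm]
    gcongr
    linarith
  have hP2 : |(M.par ξ).2| ≤ D * (κ + 1) := by
    rw [abs_of_nonneg h3]
    refine h4.trans ?_
    rw [mul_comm]
    have := one_div_pos.2 ha
    gcongr
    linarith
  have hf1 := hb (M.par ξ) (D * (κ + 1)) (by nlinarith) hP1 hP2 z (Ioo_subset_Icc_self hz)
  have hexp : Real.exp (M.rate ξ * t) ≤ Real.exp (√((κ + 1) * M.b) * t) :=
    Real.exp_le_exp.2 (mul_le_mul_of_nonneg_right (M.rate_le hξ) ht)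
  have hB0 : 0 ≤ B := (norm_nonneg _).trans hB
  set G := C * (D * (κ + 1)) ^ N with hG
  have hG0 : 0 ≤ G := by positivity
  set E := Real.exp (√((κ + 1) * M.b) * t)
  set W := M.weight s ξ with hW
  set u := M.u s (M.par ξ) z with hu
  set H := M.H s (M.par ξ) z with hH
  have hsq : (|u| + |H|) ^ 2 ≤ 2 * (u ^ 2 + H ^ 2) := by
    rw [← sq_abs u, ← sq_abs H]
    nlinarith [sq_nonneg (|u| - |H|)]
  calc M.density r s m f t ξ z
      ≤ (1 + (κ + 1) ^ 2) ^ r * ((2 * Real.pi) ^ 2 * (B * (|W| * (G * (|u| + |H|))) * E)) ^ 2 := by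
        unfold density
        rw [abs_mul]
        have := hξ.2
        gcongr
    _ = (1 + (κ + 1) ^ 2) ^ r * (2 * Real.pi) ^ 4 * G ^ 2 * (B * E) ^ 2 * |W| ^ 2 *
          (|u| + |H|) ^ 2 := by ring
    _ ≤ (1 + (κ + 1) ^ 2) ^ r * (2 * Real.pi) ^ 4 * G ^ 2 * (B * E) ^ 2 * |W| ^ 2 *
          (2 * (u ^ 2 + H ^ 2)) := by gcongr
    _ = _ := by
        rw [sq_abs, modeEnergy]; ring

theorem exists_sobolevSq_field_le (hf : M.Profile s f) (k : ℕ) : ∃ φ : Polynomial ℝ,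
    (∀ κ, 0 ≤ κ → 0 ≤ φ.eval κ) ∧ ∀ κ, 0 ≤ κ → ∀ (m : Freq → ℂ) (B t : ℝ), 0 ≤ t →
      IsSymbol (annulus κ) m → (∀ ξ ∈ annulus κ, ‖m ξ‖ ≤ B) →
      c.sobolevSq k s (M.field κ s m f t) ≤ ENNReal.ofReal
        (φ.eval κ * (B * Real.exp (√((κ + 1) * M.b) * t)) ^ 2) * M.energy κ s := by
  obtain ⟨F, -, hF, hS⟩ := M.exists_sobolevSq_field_eq hc hf
  choose φ hφ hb using fun j => M.exists_density_bound hc (hF j) (k - j)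
  refine ⟨∑ j ∈ Finset.range (k + 1), φ j, fun κ hκ => ?_, fun κ hκ m B t ht hm hB => ?_⟩
  · rw [Polynomial.eval_finsetSum]
    exact Finset.sum_nonneg fun j _ => hφ j κ hκ
  rw [hS k κ m t hm, Polynomial.eval_finsetSum, Finset.sum_mul, ENNReal.ofReal_sum_of_nonneg
    (fun j _ => mul_nonneg (hφ j κ hκ) (sq_nonneg _)), Finset.sum_mul]
  refine Finset.sum_le_sum fun j _ => ?_
  rw [energy, ← lintegral_const_mul' _ _ ENNReal.ofReal_ne_top]
  refine setLIntegral_mono' (c.isOpen_interval s).measurableSet fun z hz => ?_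
  rw [← lintegral_const_mul' _ _ ENNReal.ofReal_ne_top]
  refine setLIntegral_mono' (measurableSet_annulus κ) fun ξ hξ => ?_
  rw [← ENNReal.ofReal_mul (mul_nonneg (hφ j κ hκ) (sq_nonneg _))]
  exact ENNReal.ofReal_le_ofReal (hb j κ hκ m B t ht ξ hξ (hB ξ hξ) z hz)

/-! ### The energy of the modes -/

omit hc in
theorem measurable_u (s : Phase) : Measurable fun p : ℝ × Freq => M.u s (M.par p.2) p.1 :=
  (M.isMode s).continuous_u.measurable.comp ((M.measurable_par.comp measurable_snd).prodMk
    measurable_fst)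

omit hc in
theorem measurable_H (s : Phase) : Measurable fun p : ℝ × Freq => M.H s (M.par p.2) p.1 :=
  (M.isMode s).continuous_H.measurable.comp ((M.measurable_par.comp measurable_snd).prodMk
    measurable_fst)

omit hc in
theorem measurable_modeEnergy (s : Phase) :
    Measurable fun p : ℝ × Freq => M.modeEnergy s p.2 p.1 :=
  (((M.measurable_weight s).comp measurable_snd).pow_const 2).mul
    (((M.measurable_u s).pow_const 2).add ((M.measurable_H s).pow_const 2))

omit hc in
theorem energy_lt_top (κ : ℝ) (s : Phase) : M.energy κ s < ⊤ := by
  have hK : IsCompact ((Icc 0 ((κ + 1) / M.a) ×ˢ Icc 0 ((κ + 1) * M.b)) ×ˢ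
      Icc (c.lo s) (c.hi s)) := (isCompact_Icc.prod isCompact_Icc).prod isCompact_Icc
  have hcont : Continuous fun p : (ℝ × ℝ) × ℝ => M.u s p.1 p.2 ^ 2 + M.H s p.1 p.2 ^ 2 :=
    ((M.isMode s).continuous_u.pow 2).add ((M.isMode s).continuous_H.pow 2)
  obtain ⟨C, hC⟩ := hK.exists_bound_of_continuousOn hcont.continuousOn
  obtain ⟨D, hD, hw⟩ := M.exists_weight_bound κ s
  have hb : M.energy κ s ≤ ∫⁻ z in c.interval s, ∫⁻ ξ in annulus κ, ENNReal.ofReal (D ^ 2 * C) := by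
    refine setLIntegral_mono' (c.isOpen_interval s).measurableSet fun z hz =>
      setLIntegral_mono' (measurableSet_annulus κ) fun ξ hξ => ENNReal.ofReal_le_ofReal ?_
    rw [c.interval_eq] at hz
    have h1 := hC (M.par ξ, z) ⟨M.par_mem hξ, Ioo_subset_Icc_self hz⟩
    have h2 := hw ξ hξ
    rw [modeEnergy, ← sq_abs (M.weight s ξ)]
    have h3 := (le_abs_self _).trans h1
    gcongr
  refine hb.trans_lt ?_
  rw [setLIntegral_const, setLIntegral_const, c.interval_eq, Real.volume_Ioo]
  exact ENNReal.mul_lt_top (ENNReal.mul_lt_top ENNReal.ofReal_lt_top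
    (M.isSpectrum κ).volume_lt_top) ENNReal.ofReal_lt_top

theorem weight_pos (hκ : 0 < κ) (s : Phase) {ξ : Freq} (hξ : ξ ∈ annulus κ) :
    0 < M.weight s ξ := by
  have hn : 0 < ‖ξ‖ := hκ.trans_le hξ.1
  have h1 : 0 < (M.par ξ).1 := div_pos hn (M.μ_pos _)
  have h2 : 0 ≤ (M.par ξ).2 := (mul_pos hn (M.μ_pos _)).le
  have hu := fun s => (M.isMode s).interface_u_pos _ h1 h2
  have hr := fun s => hc.rho0_pos s (zero_mem_dom hc s)
  cases s
  · exact div_pos (hu _) (hr _)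
  · exact div_pos (hu _) (hr _)

omit hc in
theorem volume_annulus_pos (hκ : 0 ≤ κ) : 0 < volume (annulus κ) := by
  have h1 : Metric.ball (EuclideanSpace.single (0 : Fin 2) (κ + 1 / 2)) (1 / 2) ⊆ annulus κ := by
    intro ξ hξ
    rw [mem_ball_iff_norm] at hξ
    have h2 : ‖EuclideanSpace.single (0 : Fin 2) (κ + 1 / 2)‖ = κ + 1 / 2 := by
      rw [PiLp.norm_single, Real.norm_eq_abs, abs_of_nonneg (by linarith)]
    have h3 := abs_le.1 (abs_norm_sub_norm_le ξ (EuclideanSpace.single (0 : Fin 2) (κ + 1 / 2)))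
    constructor <;> linarith [h3.1, h3.2]
  exact (Metric.measure_ball_pos _ _ (by norm_num)).trans_le (measure_mono h1)

/-- The weights are positive and |H| ≥ 1 throughout the layer, so the integrand is positive on a set
of positive measure. -/
theorem energy_pos (hκ : 0 < κ) (s : Phase) : 0 < M.energy κ s := by
  have hpos : ∀ z ∈ c.interval s, ∀ ξ ∈ annulus κ, 0 < M.modeEnergy s ξ z := by
    intro z hz ξ hξ
    rw [c.interval_eq] at hz
    have hn : 0 < ‖ξ‖ := hκ.trans_le hξ.1
    have h1 : 0 ≤ (M.par ξ).1 := (div_pos hn (M.μ_pos _)).le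
    have h2 : 0 ≤ (M.par ξ).2 := (mul_pos hn (M.μ_pos _)).le
    have h3 := (M.isMode s).one_le_H _ h1 h2 z (Ioo_subset_Icc_self hz)
    have h4 : M.H s (M.par ξ) z ≠ 0 := by
      rintro h
      rw [h, mul_zero] at h3
      linarith
    have := M.weight_pos hc hκ s hξ
    unfold modeEnergy
    positivity
  have hm := (M.measurable_modeEnergy s).ennreal_ofReal
  have hin : ∀ z ∈ c.interval s, 0 < ∫⁻ ξ in annulus κ, ENNReal.ofReal (M.modeEnergy s ξ z) := by
    intro z hz
    rw [setLIntegral_pos_iff (f := fun ξ => ENNReal.ofReal (M.modeEnergy s ξ z))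
      (hm.comp (measurable_prodMk_left (x := z))), inter_eq_self_of_subset_right]
    · exact volume_annulus_pos hκ.le
    · exact fun ξ hξ => (ENNReal.ofReal_pos.2 (hpos z hz ξ hξ)).ne'
  rw [energy, setLIntegral_pos_iff hm.lintegral_prod_right', inter_eq_self_of_subset_right]
  · rw [c.interval_eq, Real.volume_Ioo]
    exact ENNReal.ofReal_pos.2 (sub_pos.2 (hc.lo_lt_hi s))
  · exact fun z hz => (hin z hz).ne'

end GrowingModes

/-! ### Lower bound for the flow map -/

theorem lintegral_lintegral_add {X Y : Type*} [MeasurableSpace X] [MeasurableSpace Y]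
    {μ : Measure X} {ν : Measure Y} [SFinite ν] {F G : X → Y → ℝ≥0∞}
    (hF : Measurable fun p : X × Y => F p.1 p.2) :
    ∫⁻ x, ∫⁻ y, F x y + G x y ∂ν ∂μ = ∫⁻ x, ∫⁻ y, F x y ∂ν ∂μ + ∫⁻ x, ∫⁻ y, G x y ∂ν ∂μ := by
  rw [← lintegral_add_left hF.lintegral_prod_right']
  refine lintegral_congr fun x => ?_
  exact lintegral_add_left (hF.comp (measurable_prodMk_left (x := x))) _

namespace GrowingModes

variable {c : Config} (M : GrowingModes c) {κ : ℝ}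

theorem norm_symEta_horizontal (α : ℝ) (i : Fin 2) (ξ : Freq) :
    ‖M.symEta α i.castSucc ξ‖ = |α| * |ξ i| * (M.rate ξ)⁻¹ ^ 3 := by
  have hr : 0 ≤ M.rate ξ := Real.sqrt_nonneg _
  have hV : M.symV α i.castSucc ξ =
      α * ((M.rate ξ : ℂ)⁻¹ * ((M.rate ξ : ℂ)⁻¹ * (Complex.I * ξ i))) := by
    fin_cases i <;> rfl
  rw [symEta, hV]
  simp only [norm_mul, norm_inv, Complex.norm_real, Complex.norm_I, Real.norm_eq_abs,
    abs_of_nonneg hr]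
  ring

theorem norm_symEta_vertical (α : ℝ) (ξ : Freq) : ‖M.symEta α 2 ξ‖ = |α| * (M.rate ξ)⁻¹ := by
  have hr : 0 ≤ M.rate ξ := Real.sqrt_nonneg _
  have hV : M.symV α 2 ξ = α := rfl
  rw [symEta, hV]
  simp only [norm_mul, norm_inv, Complex.norm_real, Real.norm_eq_abs, abs_of_nonneg hr]
  ring

variable {κ : ℝ}

theorem one_le_rate (hκ : 1 ≤ κ * M.a) {ξ : Freq} (hξ : ξ ∈ annulus κ) : 1 ≤ M.rate ξ :=
  (Real.one_le_sqrt.2 hκ).trans (M.le_rate hξ)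

theorem norm_symEta_le (hκ : 1 ≤ κ * M.a) (α : ℝ) (i : Fin 3) {ξ : Freq} (hξ : ξ ∈ annulus κ) :
    ‖M.symEta α i ξ‖ ≤ ‖M.symV α i ξ‖ := by
  have h1 := M.one_le_rate hκ hξ
  rw [symEta, norm_mul, norm_inv, Complex.norm_real, Real.norm_eq_abs,
    abs_of_nonneg (zero_le_one.trans h1)]
  exact mul_le_of_le_one_left (norm_nonneg _) (inv_le_one_of_one_le₀ h1)

theorem norm_symV_le (hκ : 1 ≤ κ * M.a) (α : ℝ) (i : Fin 3) {ξ : Freq} (hξ : ξ ∈ annulus κ) :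
    ‖M.symV α i ξ‖ ≤ |α| * (κ + 1) := by
  have h1 := M.one_le_rate hκ hξ
  have h2 : (M.rate ξ)⁻¹ ≤ 1 := inv_le_one_of_one_le₀ h1
  have h0 : 0 ≤ (M.rate ξ)⁻¹ := inv_nonneg.2 (zero_le_one.trans h1)
  have hκ1 : ‖ξ‖ ≤ κ + 1 := hξ.2
  have hκ0 : 1 ≤ κ + 1 := by
    have := M.a_pos
    have : 0 < κ := pos_of_mul_pos_left (zero_lt_one.trans_le hκ) this.le
    linarith
  have horizontal : ∀ j : Fin 2,
      ‖(α : ℂ) * ((M.rate ξ : ℂ)⁻¹ * ((M.rate ξ : ℂ)⁻¹ * (Complex.I * ξ j)))‖ ≤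
        |α| * (κ + 1) := by
    intro j
    have h3 : |ξ j| ≤ κ + 1 := (PiLp.norm_apply_le ξ j).trans hκ1
    simp only [norm_mul, norm_inv, Complex.norm_real, Complex.norm_I, Real.norm_eq_abs,
      abs_of_nonneg (zero_le_one.trans h1), one_mul]
    refine mul_le_mul_of_nonneg_left ?_ (abs_nonneg _)
    exact (mul_le_of_le_one_left (by positivity) h2).trans
      ((mul_le_of_le_one_left (abs_nonneg _) h2).trans h3)
  fin_cases i
  · exact horizontal 0
  · exact horizontal 1
  · change ‖(α : ℂ)‖ ≤ _
    rw [Complex.norm_real, Real.norm_eq_abs]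
    exact le_mul_of_one_le_right (abs_nonneg _) hκ0

theorem norm_symQ_le (hκ : 1 ≤ κ * M.a) (α : ℝ) {ξ : Freq} (hξ : ξ ∈ annulus κ) :
    ‖M.symQ α ξ‖ ≤ |α| * (κ + 1) := by
  refine le_trans (le_of_eq ?_) ((M.norm_symEta_le hκ α 2 hξ).trans (M.norm_symV_le hκ α 2 hξ))
  have hr : 0 ≤ M.rate ξ := Real.sqrt_nonneg _
  rw [norm_symEta_vertical, symQ, norm_mul, norm_inv, Complex.norm_real, Complex.norm_real,
    Real.norm_eq_abs, Real.norm_eq_abs, abs_neg, abs_of_nonneg hr]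

variable (hc : c.Admissible)
include hc

/-- The horizontal components of η see H with symbol ξⱼ/λ³ and the vertical one sees u/ρ₀ with
symbol 1/λ. Together they recover u² + H², because ξ₀² + ξ₁² = |ξ|² ≥ 1, at the cost of powers of λ²
≤ (κ + 1)b. -/
theorem exists_le_sobolevSq_eta (s : Phase) : ∃ ψ : Polynomial ℝ, (∀ κ, 0 ≤ κ → 0 < ψ.eval κ) ∧
    ∀ κ, 1 ≤ κ → 1 ≤ κ * M.a → ∀ (k : ℕ) (α t : ℝ), 0 ≤ t →
      ENNReal.ofReal (α ^ 2 * Real.exp (√(κ * M.a) * t) ^ 2 / ψ.eval κ) * M.energy κ s ≤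
        ∑ i, c.sobolevSq k s (fun x => (M.state κ α).η s t x i) := by
  have ha := M.a_pos
  have hb0 : 0 < M.b := ha.trans_le ((M.μ_mem 0).1.trans (M.μ_mem 0).2)
  obtain ⟨B, hB⟩ := isCompact_Icc.exists_bound_of_continuousOn
    ((hc.contDiffOn_rho0 s).continuousOn.mono (hc.Icc_subset_dom s))
  -- The cube pays for λ⁶ in the horizontal components and also for λ² in the vertical one; 1 + B²
  -- pays for ρ₀² there.
  open Polynomial in
  refine ⟨(1 + (X + 1) * Polynomial.C M.b) ^ 3 * (1 + Polynomial.C B ^ 2), fun κ hκ => ?_,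
    fun κ hκ hκa k α t ht => ?_⟩
  · simp only [Polynomial.eval_mul, Polynomial.eval_pow, Polynomial.eval_add, Polynomial.eval_X,
      Polynomial.eval_one, Polynomial.eval_C]
    positivity
  simp only [Polynomial.eval_mul, Polynomial.eval_pow, Polynomial.eval_add, Polynomial.eval_X,
    Polynomial.eval_one, Polynomial.eval_C]
  set E := Real.exp (√(κ * M.a) * t) with hE
  set Ψ := (1 + (κ + 1) * M.b) ^ 3 * (1 + B ^ 2) with hΨ
  set d := α ^ 2 * E ^ 2 / Ψ with hd
  have hκ0 : 0 < κ := zero_lt_one.trans_le hκ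
  have hΨ0 : 0 < Ψ := by positivity
  have hd0 : 0 ≤ d := by positivity
  let G : Fin 3 → Freq → ℝ → ℝ :=
    ![fun ξ z => d * (M.weight s ξ ^ 2 * M.H s (M.par ξ) z ^ 2 * ξ 0 ^ 2),
      fun ξ z => d * (M.weight s ξ ^ 2 * M.H s (M.par ξ) z ^ 2 * ξ 1 ^ 2),
      fun ξ z => d * (M.weight s ξ ^ 2 * M.u s (M.par ξ) z ^ 2)]
  have hGm : ∀ i, Measurable fun p : ℝ × Freq => ENNReal.ofReal (G i p.2 p.1) := by
    intro i
    have h1 := M.measurable_u s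
    have h2 := M.measurable_H s
    have h3 : Measurable fun p : ℝ × Freq => M.weight s p.2 :=
      (M.measurable_weight s).comp measurable_snd
    have h4 : ∀ j : Fin 2, Measurable fun p : ℝ × Freq => p.2 j := fun j => by fun_prop
    refine Measurable.ennreal_ofReal ?_
    fin_cases i
    · exact (((h3.pow_const 2).mul (h2.pow_const 2)).mul ((h4 0).pow_const 2)).const_mul d
    · exact (((h3.pow_const 2).mul (h2.pow_const 2)).mul ((h4 1).pow_const 2)).const_mul d
    · exact ((h3.pow_const 2).mul (h1.pow_const 2)).const_mul d
  have hsum : ENNReal.ofReal d * M.energy κ s ≤ ∑ i, ∫⁻ z in c.interval s, ∫⁻ ξ in annulus κ,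
      ENNReal.ofReal (G i ξ z) := by
    rw [Fin.sum_univ_three, ← lintegral_lintegral_add (hGm 0),
      ← lintegral_lintegral_add ((hGm 0).add (hGm 1)), energy,
      ← lintegral_const_mul' _ _ ENNReal.ofReal_ne_top]
    refine lintegral_mono fun z => ?_
    rw [← lintegral_const_mul' _ _ ENNReal.ofReal_ne_top]
    refine setLIntegral_mono' (measurableSet_annulus κ) fun ξ hξ => ?_
    have h0 : ∀ i, 0 ≤ G i ξ z := by
      intro i
      fin_cases i
      · change 0 ≤ d * (M.weight s ξ ^ 2 * M.H s (M.par ξ) z ^ 2 * ξ 0 ^ 2); positivity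
      · change 0 ≤ d * (M.weight s ξ ^ 2 * M.H s (M.par ξ) z ^ 2 * ξ 1 ^ 2); positivity
      · change 0 ≤ d * (M.weight s ξ ^ 2 * M.u s (M.par ξ) z ^ 2); positivity
    rw [← ENNReal.ofReal_mul hd0, ← ENNReal.ofReal_add (h0 0) (h0 1),
      ← ENNReal.ofReal_add (add_nonneg (h0 0) (h0 1)) (h0 2)]
    apply ENNReal.ofReal_le_ofReal
    have h2 : ‖ξ‖ ^ 2 = ξ 0 ^ 2 + ξ 1 ^ 2 := by
      rw [EuclideanSpace.norm_sq_eq]; simp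
    have h3 : 1 ≤ ξ 0 ^ 2 + ξ 1 ^ 2 := h2 ▸ one_le_pow₀ (hκ.trans hξ.1)
    change d * M.modeEnergy s ξ z ≤ d * (M.weight s ξ ^ 2 * M.H s (M.par ξ) z ^ 2 * ξ 0 ^ 2) +
      d * (M.weight s ξ ^ 2 * M.H s (M.par ξ) z ^ 2 * ξ 1 ^ 2) +
      d * (M.weight s ξ ^ 2 * M.u s (M.par ξ) z ^ 2)
    have h4 : 0 ≤ d * (M.weight s ξ ^ 2 * M.H s (M.par ξ) z ^ 2) := by positivity
    rw [modeEnergy]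
    linear_combination mul_le_mul_of_nonneg_left h3 h4
  refine hsum.trans (Finset.sum_le_sum fun i _ => ?_)
  refine le_trans ?_ (M.le_sobolevSq_field hc (M.profile_velocity hc s i)
    (M.isSymbol_symEta hκ0 α i) k t)
  refine setLIntegral_mono' (c.isOpen_interval s).measurableSet fun z hz =>
    setLIntegral_mono' (measurableSet_annulus κ) fun ξ hξ => ENNReal.ofReal_le_ofReal ?_
  rw [c.interval_eq] at hz
  have hz' := Ioo_subset_Icc_self hz
  set r := M.rate ξ with hr
  have hr1 : 1 ≤ r := M.one_le_rate hκa hξ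
  have hr0 : 0 < r := zero_lt_one.trans_le hr1
  have hrsq : r ^ 2 ≤ (κ + 1) * M.b := by
    rw [hr, rate_sq]
    exact mul_le_mul hξ.2 (M.μ_mem _).2 (M.μ_pos _).le (by positivity)
  have hexp : E ^ 2 ≤ Real.exp (r * t) ^ 2 := by
    refine pow_le_pow_left₀ (Real.exp_pos _).le ?_ 2
    exact Real.exp_le_exp.2 (mul_le_mul_of_nonneg_right (M.le_rate hξ) ht)
  have hr6 : r ^ 6 ≤ Ψ := by
    have h1 : r ^ 6 = (r ^ 2) ^ 3 := by ring
    have h2 : (r ^ 2) ^ 3 ≤ (1 + (κ + 1) * M.b) ^ 3 := by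
      gcongr
      linarith
    rw [h1]
    exact h2.trans (le_mul_of_one_le_right (by positivity) (by nlinarith [sq_nonneg B]))
  have hd6 : d ≤ α ^ 2 * Real.exp (r * t) ^ 2 * r⁻¹ ^ 6 := by
    rw [hd, inv_pow, ← div_eq_mul_inv]
    gcongr
  have horizontal : ∀ j : Fin 2, d * (M.weight s ξ ^ 2 * M.H s (M.par ξ) z ^ 2 * ξ j ^ 2) ≤
      (‖M.symEta α j.castSucc ξ‖ * |M.weight s ξ * M.tangentialProfile s (M.par ξ) z| *
        Real.exp (r * t)) ^ 2 := by
    intro j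
    rw [norm_symEta_horizontal, tangentialProfile, one_mul, mul_pow, mul_pow, mul_pow, mul_pow,
      sq_abs, sq_abs, sq_abs]
    calc _ ≤ α ^ 2 * Real.exp (r * t) ^ 2 * r⁻¹ ^ 6 *
          (M.weight s ξ ^ 2 * M.H s (M.par ξ) z ^ 2 * ξ j ^ 2) := by gcongr
      _ = _ := by ring
  fin_cases i
  · exact horizontal 0
  · exact horizontal 1
  · change d * (M.weight s ξ ^ 2 * M.u s (M.par ξ) z ^ 2) ≤
      (‖M.symEta α 2 ξ‖ * |M.weight s ξ * ((c.rho0 s z)⁻¹ * M.u s (M.par ξ) z)| *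
        Real.exp (r * t)) ^ 2
    have hρ := hc.rho0_pos s (hc.Icc_subset_dom s hz')
    have hρB : c.rho0 s z ^ 2 ≤ 1 + B ^ 2 := by
      have h1 := (le_abs_self _).trans (hB z hz')
      nlinarith
    have h2 : r ^ 2 ≤ (1 + (κ + 1) * M.b) ^ 3 := by
      have h3 : 1 ≤ 1 + (κ + 1) * M.b := by nlinarith
      calc r ^ 2 ≤ 1 + (κ + 1) * M.b := by linarith
        _ ≤ _ := le_self_pow₀ h3 (by norm_num)
    have hd2 : d ≤ α ^ 2 * Real.exp (r * t) ^ 2 * (r⁻¹ ^ 2 * (c.rho0 s z)⁻¹ ^ 2) := by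
      rw [hd, inv_pow, inv_pow, ← mul_inv, ← div_eq_mul_inv]
      have : r ^ 2 * c.rho0 s z ^ 2 ≤ Ψ := mul_le_mul h2 hρB (sq_nonneg _) (by positivity)
      gcongr
    rw [norm_symEta_vertical, mul_pow, mul_pow, mul_pow, sq_abs, sq_abs]
    calc _ ≤ α ^ 2 * Real.exp (r * t) ^ 2 * (r⁻¹ ^ 2 * (c.rho0 s z)⁻¹ ^ 2) *
          (M.weight s ξ ^ 2 * M.u s (M.par ξ) z ^ 2) := by gcongr
      _ = _ := by ring

end GrowingModes

/-! ### Choice of amplitude and frequency, and ill-posedness -/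

theorem stateNorm_diff_zero (c : Config) (k : ℕ) (X Z : State) (hη : Z.η = 0) (hv : Z.v = 0)
    (hq : Z.q = 0) (t : ℝ) : stateNorm c k (Z.diff X) t = stateNorm c k X t := by
  simp only [stateNorm, Config.hNormVec, Config.hNorm, State.diff, hη, hv, hq, Pi.zero_apply,
    zero_sub, Config.sobolevSq_neg]

namespace GrowingModes

variable {c : Config} (M : GrowingModes c)

/-- The total energy of the modes over the annulus of frequencies. -/
def totalEnergy (κ : ℝ) : ℝ≥0∞ := M.energy κ .lower + M.energy κ .upper

theorem totalEnergy_lt_top (κ : ℝ) : M.totalEnergy κ < ⊤ :=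
  ENNReal.add_lt_top.2 ⟨M.energy_lt_top κ _, M.energy_lt_top κ _⟩

theorem field_zero (κ t : ℝ) (s : Phase) (f : ℝ × ℝ → ℝ → ℝ) {m : Freq → ℂ} (hm : m = 0) :
    M.field κ s m f t = 0 := by
  funext x
  simp [field, cwave, amp, hm]

theorem symV_zero (i : Fin 3) : M.symV 0 i = 0 := by
  funext ξ
  fin_cases i <;> simp [symV]

theorem state_zero (κ : ℝ) :
    (M.state κ 0).η = 0 ∧ (M.state κ 0).v = 0 ∧ (M.state κ 0).q = 0 := by
  refine ⟨?_, ?_, ?_⟩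
  · funext s t x i
    have : M.symEta 0 i = 0 := by funext ξ; simp [symEta, symV_zero]
    exact congrFun (M.field_zero κ t s _ this) x
  · funext s t x i
    exact congrFun (M.field_zero κ t s _ (M.symV_zero i)) x
  · funext s t x
    have : M.symQ 0 = 0 := by funext ξ; simp [symQ]
    exact congrFun (M.field_zero κ t s _ this) x

variable (hc : c.Admissible)
include hc

theorem totalEnergy_pos {κ : ℝ} (hκ : 0 < κ) : 0 < M.totalEnergy κ :=
  (M.energy_pos hc hκ .lower).trans_le le_self_add

/-- All symbols are at most |α|(κ + 1) once λ ≥ 1, so η, v and q share one bound; the factor 3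
counts them. -/
theorem exists_stateNorm_le (k : ℕ) : ∃ Φ : Polynomial ℝ, (∀ κ, 0 ≤ κ → 0 ≤ Φ.eval κ) ∧
    ∀ κ, 1 ≤ κ → 1 ≤ κ * M.a → ∀ α t : ℝ, 0 ≤ t → stateNorm c k (M.state κ α) t ≤
      3 * (ENNReal.ofReal (Φ.eval κ * (α * Real.exp (√((κ + 1) * M.b) * t)) ^ 2) *
        M.totalEnergy κ) ^ (1 / 2 : ℝ) := by
  choose φ hφ hφb using fun (s : Phase) (i : Fin 3) =>
    M.exists_sobolevSq_field_le hc (M.profile_velocity hc s i) k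
  choose χ hχ hχb using fun (s : Phase) => M.exists_sobolevSq_field_le hc (M.profile_density hc s) k
  have hS : ∀ κ, 0 ≤ κ → ∀ s, 0 ≤ ∑ i, (φ s i).eval κ := fun κ hκ s =>
    Finset.sum_nonneg fun i _ => hφ s i κ hκ
  open Polynomial in
  refine ⟨(X + 1) ^ 2 * (∑ i, φ .lower i + ∑ i, φ .upper i + χ .lower + χ .upper),
    fun κ hκ => ?_, fun κ hκ hκa α t ht => ?_⟩
  · simp only [Polynomial.eval_mul, Polynomial.eval_pow, Polynomial.eval_add, Polynomial.eval_X,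
      Polynomial.eval_one, Polynomial.eval_finsetSum]
    have h1 := hS κ hκ .lower
    have h2 := hS κ hκ .upper
    have h3 := hχ .lower κ hκ
    have h4 := hχ .upper κ hκ
    positivity
  have hκ0 : 0 < κ := zero_lt_one.trans_le hκ
  simp only [Polynomial.eval_mul, Polynomial.eval_pow, Polynomial.eval_add, Polynomial.eval_X,
    Polynomial.eval_one, Polynomial.eval_finsetSum]
  set E := Real.exp (√((κ + 1) * M.b) * t) with hE
  have hl := hS κ hκ0.le .lower
  have hu := hS κ hκ0.le .upper
  have hcl := hχ .lower κ hκ0.le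
  have hcu := hχ .upper κ hκ0.le
  set φl := ∑ i, (φ .lower i).eval κ with hφl
  set φu := ∑ i, (φ .upper i).eval κ with hφu
  set Y := (|α| * (κ + 1) * E) ^ 2 with hY
  have hY0 : 0 ≤ Y := by positivity
  have hYe : (κ + 1) ^ 2 * (φl + φu + (χ .lower).eval κ + (χ .upper).eval κ) * (α * E) ^ 2 =
      (φl + φu + (χ .lower).eval κ + (χ .upper).eval κ) * Y := by
    rw [hY, mul_pow, mul_pow, mul_pow, sq_abs]; ring
  rw [hYe]
  have vec : ∀ m : Fin 3 → Freq → ℂ, (∀ i, IsSymbol (annulus κ) (m i)) →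
      (∀ i, ∀ ξ ∈ annulus κ, ‖m i ξ‖ ≤ |α| * (κ + 1)) →
      ∑ i, (c.sobolevSq k .lower (M.field κ .lower (m i) (M.velocityProfile .lower i) t) +
        c.sobolevSq k .upper (M.field κ .upper (m i) (M.velocityProfile .upper i) t)) ≤
      ENNReal.ofReal ((φl + φu + (χ .lower).eval κ + (χ .upper).eval κ) * Y) *
        M.totalEnergy κ := by
    intro m hm hmb
    have h1 : ∀ s, ∑ i, c.sobolevSq k s (M.field κ s (m i) (M.velocityProfile s i) t) ≤
        ENNReal.ofReal ((∑ i, (φ s i).eval κ) * Y) * M.energy κ s := by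
      intro s
      rw [Finset.sum_mul, ENNReal.ofReal_sum_of_nonneg
        (fun i _ => mul_nonneg (hφ s i κ hκ0.le) hY0), Finset.sum_mul]
      exact Finset.sum_le_sum fun i _ => hφb s i κ hκ0.le (m i) _ t ht (hm i) (hmb i)
    rw [Finset.sum_add_distrib, totalEnergy, mul_add]
    refine add_le_add ((h1 _).trans ?_) ((h1 _).trans ?_)
    · gcongr; linarith
    · gcongr; linarith
  have hη := vec (M.symEta α) (M.isSymbol_symEta hκ0 α) fun i ξ hξ =>
    (M.norm_symEta_le hκa α i hξ).trans (M.norm_symV_le hκa α i hξ)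
  have hv := vec (M.symV α) (M.isSymbol_symV hκ0 α) fun i ξ hξ => M.norm_symV_le hκa α i hξ
  have hq : c.sobolevSq k .lower (M.field κ .lower (M.symQ α) (M.densityProfile .lower) t) +
      c.sobolevSq k .upper (M.field κ .upper (M.symQ α) (M.densityProfile .upper) t) ≤
      ENNReal.ofReal ((φl + φu + (χ .lower).eval κ + (χ .upper).eval κ) * Y) *
        M.totalEnergy κ := by
    have h1 := fun s => hχb s κ hκ0.le (M.symQ α) (|α| * (κ + 1)) t ht (M.isSymbol_symQ hκ0 α)
      fun ξ hξ => M.norm_symQ_le hκa α hξ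
    rw [totalEnergy, mul_add]
    refine add_le_add ((h1 _).trans ?_) ((h1 _).trans ?_)
    · rw [← hY]
      gcongr; linarith
    · rw [← hY]
      gcongr; linarith
  have e3 : ∀ x : ℝ≥0∞, 3 * x = x + x + x := fun x => by ring
  rw [e3]
  refine add_le_add (add_le_add ?_ ?_) ?_
  · exact ENNReal.rpow_le_rpow hη (by norm_num)
  · exact ENNReal.rpow_le_rpow hv (by norm_num)
  · exact ENNReal.rpow_le_rpow hq (by norm_num)

theorem isSolutionIn_state {κ : ℝ} (hκ : M.k₀ ≤ κ) (hκa : 1 ≤ κ * M.a) (k : ℕ) (α : ℝ) :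
    IsSolutionIn c k (M.state κ α) := by
  refine ⟨M.isSolution_state hc hκ α, fun t ht => ?_⟩
  obtain ⟨Φ, -, hΦ⟩ := M.exists_stateNorm_le hc k
  refine (hΦ κ (M.one_le.trans hκ) hκa α t ht).trans_lt ?_
  refine ENNReal.mul_lt_top (by simp) (ENNReal.rpow_lt_top_of_nonneg (by norm_num) ?_)
  exact (ENNReal.mul_lt_top ENNReal.ofReal_lt_top (M.totalEnergy_lt_top κ)).ne

theorem exists_le_hNormVec_eta : ∃ Ψ : Polynomial ℝ, (∀ κ, 0 ≤ κ → 0 < Ψ.eval κ) ∧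
    ∀ κ, 1 ≤ κ → 1 ≤ κ * M.a → ∀ (k : ℕ) (α t : ℝ), 0 ≤ t →
      (ENNReal.ofReal (α ^ 2 * Real.exp (√(κ * M.a) * t) ^ 2 / Ψ.eval κ) *
        M.totalEnergy κ) ^ (1 / 2 : ℝ) ≤ c.hNormVec k (fun s => (M.state κ α).η s t) := by
  choose ψ hψ hψb using fun s => M.exists_le_sobolevSq_eta hc s
  refine ⟨ψ .lower + ψ .upper, fun κ hκ => ?_, fun κ hκ hκa k α t ht => ?_⟩
  · rw [Polynomial.eval_add]
    exact add_pos (hψ _ κ hκ) (hψ _ κ hκ)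
  rw [Polynomial.eval_add]
  refine ENNReal.rpow_le_rpow ?_ (by norm_num)
  have h1 := fun s => hψ s κ (zero_le_one.trans hκ)
  rw [Finset.sum_add_distrib, totalEnergy, mul_add]
  refine add_le_add (le_trans ?_ (hψb _ κ hκ hκa k α t ht))
    (le_trans ?_ (hψb _ κ hκ hκa k α t ht))
  · have := h1 .lower
    gcongr
    linarith [h1 .upper]
  · have := h1 .lower
    have := h1 .upper
    gcongr
    linarith

/-- The symbols of η are those of v divided by λ, and λ ≥ 1 on the annulus. -/
theorem hNormVec_eta_le {κ : ℝ} (hκ : 0 < κ) (hκa : 1 ≤ κ * M.a) (k : ℕ) (α t : ℝ) :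
    c.hNormVec k (fun s => (M.state κ α).η s t) ≤ c.hNormVec k (fun s => (M.state κ α).v s t) := by
  refine ENNReal.rpow_le_rpow (Finset.sum_le_sum fun i _ => ?_) (by norm_num)
  have h : ∀ s, c.sobolevSq k s (fun x => (M.state κ α).η s t x i) ≤
      c.sobolevSq k s (fun x => (M.state κ α).v s t x i) := fun s =>
    M.sobolevSq_field_mono hc (M.profile_velocity hc s i) (M.isSymbol_symEta hκ α i)
      (M.isSymbol_symV hκ α i) (fun ξ hξ => M.norm_symEta_le hκa α i hξ) k t
  exact add_le_add (h _) (h _)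

end GrowingModes

open Filter in
/-- A polynomial is dominated by `κ ↦ exp (δ √κ)`. -/
theorem tendsto_eval_div_exp_sqrt (p : Polynomial ℝ) {δ : ℝ} (hδ : 0 < δ) :
    Tendsto (fun κ => p.eval κ / Real.exp (δ * √κ)) atTop (nhds 0) := by
  have h1 := (p.comp (Polynomial.C (1 / δ ^ 2) * Polynomial.X ^ 2)).tendsto_div_exp_atTop.comp
    (Real.tendsto_sqrt_atTop.const_mul_atTop hδ)
  refine h1.congr' ?_
  filter_upwards [eventually_ge_atTop 0] with κ hκ
  have : 1 / δ ^ 2 * (δ * √κ) ^ 2 = κ := by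
    rw [mul_pow, Real.sq_sqrt hκ]; field_simp
  simp [-one_div, this]

/-- One choice of κ and α serves every `k`, because the lower bound for η uses only its L² part and
its polynomial does not depend on `k`. -/
theorem Config.Admissible.exists_small_growing_solution {c : Config} (hc : c.Admissible) (j : ℕ)
    {T₀ A ε : ℝ} (hT : 0 < T₀) (hε : 0 < ε) : ∃ X : State, IsSolutionIn c j X ∧
      stateNorm c j X 0 ≤ ENNReal.ofReal ε ∧ ∀ (k : ℕ) (t : ℝ), T₀ ≤ t →
        c.hNormVec k (fun s => X.η s t) ≤ c.hNormVec k (fun s => X.v s t) ∧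
        ENNReal.ofReal A ≤ c.hNormVec k (fun s => X.η s t) := by
  obtain ⟨M⟩ := hc.nonempty_growingModes
  have ha := M.a_pos
  obtain ⟨Φ, hΦ, hup⟩ := M.exists_stateNorm_le hc j
  obtain ⟨Ψ, hΨ, hlow⟩ := M.exists_le_hNormVec_eta hc
  have hδ : 0 < 2 * √M.a * T₀ := by positivity
  -- The ratio of the upper to the lower constant is Ψ(Φ + 1); the factor 9A²/ε² is what turns size
  -- ε at time zero into size A at time T₀.
  have hlim := tendsto_eval_div_exp_sqrt
    (Polynomial.C (9 * A ^ 2 / ε ^ 2) * Ψ * (Φ + 1)) hδ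
  obtain ⟨κ, hκ1, hκ2, hκ3⟩ := (((hlim.eventually (gt_mem_nhds zero_lt_one)).and
    ((Filter.eventually_ge_atTop M.k₀).and (Filter.eventually_ge_atTop (1 / M.a))))).exists
  have hκa : 1 ≤ κ * M.a := (div_le_iff₀ ha).1 hκ3
  have hκ : 1 ≤ κ := M.one_le.trans hκ2
  have hκ0 : 0 < κ := zero_lt_one.trans_le hκ
  have hE := (ENNReal.toReal_pos (M.totalEnergy_pos hc hκ0).ne' (M.totalEnergy_lt_top κ).ne)
  have hEe : M.totalEnergy κ = ENNReal.ofReal (M.totalEnergy κ).toReal :=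
    (ENNReal.ofReal_toReal (M.totalEnergy_lt_top κ).ne).symm
  set e := (M.totalEnergy κ).toReal
  set φ := Φ.eval κ with hφ
  set ψ := Ψ.eval κ with hψ
  have hφ0 : 0 ≤ φ := hΦ κ hκ0.le
  have hψ0 : 0 < ψ := hΨ κ hκ0.le
  -- Normalized so that three times the square root of φα²e is at most ε; φ + 1 replaces φ, which
  -- may vanish.
  set α : ℝ := ε / (3 * √((φ + 1) * e)) with hα
  have hα2 : α ^ 2 * ((φ + 1) * e) = ε ^ 2 / 9 := by
    rw [hα, div_pow, mul_pow, Real.sq_sqrt (by positivity)]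
    field_simp
    norm_num
  have hroot : ∀ {x y : ℝ}, 0 ≤ x → 0 ≤ y → (ENNReal.ofReal x * ENNReal.ofReal y) ^ (1 / 2 : ℝ) =
      ENNReal.ofReal (√(x * y)) := by
    intro x y hx hy
    rw [← ENNReal.ofReal_mul hx, ENNReal.ofReal_rpow_of_nonneg (mul_nonneg hx hy) (by norm_num),
      Real.sqrt_eq_rpow]
  refine ⟨M.state κ α, M.isSolutionIn_state hc hκ2 hκa j α, ?_, fun k t ht =>
    ⟨M.hNormVec_eta_le hc hκ0 hκa k α t, ?_⟩⟩
  · refine (hup κ hκ hκa α 0 le_rfl).trans ?_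
    rw [mul_zero, Real.exp_zero, mul_one, hEe, hroot (by positivity) hE.le]
    have h3 : (3 : ℝ≥0∞) = ENNReal.ofReal 3 := by simp
    rw [h3, ← ENNReal.ofReal_mul (by norm_num)]
    apply ENNReal.ofReal_le_ofReal
    have h4 : √(φ * α ^ 2 * e) ≤ ε / 3 := by
      refine Real.sqrt_le_iff.2 ⟨by positivity, ?_⟩
      have h5 : φ * α ^ 2 * e ≤ α ^ 2 * ((φ + 1) * e) := by
        nlinarith [mul_nonneg (sq_nonneg α) hE.le]
      rw [hα2] at h5
      linarith [show (ε / 3) ^ 2 = ε ^ 2 / 9 by ring]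
    linarith
  · have ht0 : 0 ≤ t := hT.le.trans ht
    refine le_trans ?_ (hlow κ hκ hκa k α t ht0)
    rw [hEe, hroot (by positivity) hE.le]
    apply ENNReal.ofReal_le_ofReal
    apply Real.le_sqrt_of_sq_le
    have h1 : Real.exp (2 * √M.a * T₀ * √κ) ≤ Real.exp (√(κ * M.a) * t) ^ 2 := by
      rw [← Real.exp_nat_mul, Real.sqrt_mul hκ0.le]
      apply Real.exp_le_exp.2
      push_cast
      have : 0 ≤ √κ * √M.a := by positivity
      nlinarith [mul_le_mul_of_nonneg_left ht this]
    have h2 : 9 * A ^ 2 / ε ^ 2 * ψ * (φ + 1) ≤ Real.exp (√(κ * M.a) * t) ^ 2 := by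
      have h3 := (div_lt_one (Real.exp_pos _)).1 hκ1
      simp only [Polynomial.eval_mul, Polynomial.eval_C, Polynomial.eval_add,
        Polynomial.eval_one] at h3
      exact h3.le.trans h1
    have h4 : α ^ 2 * e = ε ^ 2 / 9 / (φ + 1) := by
      rw [← hα2]; field_simp
    calc A ^ 2 = ε ^ 2 / 9 / (φ + 1) * (9 * A ^ 2 / ε ^ 2 * ψ * (φ + 1)) / ψ := by field_simp
      _ ≤ α ^ 2 * e * Real.exp (√(κ * M.a) * t) ^ 2 / ψ := by
        rw [h4]; gcongr
      _ = _ := by ring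

/-- Continuity fails already at the zero solution, represented by a packet of amplitude 0: with ε =
1, data smaller than any δ reach norm at least 1 at time T. -/
theorem Config.Admissible.hadamardIllPosed {c : Config} (hc : c.Admissible) (k : ℕ) :
    HadamardIllPosed c k := by
  intro T hT hdep
  obtain ⟨M⟩ := hc.nonempty_growingModes
  obtain ⟨κ, hκ, hκ'⟩ := ((Filter.eventually_ge_atTop M.k₀).and
    (Filter.eventually_ge_atTop (1 / M.a))).exists
  obtain ⟨h1, h2, h3⟩ := M.state_zero κ
  have hZ := M.isSolutionIn_state hc hκ ((div_le_iff₀ M.a_pos).1 hκ') k 0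
  obtain ⟨δ, hδ, h⟩ := hdep _ hZ 1 one_pos
  obtain ⟨X, hX, hX0, hXT⟩ := hc.exists_small_growing_solution k (A := 1) hT (half_pos hδ)
  have h4 := h X hX (by
    rw [stateNorm_diff_zero c k X _ h1 h2 h3]
    exact hX0.trans_lt ((ENNReal.ofReal_lt_ofReal_iff hδ).2 (half_lt_self hδ))) T ⟨hT.le, le_rfl⟩
  rw [stateNorm_diff_zero c k X _ h1 h2 h3] at h4
  refine absurd ((hXT k T le_rfl).2.trans ?_) h4.not_ge
  rw [stateNorm, add_assoc]
  exact le_self_add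

end RT

end

theorem theorem4p5 (c : RT.Config) (hc : c.Admissible) :
    (∀ k : ℕ, RT.HadamardIllPosed c k) ∧
    ∀ k j : ℕ, k ≤ j → ∀ T₀ α : ℝ, 0 < T₀ → 0 < α →
      ∃ X : ℕ → RT.State, ∀ n : ℕ, 1 ≤ n →
        RT.IsSolutionIn c j (X n) ∧
        c.hNormVec j (fun s => (X n).η s 0) + c.hNormVec j (fun s => (X n).v s 0) +
          c.hNorm j (fun s => (X n).q s 0) ≤ ENNReal.ofReal (1 / (n : ℝ)) ∧
        ∀ t : ℝ, T₀ ≤ t →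
          c.hNormVec k (fun s => (X n).η s t) ≤ c.hNormVec k (fun s => (X n).v s t) ∧
          ENNReal.ofReal α ≤ c.hNormVec k (fun s => (X n).η s t) := by
  refine ⟨hc.hadamardIllPosed, fun k j _ T₀ α hT _ => ?_⟩
  have h : ∀ n : ℕ, ∃ X, 1 ≤ n → RT.IsSolutionIn c j X ∧
      RT.stateNorm c j X 0 ≤ ENNReal.ofReal (1 / (n : ℝ)) ∧ ∀ (k : ℕ) (t : ℝ), T₀ ≤ t →
        c.hNormVec k (fun s => X.η s t) ≤ c.hNormVec k (fun s => X.v s t) ∧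
        ENNReal.ofReal α ≤ c.hNormVec k (fun s => X.η s t) := by
    intro n
    by_cases hn : 1 ≤ n
    · obtain ⟨X, hX⟩ := hc.exists_small_growing_solution j (A := α) (ε := 1 / (n : ℝ)) hT
        (one_div_pos.2 (Nat.cast_pos.2 hn))
      exact ⟨X, fun _ => hX⟩
    -- For n = 0 nothing is required, so an arbitrary state fills the sequence.
    · exact ⟨⟨0, 0, 0⟩, fun h => absurd h hn⟩
  choose X hX using h
  exact ⟨X, fun n hn => ⟨(hX n hn).1, (hX n hn).2.1, (hX n hn).2.2 k⟩⟩
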